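/- **Corollary (adequacy of the LF encoding with respect to CP).** *CP.* Session types are $A,B ::= 1 \mid \bot \mid A\otimes B \mid A\mathbin{\mathsf{par}}B \mid A\oplus B \mid A \mathbin{\&} B$; the dual $A^\bot$ exchanges $1/\bot$, $\otimes/\mathsf{par}$ and $\oplus/\&$ and is applied recursively to the components. CP processes are, up to renaming of bound channels, $$P,Q ::= \mathsf{fwd}\,x\,y \mid \nu x{:}A.(P\parallel Q)\mid x[y].(P\parallel Q)\mid x(y).P\mid x[\mathsf{inl}].P\mid x[\mathsf{inr}].P\mid \mathsf{case}\,x(P,Q)\mid \mathsf{close}\,x\mid \mathsf{wait}\,x;P,$$ where $x$ is bound in both components of the cut, and $y$ is bound in $P$ in the output and in the input. A context $\Delta$ assigns types to finitely many distinct channels, and its order is irrelevant. The judgment $\Delta\vdash P$ is given by the rules - $x{:}A, y{:}A^\bot\vdash \mathsf{fwd}\,x\,y$; - $\Delta_1,\Delta_2\vdash\nu x{:}A.(P\parallel Q)$ if $\Delta_1,x{:}A\vdash P$ and $\Delta_2,x{:}A^\bot\vdash Q$; - $\Delta_1,\Delta_2,x{:}A\otimes B\vdash x[y].(P\parallel Q)$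 if $\Delta_1,y{:}A\vdash P$ and $\Delta_2,x{:}B\vdash Q$; - $\Delta,x{:}A\mathbin{\mathsf{par}}B\vdash x(y).P$ if $\Delta,x{:}B,y{:}A\vdash P$; - $\Delta,x{:}A\oplus B\vdash x[\mathsf{inl}].P$ (resp. $x[\mathsf{inr}].P$) if $\Delta,x{:}A\vdash P$ (resp. $\Delta,x{:}B\vdash P$); - $\Delta,x{:}A\mathbin{\&}B\vdash\mathsf{case}\,x(P,Q)$ if $\Delta,x{:}A\vdash P$ and $\Delta,x{:}B\vdash Q$; - $x{:}1\vdash\mathsf{close}\,x$; - $\Delta,x{:}\bot\vdash\mathsf{wait}\,x;P$ if $\Delta\vdash P$. *SCP.* SCP processes have the same types but bind the continuation $w$ of a channel explicitly: $$P,Q ::= \mathsf{fwd}\,x\,y\mid\nu x{:}A.(P\parallel Q)\mid x[y.P;\,w.Q]\mid x(w.y.P)\mid x[\mathsf{inl};w.P]\mid x[\mathsf{inr};w.P]\mid\mathsf{case}\,x(w.P,w.Q)\mid\mathsf{close}\,x\mid\mathsf{wait}\,x;P .$$ The linearity judgment $\mathrm{lin}(x;P)$ is defined by - $\mathrm{lin}(x;\mathsf{fwd}\,x\,y)$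 and $\mathrm{lin}(y;\mathsf{fwd}\,x\,y)$ for $x\ne y$; $\mathrm{lin}(x;\mathsf{close}\,x)$; $\mathrm{lin}(x;\mathsf{wait}\,x;P)$ if $x\notin\mathrm{fn}(P)$; - (principal cases) if $x$ is not free in the components, then $\mathrm{lin}(x;x[y.P;w.Q])$ if $\mathrm{lin}(w;Q)$; $\mathrm{lin}(x;x(w.y.P))$, $\mathrm{lin}(x;x[\mathsf{inl};w.P])$ and $\mathrm{lin}(x;x[\mathsf{inr};w.P])$ if $\mathrm{lin}(w;P)$; $\mathrm{lin}(x;\mathsf{case}\,x(w.P,w.Q))$ if $\mathrm{lin}(w;P)$ and $\mathrm{lin}(w;Q)$; - (congruence cases, $z\neq x$) $\mathrm{lin}(z;-)$ holds for $\mathsf{wait}\,x;P$, $x(w.y.P)$, $x[\mathsf{inl};w.P]$ and $x[\mathsf{inr};w.P]$ if $\mathrm{lin}(z;P)$; for $\mathsf{case}\,x(w.P,w.Q)$ if $\mathrm{lin}(z;P)$ and $\mathrm{lin}(z;Q)$; for $x[y.P;w.Q]$ and $\nu x{:}A.(P\parallel Q)$ if $\mathrm{lin}(z;P)$ and $z\notin\mathrm{fn}(Q)$,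 or $\mathrm{lin}(z;Q)$ and $z\notin\mathrm{fn}(P)$. The judgment $\Gamma\Vdash P$, with a structural context $\Gamma$, is defined by - $\Gamma\Vdash\mathsf{fwd}\,x\,y$ if $x{:}A,\ y{:}A^\bot\in\Gamma$; - $\Gamma\Vdash\nu x{:}A.(P\parallel Q)$ if $\Gamma,x{:}A\Vdash P$, $\mathrm{lin}(x;P)$, $\Gamma,x{:}A^\bot\Vdash Q$, $\mathrm{lin}(x;Q)$; - for $x{:}A\otimes B\in\Gamma$: $\Gamma\Vdash x[y.P;w.Q]$ if $\Gamma,y{:}A\Vdash P$, $\mathrm{lin}(y;P)$, $\Gamma,w{:}B\Vdash Q$; - for $x{:}A\mathbin{\mathsf{par}}B\in\Gamma$: $\Gamma\Vdash x(w.y.P)$ if $\Gamma,w{:}B,y{:}A\Vdash P$, $\mathrm{lin}(y;P)$; - for $x{:}A\oplus B\in\Gamma$: $\Gamma\Vdash x[\mathsf{inl};w.P]$ if $\Gamma,w{:}A\Vdash P$, and $\Gamma\Vdash x[\mathsf{inr};w.P]$ if $\Gamma,w{:}B\Vdash P$; - for $x{:}A\mathbin{\&}B\in\Gamma$: $\Gamma\Vdash\mathsf{case}\,x(w.P,w.Q)$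 if $\Gamma,w{:}A\Vdash P$ and $\Gamma,w{:}B\Vdash Q$; - $\Gamma\Vdash\mathsf{close}\,x$ if $x{:}1\in\Gamma$; and $\Gamma\Vdash\mathsf{wait}\,x;P$ if $x{:}\bot\in\Gamma$ and $\Gamma\Vdash P$. *$\varepsilon$ and $\delta$.* $\varepsilon$ maps CP processes to SCP processes homomorphically, renaming in each continuation the principal channel $x$ to the bound continuation channel $w$, e.g. $\varepsilon(x[y].(P\parallel Q))=x[y.\varepsilon(P);\,w.[w/x]\varepsilon(Q)]$ and $\varepsilon(x(y).P)=x(w.y.[w/x]\varepsilon(P))$. Conversely $\delta$ renames $w$ to $x$, e.g. $\delta(x[y.P;w.Q])=x[y].(\delta(P)\parallel[x/w]\delta(Q))$. Both act on typing derivations rule by rule: $\varepsilon$ sends a derivation of $\Delta\vdash P$ to one of $\Delta\Vdash\varepsilon(P)$ (weakening the premises and inserting the linearity derivations of the channels that the CP derivation types), and $\delta$ is a partial map sending a derivation of $\Delta\Vdash P$ to one of $\Delta\vdash\delta(P)$, contexts being split according to free channels. *LF.* The signature (in canonical LF, with the upper-case metavariables Π-bound in front) declares the families $\mathsf{tp},\mathsf{name},\mathsf{proc}:\mathsf{type}$,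 $\mathsf{dual}:\mathsf{tp}\to\mathsf{tp}\to\mathsf{type}$, $\mathsf{linear}:(\mathsf{name}\to\mathsf{proc})\to\mathsf{type}$, $\mathsf{hyp}:\mathsf{name}\to\mathsf{tp}\to\mathsf{type}$, $\mathsf{wtp}:\mathsf{proc}\to\mathsf{type}$, and - a constant of $\mathsf{tp}$ for each type former, and a constant of $\mathsf{dual}$ for each clause of duality; - $\mathsf{fwd}:\mathsf{name}\to\mathsf{name}\to\mathsf{proc}$; $\mathsf{close}:\mathsf{name}\to\mathsf{proc}$; $\mathsf{wait}:\mathsf{name}\to\mathsf{proc}\to\mathsf{proc}$; $\mathsf{inl},\mathsf{inr}:\mathsf{name}\to(\mathsf{name}\to\mathsf{proc})\to\mathsf{proc}$; $\mathsf{out},\mathsf{choice}:\mathsf{name}\to(\mathsf{name}\to\mathsf{proc})\to(\mathsf{name}\to\mathsf{proc})\to\mathsf{proc}$; $\mathsf{inp}:\mathsf{name}\to(\mathsf{name}\to\mathsf{name}\to\mathsf{proc})\to\mathsf{proc}$; $\mathsf{pcomp}:\mathsf{tp}\to(\mathsf{name}\to\mathsf{proc})\to(\mathsf{name}\to\mathsf{proc})\to\mathsf{proc}$;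 - a constant of $\mathsf{linear}$ for each linearity rule, where a side condition $x\notin\mathrm{fn}(P)$ is expressed by $P$ being a metavariable that does not depend on $x$ and premises about processes with bound channels are Π-quantified over these channels, e.g. $\mathsf{l\_out}:\mathsf{linear}(\lambda w.Q\,w)\to\mathsf{linear}(\lambda x.\mathsf{out}\,x\,(\lambda y.P\,y)\,(\lambda w.Q\,w))$ and $\mathsf{l\_out2}:(\Pi y.\,\mathsf{linear}(\lambda z.P\,z\,y))\to\mathsf{linear}(\lambda z.\mathsf{out}\,X\,(\lambda y.P\,z\,y)\,(\lambda w.Q\,w))$; - a constant of $\mathsf{wtp}$ for each rule of $\Vdash$, where a premise with a new assumption $x{:}A$ becomes an argument of type $\Pi x{:}\mathsf{name}.\,\mathsf{hyp}\,x\,A\to\mathsf{wtp}(P\,x)$ and a side condition $x{:}A\in\Gamma$ becomes an argument of type $\mathsf{hyp}\,X\,A$, e.g. $\mathsf{wtp\_out}:\mathsf{hyp}\,X\,(A\otimes B)\to(\Pi y.\mathsf{hyp}\,y\,A\to\mathsf{wtp}(P\,y))\to\mathsf{linear}(\lambda y.P\,y)\to(\Pi w.\mathsf{hyp}\,w\,B\to\mathsf{wtp}(Q\,w))\to\mathsf{wtp}(\mathsf{out}\,X\,(\lambda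 y.P\,y)\,(\lambda w.Q\,w))$; in addition $\mathsf{wtp\_fwd}$ and $\mathsf{wtp\_pcomp}$ take an argument of type $\mathsf{dual}\,A\,A'$ for the types $A,A'$ of the two channels involved. $\ulcorner-\urcorner$ is the structural (higher-order abstract syntax) encoding of SCP types, processes, linearity derivations and typing derivations as canonical forms; $\llcorner-\lrcorner$ is the corresponding structural (partial) decoding of canonical forms. For a set $S$ of channels $\ulcorner S\urcorner=\{x:\mathsf{name}\mid x\in S\}$, and $\ulcorner x_1{:}A_1,\dots,x_n{:}A_n\urcorner=\{x_i:\mathsf{name},\ h_i:\mathsf{hyp}\,x_i\,\ulcorner A_i\urcorner\}_{1\le i\le n}$. Put $\varepsilon_\circ=\ulcorner\varepsilon(-)\urcorner$ and $\delta_\circ=\delta(\llcorner-\lrcorner)$, both on processes and on typing derivations. **Claim.** For all CP processes $P$, $\delta_\circ(\varepsilon_\circ(P))$ is defined and equals $P$. Moreover: 1. If $\mathcal D$ is a derivation of $\Delta\vdash P$, where $\Delta=x_1{:}A_1,\dots,x_n{:}A_n$, then there are LF canonical forms $W,L_1,\dots,L_n$ such that - $W=\varepsilon_\circ(\mathcal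 D)$ and $\ulcorner\Delta\urcorner\vdash W:\mathsf{wtp}\;\varepsilon_\circ(P)$; - $\ulcorner\mathrm{fn}(P)\setminus\{x_i\}\urcorner\vdash L_i:\mathsf{linear}(\lambda x_i.\,\varepsilon_\circ(P))$ for $1\le i\le n$; - $\delta_\circ(\varepsilon_\circ(\mathcal D))=\mathcal D$. 2. Let $M, W,L_1,\dots,L_n$ be LF canonical forms such that - $\Gamma\vdash W:\mathsf{wtp}\,M$, where $\Gamma=\{x_i:\mathsf{name},\ h_i:\mathsf{hyp}\,x_i\,T_i\}_{1\le i\le n}$; - $\Gamma\setminus\{x_i,h_i\}\vdash L_i:\mathsf{linear}(\lambda x_i.M)$ for $1\le i\le n$. Then there is a CP context $\Delta$ with $\Gamma=\ulcorner\Delta\urcorner$; $\delta_\circ(M)$ and $\delta_\circ(W)$ are defined; $\delta_\circ(W)$ is a derivation of $\Delta\vdash\delta_\circ(M)$; $\varepsilon_\circ(\delta_\circ(M))=M$; and $\varepsilon_\circ(\delta_\circ(W))=W$. -/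

import Mathlib

/-! # CP, SCP, LF, and the encodings between them

Processes are taken up to renaming of bound channels: a process whose free channels are among
`n` given ones is a well-scoped de Bruijn term, whose channels are the elements of `Fin n`; under
a binder the newly bound channel is `0` and an old channel `i` becomes `i.succ`. -/

namespace CPLF

/-! ## Session types -/

inductive Tp : Type
  | one : Tp
  | bot : Tp
  | tensor : Tp → Tp → Tp
  | par : Tp → Tp → Tp
  | plus : Tp → Tp → Tp
  | wth : Tp → Tp → Tp
deriving DecidableEq

/-- The dual type `A^⊥`. -/
def Tp.dual : Tp → Tp
  | .one => .bot
  | .bot => .one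
  | .tensor A B => .par A.dual B.dual
  | .par A B => .tensor A.dual B.dual
  | .plus A B => .wth A.dual B.dual
  | .wth A B => .plus A.dual B.dual

/-! ## Renamings of channels -/

/-- Extension of a renaming under a binder. -/
def liftR {n m : ℕ} (ρ : Fin n → Fin m) : Fin (n + 1) → Fin (m + 1) :=
  Fin.cases 0 (fun i => (ρ i).succ)

/-- The renaming `[w/x]` that turns `x` into a new channel `w` (which becomes channel `0`). -/
def absR {n : ℕ} (x : Fin n) : Fin n → Fin (n + 1) :=
  fun i => if i = x then 0 else i.succ

/-- The renaming `[x/w]` that instantiates the most recently bound channel `w` by `x`. -/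
def instR {n : ℕ} (x : Fin n) : Fin (n + 1) → Fin n :=
  Fin.cases x (fun i => i)

/-- Free channels of the body of a binder, without the bound channel. -/
def lower {n : ℕ} (S : Finset (Fin (n + 1))) : Finset (Fin n) :=
  Finset.univ.filter (fun i => i.succ ∈ S)

/-! ## Processes of CP and of SCP -/

/-- CP processes with free channels in `Fin n`. -/
inductive CProc : ℕ → Type
  /-- `fwd x y` -/
  | fwd {n : ℕ} (x y : Fin n) : CProc n
  /-- `νx:A.(P ∥ Q)`, with `x` bound in `P` and in `Q` -/
  | cut {n : ℕ} (A : Tp) (P Q : CProc (n + 1)) : CProc n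
  /-- `x[y].(P ∥ Q)`, with `y` bound in `P` -/
  | out {n : ℕ} (x : Fin n) (P : CProc (n + 1)) (Q : CProc n) : CProc n
  /-- `x(y).P`, with `y` bound in `P` -/
  | inp {n : ℕ} (x : Fin n) (P : CProc (n + 1)) : CProc n
  | inl {n : ℕ} (x : Fin n) (P : CProc n) : CProc n
  | inr {n : ℕ} (x : Fin n) (P : CProc n) : CProc n
  /-- `case x (P, Q)` -/
  | choice {n : ℕ} (x : Fin n) (P Q : CProc n) : CProc n
  | close {n : ℕ} (x : Fin n) : CProc n
  | wait {n : ℕ} (x : Fin n) (P : CProc n) : CProc n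

def CProc.rename : {n m : ℕ} → (Fin n → Fin m) → CProc n → CProc m
  | _, _, ρ, .fwd x y => .fwd (ρ x) (ρ y)
  | _, _, ρ, .cut A P Q => .cut A (P.rename (liftR ρ)) (Q.rename (liftR ρ))
  | _, _, ρ, .out x P Q => .out (ρ x) (P.rename (liftR ρ)) (Q.rename ρ)
  | _, _, ρ, .inp x P => .inp (ρ x) (P.rename (liftR ρ))
  | _, _, ρ, .inl x P => .inl (ρ x) (P.rename ρ)
  | _, _, ρ, .inr x P => .inr (ρ x) (P.rename ρ)
  | _, _, ρ, .choice x P Q => .choice (ρ x) (P.rename ρ) (Q.rename ρ)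
  | _, _, ρ, .close x => .close (ρ x)
  | _, _, ρ, .wait x P => .wait (ρ x) (P.rename ρ)

/-- Free channels of a CP process. -/
def CProc.fn : {n : ℕ} → CProc n → Finset (Fin n)
  | _, .fwd x y => {x, y}
  | _, .cut _ P Q => lower P.fn ∪ lower Q.fn
  | _, .out x P Q => insert x (lower P.fn ∪ Q.fn)
  | _, .inp x P => insert x (lower P.fn)
  | _, .inl x P => insert x P.fn
  | _, .inr x P => insert x P.fn
  | _, .choice x P Q => insert x (P.fn ∪ Q.fn)
  | _, .close x => {x}
  | _, .wait x P => insert x P.fn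

/-- SCP processes with free channels in `Fin n`; continuation channels are bound explicitly. -/
inductive SProc : ℕ → Type
  | fwd {n : ℕ} (x y : Fin n) : SProc n
  /-- `νx:A.(P ∥ Q)`, with `x` bound in `P` and in `Q` -/
  | cut {n : ℕ} (A : Tp) (P Q : SProc (n + 1)) : SProc n
  /-- `x[y.P; w.Q]`, with `y` bound in `P` and the continuation `w` bound in `Q` -/
  | out {n : ℕ} (x : Fin n) (P Q : SProc (n + 1)) : SProc n
  /-- `x(w.y.P)`: in `P` the received channel `y` is `0`, the continuation `w` is `1` -/
  | inp {n : ℕ} (x : Fin n) (P : SProc (n + 2)) : SProc n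
  | inl {n : ℕ} (x : Fin n) (P : SProc (n + 1)) : SProc n
  | inr {n : ℕ} (x : Fin n) (P : SProc (n + 1)) : SProc n
  | choice {n : ℕ} (x : Fin n) (P Q : SProc (n + 1)) : SProc n
  | close {n : ℕ} (x : Fin n) : SProc n
  | wait {n : ℕ} (x : Fin n) (P : SProc n) : SProc n

def SProc.rename : {n m : ℕ} → (Fin n → Fin m) → SProc n → SProc m
  | _, _, ρ, .fwd x y => .fwd (ρ x) (ρ y)
  | _, _, ρ, .cut A P Q => .cut A (P.rename (liftR ρ)) (Q.rename (liftR ρ))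
  | _, _, ρ, .out x P Q => .out (ρ x) (P.rename (liftR ρ)) (Q.rename (liftR ρ))
  | _, _, ρ, .inp x P => .inp (ρ x) (P.rename (liftR (liftR ρ)))
  | _, _, ρ, .inl x P => .inl (ρ x) (P.rename (liftR ρ))
  | _, _, ρ, .inr x P => .inr (ρ x) (P.rename (liftR ρ))
  | _, _, ρ, .choice x P Q => .choice (ρ x) (P.rename (liftR ρ)) (Q.rename (liftR ρ))
  | _, _, ρ, .close x => .close (ρ x)
  | _, _, ρ, .wait x P => .wait (ρ x) (P.rename ρ)

/-- Free channels of an SCP process. -/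
def SProc.fn : {n : ℕ} → SProc n → Finset (Fin n)
  | _, .fwd x y => {x, y}
  | _, .cut _ P Q => lower P.fn ∪ lower Q.fn
  | _, .out x P Q => insert x (lower P.fn ∪ lower Q.fn)
  | _, .inp x P => insert x (lower (lower P.fn))
  | _, .inl x P => insert x (lower P.fn)
  | _, .inr x P => insert x (lower P.fn)
  | _, .choice x P Q => insert x (lower P.fn ∪ lower Q.fn)
  | _, .close x => {x}
  | _, .wait x P => insert x P.fn

/-- The encoding `ε` of CP processes as SCP processes: `x` is renamed to its continuation. -/
def eps : {n : ℕ} → CProc n → SProc n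
  | _, .fwd x y => .fwd x y
  | _, .cut A P Q => .cut A (eps P) (eps Q)
  | _, .out x P Q => .out x (eps P) ((eps Q).rename (absR x))
  | _, .inp x P => .inp x ((eps P).rename (liftR (absR x)))
  | _, .inl x P => .inl x ((eps P).rename (absR x))
  | _, .inr x P => .inr x ((eps P).rename (absR x))
  | _, .choice x P Q => .choice x ((eps P).rename (absR x)) ((eps Q).rename (absR x))
  | _, .close x => .close x
  | _, .wait x P => .wait x (eps P)

/-- The decoding `δ` of SCP processes as CP processes: continuations of `x` are renamed to `x`. -/
def del : {n : ℕ} → SProc n → CProc n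
  | _, .fwd x y => .fwd x y
  | _, .cut A P Q => .cut A (del P) (del Q)
  | _, .out x P Q => .out x (del P) ((del Q).rename (instR x))
  | _, .inp x P => .inp x ((del P).rename (liftR (instR x)))
  | _, .inl x P => .inl x ((del P).rename (instR x))
  | _, .inr x P => .inr x ((del P).rename (instR x))
  | _, .choice x P Q => .choice x ((del P).rename (instR x)) ((del Q).rename (instR x))
  | _, .close x => .close x
  | _, .wait x P => .wait x (del P)

/-! ## Typing contexts -/

/-- A typing context: it assigns types to some of the channels. -/
abbrev Ctx (n : ℕ) : Type := Fin n → Option Tp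

namespace Ctx
variable {n m : ℕ}

def empty : Ctx n := fun _ => none

/-- `Δ, x : A` (used where `x` is not in the domain of `Δ`). -/
def set (Δ : Ctx n) (x : Fin n) (A : Tp) : Ctx n := Function.update Δ x (some A)

/-- `Δ` without its assumption about `x`. -/
def erase (Δ : Ctx n) (x : Fin n) : Ctx n := Function.update Δ x none

/-- `Δ, x : A` for a newly bound channel `x`. -/
def cons (A : Tp) (Δ : Ctx n) : Ctx (n + 1) := Fin.cases (some A) Δ

def restrict (Δ : Ctx n) (S : Finset (Fin n)) : Ctx n := fun i => if i ∈ S then Δ i else none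

/-- `Θ` is the union `Δ₁, Δ₂` of two contexts with disjoint domains. -/
def Join (Δ₁ Δ₂ Θ : Ctx n) : Prop :=
  ∀ z, (Δ₁ z = none ∧ Θ z = Δ₂ z) ∨ (Δ₂ z = none ∧ Θ z = Δ₁ z)

instance (Δ₁ Δ₂ Θ : Ctx n) : Decidable (Join Δ₁ Δ₂ Θ) := by unfold Join; infer_instance

/-- The context obtained by renaming the channels of `Δ`. -/
def map (ρ : Fin n → Fin m) (Δ : Ctx n) : Ctx m :=
  fun z => ((List.finRange n).find? (fun i => decide (ρ i = z) && (Δ i).isSome)).bind Δ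

/-- `ρ` is injective on the domain of `Δ`. -/
def InjDom (ρ : Fin n → Fin m) (Δ : Ctx n) : Prop :=
  ∀ i j A B, Δ i = some A → Δ j = some B → ρ i = ρ j → i = j

end Ctx

/-! ## Typing derivations of CP

`CPDer Θ P` is the type of derivations of `Θ ⊢ P`. Premises `Θ = …` only serve to display the
shape of the context in the conclusion. -/

inductive CPDer : {n : ℕ} → Ctx n → CProc n → Type
  | id {n : ℕ} {Θ : Ctx n} (x y : Fin n) (A : Tp) (hxy : x ≠ y)
      (hΘ : Θ = (Ctx.empty.set x A).set y A.dual) : CPDer Θ (.fwd x y)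
  | cut {n : ℕ} {Θ : Ctx n} (Δ₁ Δ₂ : Ctx n) {A : Tp} {P Q : CProc (n + 1)}
      (hΘ : Ctx.Join Δ₁ Δ₂ Θ)
      (D₁ : CPDer (Ctx.cons A Δ₁) P) (D₂ : CPDer (Ctx.cons A.dual Δ₂) Q) :
      CPDer Θ (.cut A P Q)
  | tensor {n : ℕ} {Θ : Ctx n} (Δ Δ₁ Δ₂ : Ctx n) (x : Fin n) (A B : Tp)
      {P : CProc (n + 1)} {Q : CProc n}
      (hΔ : Ctx.Join Δ₁ Δ₂ Δ) (hx : Δ x = none) (hΘ : Θ = Δ.set x (.tensor A B))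
      (D₁ : CPDer (Ctx.cons A Δ₁) P) (D₂ : CPDer (Δ₂.set x B) Q) :
      CPDer Θ (.out x P Q)
  | par {n : ℕ} {Θ : Ctx n} (Δ : Ctx n) (x : Fin n) (A B : Tp) {P : CProc (n + 1)}
      (hx : Δ x = none) (hΘ : Θ = Δ.set x (.par A B))
      (D : CPDer (Ctx.cons A (Δ.set x B)) P) : CPDer Θ (.inp x P)
  | inl {n : ℕ} {Θ : Ctx n} (Δ : Ctx n) (x : Fin n) (A B : Tp) {P : CProc n}
      (hx : Δ x = none) (hΘ : Θ = Δ.set x (.plus A B))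
      (D : CPDer (Δ.set x A) P) : CPDer Θ (.inl x P)
  | inr {n : ℕ} {Θ : Ctx n} (Δ : Ctx n) (x : Fin n) (A B : Tp) {P : CProc n}
      (hx : Δ x = none) (hΘ : Θ = Δ.set x (.plus A B))
      (D : CPDer (Δ.set x B) P) : CPDer Θ (.inr x P)
  | wth {n : ℕ} {Θ : Ctx n} (Δ : Ctx n) (x : Fin n) (A B : Tp) {P Q : CProc n}
      (hx : Δ x = none) (hΘ : Θ = Δ.set x (.wth A B))
      (D₁ : CPDer (Δ.set x A) P) (D₂ : CPDer (Δ.set x B) Q) : CPDer Θ (.choice x P Q)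
  | one {n : ℕ} {Θ : Ctx n} (x : Fin n) (hΘ : Θ = Ctx.empty.set x .one) : CPDer Θ (.close x)
  | bot {n : ℕ} {Θ : Ctx n} (Δ : Ctx n) (x : Fin n) {P : CProc n}
      (hx : Δ x = none) (hΘ : Θ = Δ.set x .bot) (D : CPDer Δ P) : CPDer Θ (.wait x P)

/-! ## Linearity and typing derivations of SCP -/

/-- `Lin x P` is the type of derivations of `lin(x; P)`. -/
inductive Lin : {n : ℕ} → Fin n → SProc n → Type
  | fwd₁ {n : ℕ} {x y : Fin n} (h : x ≠ y) : Lin x (.fwd x y)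
  | fwd₂ {n : ℕ} {x y : Fin n} (h : x ≠ y) : Lin y (.fwd x y)
  | close {n : ℕ} {x : Fin n} : Lin x (.close x)
  | wait {n : ℕ} {x : Fin n} {P : SProc n} (h : x ∉ P.fn) : Lin x (.wait x P)
  | out {n : ℕ} {x : Fin n} {P Q : SProc (n + 1)} (L : Lin 0 Q)
      (hP : x.succ ∉ P.fn) (hQ : x.succ ∉ Q.fn) : Lin x (.out x P Q)
  | inp {n : ℕ} {x : Fin n} {P : SProc (n + 2)} (L : Lin 1 P)
      (hP : x.succ.succ ∉ P.fn) : Lin x (.inp x P)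
  | inl {n : ℕ} {x : Fin n} {P : SProc (n + 1)} (L : Lin 0 P) (hP : x.succ ∉ P.fn) :
      Lin x (.inl x P)
  | inr {n : ℕ} {x : Fin n} {P : SProc (n + 1)} (L : Lin 0 P) (hP : x.succ ∉ P.fn) :
      Lin x (.inr x P)
  | choice {n : ℕ} {x : Fin n} {P Q : SProc (n + 1)} (L₁ : Lin 0 P) (L₂ : Lin 0 Q)
      (hP : x.succ ∉ P.fn) (hQ : x.succ ∉ Q.fn) : Lin x (.choice x P Q)
  | wait₂ {n : ℕ} {z x : Fin n} {P : SProc n} (hz : z ≠ x) (L : Lin z P) : Lin z (.wait x P)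
  | out₂ {n : ℕ} {z x : Fin n} {P Q : SProc (n + 1)} (hz : z ≠ x) (L : Lin z.succ P)
      (hQ : z.succ ∉ Q.fn) : Lin z (.out x P Q)
  | out₃ {n : ℕ} {z x : Fin n} {P Q : SProc (n + 1)} (hz : z ≠ x) (L : Lin z.succ Q)
      (hP : z.succ ∉ P.fn) : Lin z (.out x P Q)
  | inp₂ {n : ℕ} {z x : Fin n} {P : SProc (n + 2)} (hz : z ≠ x) (L : Lin z.succ.succ P) :
      Lin z (.inp x P)
  | inl₂ {n : ℕ} {z x : Fin n} {P : SProc (n + 1)} (hz : z ≠ x) (L : Lin z.succ P) :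
      Lin z (.inl x P)
  | inr₂ {n : ℕ} {z x : Fin n} {P : SProc (n + 1)} (hz : z ≠ x) (L : Lin z.succ P) :
      Lin z (.inr x P)
  | choice₂ {n : ℕ} {z x : Fin n} {P Q : SProc (n + 1)} (hz : z ≠ x) (L₁ : Lin z.succ P)
      (L₂ : Lin z.succ Q) : Lin z (.choice x P Q)
  | cut₁ {n : ℕ} {z : Fin n} {A : Tp} {P Q : SProc (n + 1)} (L : Lin z.succ P)
      (hQ : z.succ ∉ Q.fn) : Lin z (.cut A P Q)
  | cut₂ {n : ℕ} {z : Fin n} {A : Tp} {P Q : SProc (n + 1)} (L : Lin z.succ Q)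
      (hP : z.succ ∉ P.fn) : Lin z (.cut A P Q)

/-- `SDer Γ P` is the type of SCP derivations of `Γ ⊩ P`; the context `Γ` is structural. -/
inductive SDer : {n : ℕ} → Ctx n → SProc n → Type
  | id {n : ℕ} {Γ : Ctx n} {x y : Fin n} (A : Tp) (hx : Γ x = some A) (hy : Γ y = some A.dual) :
      SDer Γ (.fwd x y)
  | cut {n : ℕ} {Γ : Ctx n} {A : Tp} {P Q : SProc (n + 1)}
      (D₁ : SDer (Ctx.cons A Γ) P) (L₁ : Lin 0 P)
      (D₂ : SDer (Ctx.cons A.dual Γ) Q) (L₂ : Lin 0 Q) : SDer Γ (.cut A P Q)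
  | tensor {n : ℕ} {Γ : Ctx n} {x : Fin n} {P Q : SProc (n + 1)} (A B : Tp)
      (hx : Γ x = some (.tensor A B))
      (D₁ : SDer (Ctx.cons A Γ) P) (L₁ : Lin 0 P) (D₂ : SDer (Ctx.cons B Γ) Q) :
      SDer Γ (.out x P Q)
  | par {n : ℕ} {Γ : Ctx n} {x : Fin n} {P : SProc (n + 2)} (A B : Tp)
      (hx : Γ x = some (.par A B))
      (D : SDer (Ctx.cons A (Ctx.cons B Γ)) P) (L : Lin 0 P) : SDer Γ (.inp x P)
  | inl {n : ℕ} {Γ : Ctx n} {x : Fin n} {P : SProc (n + 1)} (A B : Tp)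
      (hx : Γ x = some (.plus A B)) (D : SDer (Ctx.cons A Γ) P) : SDer Γ (.inl x P)
  | inr {n : ℕ} {Γ : Ctx n} {x : Fin n} {P : SProc (n + 1)} (A B : Tp)
      (hx : Γ x = some (.plus A B)) (D : SDer (Ctx.cons B Γ) P) : SDer Γ (.inr x P)
  | wth {n : ℕ} {Γ : Ctx n} {x : Fin n} {P Q : SProc (n + 1)} (A B : Tp)
      (hx : Γ x = some (.wth A B))
      (D₁ : SDer (Ctx.cons A Γ) P) (D₂ : SDer (Ctx.cons B Γ) Q) : SDer Γ (.choice x P Q)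
  | one {n : ℕ} {Γ : Ctx n} {x : Fin n} (hx : Γ x = some .one) : SDer Γ (.close x)
  | bot {n : ℕ} {Γ : Ctx n} {x : Fin n} {P : SProc n} (hx : Γ x = some .bot)
      (D : SDer Γ P) : SDer Γ (.wait x P)

/-! ## Renaming of derivations -/

@[simp] theorem liftR_zero {n m : ℕ} (ρ : Fin n → Fin m) : liftR ρ 0 = 0 := rfl

@[simp] theorem liftR_succ {n m : ℕ} (ρ : Fin n → Fin m) (i : Fin n) :
    liftR ρ i.succ = (ρ i).succ := rfl

@[simp] theorem liftR_one {n m : ℕ} (ρ : Fin (n + 1) → Fin (m + 1)) :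
    liftR ρ 1 = (ρ 0).succ := rfl

@[simp] theorem instR_zero {n : ℕ} (x : Fin n) : instR x 0 = x := rfl

@[simp] theorem instR_succ {n : ℕ} (x i : Fin n) : instR x i.succ = i := rfl

theorem liftR_injective {n m : ℕ} {ρ : Fin n → Fin m} (h : Function.Injective ρ) :
    Function.Injective (liftR ρ) := by
  intro i j
  refine Fin.cases ?_ (fun i => ?_) i <;> refine Fin.cases ?_ (fun j => ?_) j <;>
    simp [h.eq_iff, Fin.succ_ne_zero, (Fin.succ_ne_zero _).symm]

theorem absR_injective {n : ℕ} (x : Fin n) : Function.Injective (absR x) := by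
  intro i j
  unfold absR
  split_ifs with h₁ h₂ h₂ <;>
    simp_all [Fin.succ_ne_zero, (Fin.succ_ne_zero _).symm]

theorem absR_self {n : ℕ} (x : Fin n) : absR x x = 0 := by simp [absR]

theorem absR_ne {n : ℕ} {x z : Fin n} (h : z ≠ x) : absR x z = z.succ := by simp [absR, h]

@[simp] theorem mem_lower {n : ℕ} {S : Finset (Fin (n + 1))} {i : Fin n} :
    i ∈ lower S ↔ i.succ ∈ S := by simp [lower]

theorem exists_lift {n m : ℕ} {S : Finset (Fin (n + 1))} {ρ : Fin n → Fin m} {z : Fin m} :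
    (∃ i ∈ S, liftR ρ i = z.succ) ↔ ∃ i, i.succ ∈ S ∧ ρ i = z := by
  constructor
  · rintro ⟨i, hi, h⟩
    induction i using Fin.cases with
    | zero => exact absurd h (Fin.succ_ne_zero _).symm
    | succ i => exact ⟨i, hi, by simpa using h⟩
  · rintro ⟨i, hi, rfl⟩
    exact ⟨i.succ, hi, rfl⟩

theorem SProc.mem_fn_rename {n : ℕ} (P : SProc n) : ∀ {m : ℕ} (ρ : Fin n → Fin m) (z : Fin m),
    z ∈ (P.rename ρ).fn ↔ ∃ i ∈ P.fn, ρ i = z := by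
  induction P with
  | fwd x y => intro m ρ z; simp [rename, fn, eq_comm]
  | close x => intro m ρ z; simp [rename, fn, eq_comm]
  | cut A P Q hP hQ =>
    intro m ρ z
    simp only [rename, fn, Finset.mem_union, mem_lower, hP, hQ, exists_lift]
    grind
  | out x P Q hP hQ =>
    intro m ρ z
    simp only [rename, fn, Finset.mem_insert, Finset.mem_union, mem_lower, hP, hQ, exists_lift]
    grind
  | choice x P Q hP hQ =>
    intro m ρ z
    simp only [rename, fn, Finset.mem_insert, Finset.mem_union, mem_lower, hP, hQ, exists_lift]
    grind
  | inp x P hP =>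
    intro m ρ z
    simp only [rename, fn, Finset.mem_insert, mem_lower, hP, exists_lift]
    have := exists_lift (S := lower P.fn) (ρ := ρ) (z := z)
    simp only [mem_lower] at this
    rw [this]
    grind
  | inl x P hP =>
    intro m ρ z
    simp only [rename, fn, Finset.mem_insert, mem_lower, hP, exists_lift]
    grind
  | inr x P hP =>
    intro m ρ z
    simp only [rename, fn, Finset.mem_insert, mem_lower, hP, exists_lift]
    grind
  | wait x P hP =>
    intro m ρ z
    simp only [rename, fn, Finset.mem_insert, hP]
    grind

theorem SProc.not_mem_fn_rename {n m : ℕ} {P : SProc n} {ρ : Fin n → Fin m}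
    (hρ : Function.Injective ρ) {x : Fin n} (h : x ∉ P.fn) : ρ x ∉ (P.rename ρ).fn := by
  rw [SProc.mem_fn_rename]
  rintro ⟨i, hi, e⟩
  exact h (hρ e ▸ hi)

/-- Renaming of linearity derivations along an injective renaming. -/
def Lin.rename : {n m : ℕ} → {x : Fin n} → {P : SProc n} → Lin x P → (ρ : Fin n → Fin m) →
    Function.Injective ρ → Lin (ρ x) (P.rename ρ)
  | _, _, _, _, .fwd₁ h, _, hρ => .fwd₁ (hρ.ne h)
  | _, _, _, _, .fwd₂ h, _, hρ => .fwd₂ (hρ.ne h)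
  | _, _, _, _, .close, _, _ => .close
  | _, _, _, _, .wait h, _, hρ => .wait (SProc.not_mem_fn_rename hρ h)
  | _, _, _, _, .out L hP hQ, ρ, hρ =>
    .out (L.rename (liftR ρ) (liftR_injective hρ))
      (SProc.not_mem_fn_rename (liftR_injective hρ) hP)
      (SProc.not_mem_fn_rename (liftR_injective hρ) hQ)
  | _, _, _, _, .inp L hP, ρ, hρ =>
    .inp (L.rename (liftR (liftR ρ)) (liftR_injective (liftR_injective hρ)))
      (SProc.not_mem_fn_rename (liftR_injective (liftR_injective hρ)) hP)
  | _, _, _, _, .inl L hP, ρ, hρ =>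
    .inl (L.rename (liftR ρ) (liftR_injective hρ))
      (SProc.not_mem_fn_rename (liftR_injective hρ) hP)
  | _, _, _, _, .inr L hP, ρ, hρ =>
    .inr (L.rename (liftR ρ) (liftR_injective hρ))
      (SProc.not_mem_fn_rename (liftR_injective hρ) hP)
  | _, _, _, _, .choice L₁ L₂ hP hQ, ρ, hρ =>
    .choice (L₁.rename (liftR ρ) (liftR_injective hρ)) (L₂.rename (liftR ρ) (liftR_injective hρ))
      (SProc.not_mem_fn_rename (liftR_injective hρ) hP)
      (SProc.not_mem_fn_rename (liftR_injective hρ) hQ)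
  | _, _, _, _, .wait₂ hz L, ρ, hρ => .wait₂ (hρ.ne hz) (L.rename ρ hρ)
  | _, _, _, _, .out₂ hz L hQ, ρ, hρ =>
    .out₂ (hρ.ne hz) (L.rename (liftR ρ) (liftR_injective hρ))
      (SProc.not_mem_fn_rename (liftR_injective hρ) hQ)
  | _, _, _, _, .out₃ hz L hP, ρ, hρ =>
    .out₃ (hρ.ne hz) (L.rename (liftR ρ) (liftR_injective hρ))
      (SProc.not_mem_fn_rename (liftR_injective hρ) hP)
  | _, _, _, _, .inp₂ hz L, ρ, hρ =>
    .inp₂ (hρ.ne hz) (L.rename (liftR (liftR ρ)) (liftR_injective (liftR_injective hρ)))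
  | _, _, _, _, .inl₂ hz L, ρ, hρ =>
    .inl₂ (hρ.ne hz) (L.rename (liftR ρ) (liftR_injective hρ))
  | _, _, _, _, .inr₂ hz L, ρ, hρ =>
    .inr₂ (hρ.ne hz) (L.rename (liftR ρ) (liftR_injective hρ))
  | _, _, _, _, .choice₂ hz L₁ L₂, ρ, hρ =>
    .choice₂ (hρ.ne hz) (L₁.rename (liftR ρ) (liftR_injective hρ))
      (L₂.rename (liftR ρ) (liftR_injective hρ))
  | _, _, _, _, .cut₁ L hQ, ρ, hρ =>
    .cut₁ (L.rename (liftR ρ) (liftR_injective hρ))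
      (SProc.not_mem_fn_rename (liftR_injective hρ) hQ)
  | _, _, _, _, .cut₂ L hP, ρ, hρ =>
    .cut₂ (L.rename (liftR ρ) (liftR_injective hρ))
      (SProc.not_mem_fn_rename (liftR_injective hρ) hP)

/-- `ρ` maps the assumptions of `Γ` to assumptions of `Γ'`. -/
def Ctx.Maps {n m : ℕ} (ρ : Fin n → Fin m) (Γ : Ctx n) (Γ' : Ctx m) : Prop :=
  ∀ i A, Γ i = some A → Γ' (ρ i) = some A

theorem Ctx.Maps.lift {n m : ℕ} {ρ : Fin n → Fin m} {Γ : Ctx n} {Γ' : Ctx m}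
    (h : Ctx.Maps ρ Γ Γ') (A : Tp) : Ctx.Maps (liftR ρ) (Ctx.cons A Γ) (Ctx.cons A Γ') := by
  intro i
  refine Fin.cases ?_ (fun i => ?_) i
  · exact fun B hB => hB
  · exact fun B hB => h i B hB

theorem Ctx.Maps.cons {n : ℕ} {Γ Γ' : Ctx n} (h : Ctx.Maps (fun i => i) Γ Γ') (A : Tp) :
    Ctx.Maps (fun i => i) (Ctx.cons A Γ) (Ctx.cons A Γ') := by
  intro i
  refine Fin.cases ?_ (fun i => ?_) i
  · exact fun B hB => hB
  · exact fun B hB => h i B hB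

/-- Weakening and renaming of SCP typing derivations. -/
def SDer.rename : {n m : ℕ} → {Γ : Ctx n} → {Γ' : Ctx m} → {P : SProc n} → SDer Γ P →
    (ρ : Fin n → Fin m) → Function.Injective ρ → Ctx.Maps ρ Γ Γ' → SDer Γ' (P.rename ρ)
  | _, _, _, _, _, .id A hx hy, _, _, hΓ => .id A (hΓ _ _ hx) (hΓ _ _ hy)
  | _, _, _, _, _, .cut D₁ L₁ D₂ L₂, ρ, hρ, hΓ =>
    .cut (D₁.rename (liftR ρ) (liftR_injective hρ) (hΓ.lift _))
      (L₁.rename (liftR ρ) (liftR_injective hρ))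
      (D₂.rename (liftR ρ) (liftR_injective hρ) (hΓ.lift _))
      (L₂.rename (liftR ρ) (liftR_injective hρ))
  | _, _, _, _, _, .tensor A B hx D₁ L₁ D₂, ρ, hρ, hΓ =>
    .tensor A B (hΓ _ _ hx) (D₁.rename (liftR ρ) (liftR_injective hρ) (hΓ.lift _))
      (L₁.rename (liftR ρ) (liftR_injective hρ))
      (D₂.rename (liftR ρ) (liftR_injective hρ) (hΓ.lift _))
  | _, _, _, _, _, .par A B hx D L, ρ, hρ, hΓ =>
    .par A B (hΓ _ _ hx)
      (D.rename (liftR (liftR ρ)) (liftR_injective (liftR_injective hρ)) ((hΓ.lift _).lift _))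
      (L.rename (liftR (liftR ρ)) (liftR_injective (liftR_injective hρ)))
  | _, _, _, _, _, .inl A B hx D, ρ, hρ, hΓ =>
    .inl A B (hΓ _ _ hx) (D.rename (liftR ρ) (liftR_injective hρ) (hΓ.lift _))
  | _, _, _, _, _, .inr A B hx D, ρ, hρ, hΓ =>
    .inr A B (hΓ _ _ hx) (D.rename (liftR ρ) (liftR_injective hρ) (hΓ.lift _))
  | _, _, _, _, _, .wth A B hx D₁ D₂, ρ, hρ, hΓ =>
    .wth A B (hΓ _ _ hx) (D₁.rename (liftR ρ) (liftR_injective hρ) (hΓ.lift _))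
      (D₂.rename (liftR ρ) (liftR_injective hρ) (hΓ.lift _))
  | _, _, _, _, _, .one hx, _, _, hΓ => .one (hΓ _ _ hx)
  | _, _, _, _, _, .bot hx D, ρ, hρ, hΓ => .bot (hΓ _ _ hx) (D.rename ρ hρ hΓ)

/-- Weakening of SCP typing derivations. -/
def SDer.weaken : {n : ℕ} → {Γ Γ' : Ctx n} → {P : SProc n} → SDer Γ P →
    Ctx.Maps (fun i => i) Γ Γ' → SDer Γ' P
  | _, _, _, _, .id A hx hy, hΓ => .id A (hΓ _ _ hx) (hΓ _ _ hy)
  | _, _, _, _, .cut D₁ L₁ D₂ L₂, hΓ =>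
    .cut (D₁.weaken (hΓ.cons _)) L₁ (D₂.weaken (hΓ.cons _)) L₂
  | _, _, _, _, .tensor A B hx D₁ L₁ D₂, hΓ =>
    .tensor A B (hΓ _ _ hx) (D₁.weaken (hΓ.cons _)) L₁ (D₂.weaken (hΓ.cons _))
  | _, _, _, _, .par A B hx D L, hΓ =>
    .par A B (hΓ _ _ hx) (D.weaken ((hΓ.cons _).cons _)) L
  | _, _, _, _, .inl A B hx D, hΓ => .inl A B (hΓ _ _ hx) (D.weaken (hΓ.cons _))
  | _, _, _, _, .inr A B hx D, hΓ => .inr A B (hΓ _ _ hx) (D.weaken (hΓ.cons _))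
  | _, _, _, _, .wth A B hx D₁ D₂, hΓ =>
    .wth A B (hΓ _ _ hx) (D₁.weaken (hΓ.cons _)) (D₂.weaken (hΓ.cons _))
  | _, _, _, _, .one hx, hΓ => .one (hΓ _ _ hx)
  | _, _, _, _, .bot hx D, hΓ => .bot (hΓ _ _ hx) (D.weaken hΓ)

namespace Ctx
variable {n m : ℕ}

@[simp] theorem cons_zero (A : Tp) (Δ : Ctx n) : cons A Δ 0 = some A := rfl

@[simp] theorem cons_succ (A : Tp) (Δ : Ctx n) (i : Fin n) : cons A Δ i.succ = Δ i := rfl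

theorem map_eq_some {ρ : Fin n → Fin m} {Δ : Ctx n} (h : InjDom ρ Δ) (z : Fin m) (A : Tp) :
    map ρ Δ z = some A ↔ ∃ i, ρ i = z ∧ Δ i = some A := by
  unfold map
  constructor
  · intro e
    obtain ⟨i, hi, e⟩ := Option.bind_eq_some_iff.1 e
    have := List.find?_some hi
    simp only [Bool.and_eq_true, decide_eq_true_eq] at this
    exact ⟨i, this.1, e⟩
  · rintro ⟨i, rfl, hi⟩
    cases hf : (List.finRange n).find? (fun j => decide (ρ j = ρ i) && (Δ j).isSome) with
    | none =>
      have := List.find?_eq_none.1 hf i (List.mem_finRange i)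
      simp [hi] at this
    | some j =>
      have := List.find?_some hf
      simp only [Bool.and_eq_true, decide_eq_true_eq] at this
      obtain ⟨B, hB⟩ := Option.isSome_iff_exists.1 this.2
      have := h j i B A hB hi this.1
      subst this
      simpa using hi

theorem map_eq_none {ρ : Fin n → Fin m} {Δ : Ctx n} (h : InjDom ρ Δ) (z : Fin m) :
    map ρ Δ z = none ↔ ∀ i, ρ i = z → Δ i = none := by
  rw [Option.eq_none_iff_forall_not_mem]
  simp only [Option.mem_def, map_eq_some h]
  constructor
  · intro H i hi
    rw [Option.eq_none_iff_forall_not_mem]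
    exact fun A hA => H A ⟨i, hi, hA⟩
  · rintro H A ⟨i, hi, hA⟩
    simp [H i hi] at hA

theorem set_eq_some {Δ : Ctx n} {x z : Fin n} {A B : Tp} :
    Δ.set x A z = some B ↔ (z = x ∧ A = B) ∨ (z ≠ x ∧ Δ z = some B) := by
  unfold set
  by_cases h : z = x
  · subst h; simp
  · simp [h]

theorem map_eq_of {ρ : Fin n → Fin m} {Δ : Ctx n} {Δ' : Ctx m} (h : InjDom ρ Δ)
    (H : ∀ z A, Δ' z = some A ↔ ∃ i, ρ i = z ∧ Δ i = some A) : map ρ Δ = Δ' := by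
  funext z
  apply Option.ext
  intro A
  rw [map_eq_some h, H]

theorem InjDom.lift {ρ : Fin n → Fin m} {Δ : Ctx n} (h : InjDom ρ Δ) (A : Tp) :
    InjDom (liftR ρ) (cons A Δ) := by
  intro i j
  refine Fin.cases ?_ (fun i => ?_) i <;> refine Fin.cases ?_ (fun j => ?_) j
  · simp
  · simp [(Fin.succ_ne_zero _).symm]
  · simp [Fin.succ_ne_zero]
  · intro B C hB hC e
    rw [h i j B C hB hC (by simpa using e)]

theorem map_cons {ρ : Fin n → Fin m} {Δ : Ctx n} (h : InjDom ρ Δ) (A : Tp) :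
    map (liftR ρ) (cons A Δ) = cons A (map ρ Δ) := by
  refine map_eq_of (h.lift A) fun z B => ?_
  refine Fin.cases ?_ (fun z => ?_) z
  · constructor
    · exact fun e => ⟨0, rfl, e⟩
    · rintro ⟨i, hi, e⟩
      induction i using Fin.cases with
      | zero => exact e
      | succ i => exact absurd hi (Fin.succ_ne_zero _)
  · rw [cons_succ, map_eq_some h]
    constructor
    · rintro ⟨i, rfl, e⟩
      exact ⟨i.succ, rfl, e⟩
    · rintro ⟨i, hi, e⟩
      induction i using Fin.cases with
      | zero => exact absurd hi (Fin.succ_ne_zero _).symm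
      | succ i => exact ⟨i, by simpa using hi, e⟩

theorem InjDom.of_set {ρ : Fin n → Fin m} {Δ : Ctx n} {x : Fin n} {A : Tp}
    (h : InjDom ρ (Δ.set x A)) (hx : Δ x = none) : InjDom ρ Δ := by
  intro i j B C hB hC e
  refine h i j B C (set_eq_some.2 (.inr ⟨?_, hB⟩)) (set_eq_some.2 (.inr ⟨?_, hC⟩)) e
  · rintro rfl; simp [hx] at hB
  · rintro rfl; simp [hx] at hC

/-- Injectivity on `Δ, x : A` does not depend on `A`. -/
theorem InjDom.set_congr {ρ : Fin n → Fin m} {Δ Δ' : Ctx n} {x : Fin n} {A B : Tp}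
    (h : InjDom ρ (Δ.set x A)) (hs : ∀ i C, Δ' i = some C → ∃ C', Δ i = some C') :
    InjDom ρ (Δ'.set x B) := by
  have key : ∀ i C, Δ'.set x B i = some C → ∃ C', Δ.set x A i = some C' := by
    intro i C hi
    rcases set_eq_some.1 hi with ⟨rfl, -⟩ | ⟨hne, hi⟩
    · exact ⟨A, set_eq_some.2 (.inl ⟨rfl, rfl⟩)⟩
    · obtain ⟨C', h'⟩ := hs i C hi
      exact ⟨C', set_eq_some.2 (.inr ⟨hne, h'⟩)⟩
  intro i j C C' hi hj e
  obtain ⟨D, hD⟩ := key i C hi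
  obtain ⟨D', hD'⟩ := key j C' hj
  exact h i j D D' hD hD' e

theorem map_apply_none {ρ : Fin n → Fin m} {Δ : Ctx n} {x : Fin n} {A : Tp}
    (h : InjDom ρ (Δ.set x A)) (hx : Δ x = none) : map ρ Δ (ρ x) = none := by
  rw [map_eq_none (h.of_set hx)]
  intro i hi
  by_contra hne
  obtain ⟨B, hB⟩ := Option.ne_none_iff_exists'.1 hne
  have hix : i ≠ x := by rintro rfl; simp [hx] at hB
  exact hix (h i x B A (set_eq_some.2 (.inr ⟨hix, hB⟩)) (set_eq_some.2 (.inl ⟨rfl, rfl⟩)) hi)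

theorem map_set {ρ : Fin n → Fin m} {Δ : Ctx n} {x : Fin n} {A : Tp}
    (h : InjDom ρ (Δ.set x A)) (hx : Δ x = none) :
    map ρ (Δ.set x A) = (map ρ Δ).set (ρ x) A := by
  refine map_eq_of h fun z B => ?_
  rw [set_eq_some, map_eq_some (h.of_set hx)]
  constructor
  · rintro (⟨rfl, rfl⟩ | ⟨-, i, rfl, hi⟩)
    · exact ⟨x, rfl, set_eq_some.2 (.inl ⟨rfl, rfl⟩)⟩
    · refine ⟨i, rfl, set_eq_some.2 (.inr ⟨?_, hi⟩)⟩
      rintro rfl; simp [hx] at hi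
  · rintro ⟨i, rfl, hi⟩
    rcases set_eq_some.1 hi with ⟨rfl, rfl⟩ | ⟨hne, hi'⟩
    · exact .inl ⟨rfl, rfl⟩
    · refine .inr ⟨fun e => hne ?_, i, rfl, hi'⟩
      exact h i x B A hi (set_eq_some.2 (.inl ⟨rfl, rfl⟩)) e

theorem map_empty (ρ : Fin n → Fin m) : map ρ empty = empty :=
  map_eq_of (fun i j A B h => by simp [empty] at h) fun z A => by simp [empty]

theorem Join.left {Δ₁ Δ₂ Θ : Ctx n} (h : Join Δ₁ Δ₂ Θ) {i : Fin n} {A : Tp}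
    (hi : Δ₁ i = some A) : Θ i = some A := by
  rcases h i with ⟨h₁, -⟩ | ⟨-, h₂⟩
  · simp [hi] at h₁
  · rw [h₂, hi]

theorem Join.right {Δ₁ Δ₂ Θ : Ctx n} (h : Join Δ₁ Δ₂ Θ) {i : Fin n} {A : Tp}
    (hi : Δ₂ i = some A) : Θ i = some A := by
  rcases h i with ⟨-, h₂⟩ | ⟨h₁, -⟩
  · rw [h₂, hi]
  · simp [hi] at h₁

theorem Join.none {Δ₁ Δ₂ Θ : Ctx n} (h : Join Δ₁ Δ₂ Θ) {i : Fin n} (hi : Θ i = none) :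
    Δ₁ i = none ∧ Δ₂ i = none := by
  rcases h i with ⟨h₁, h₂⟩ | ⟨h₁, h₂⟩
  · exact ⟨h₁, h₂ ▸ hi⟩
  · exact ⟨h₂ ▸ hi, h₁⟩

theorem InjDom.mono {ρ : Fin n → Fin m} {Δ Θ : Ctx n} (h : InjDom ρ Θ)
    (hs : ∀ i A, Δ i = some A → Θ i = some A) : InjDom ρ Δ :=
  fun i j A B hi hj e => h i j A B (hs i A hi) (hs j B hj) e

theorem Join.map {ρ : Fin n → Fin m} {Δ₁ Δ₂ Θ : Ctx n} (h : Join Δ₁ Δ₂ Θ) (hρ : InjDom ρ Θ) :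
    Join (Ctx.map ρ Δ₁) (Ctx.map ρ Δ₂) (Ctx.map ρ Θ) := by
  have i₁ : InjDom ρ Δ₁ := hρ.mono fun _ _ => h.left
  have i₂ : InjDom ρ Δ₂ := hρ.mono fun _ _ => h.right
  intro z
  cases h₁ : Ctx.map ρ Δ₁ z with
  | none =>
    refine .inl ⟨rfl, Option.ext fun A => ?_⟩
    rw [map_eq_some hρ, map_eq_some i₂]
    constructor
    · rintro ⟨i, hi, e⟩
      have := (map_eq_none i₁ z).1 h₁ i hi
      rcases h i with ⟨-, e'⟩ | ⟨-, e'⟩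
      · exact ⟨i, hi, e' ▸ e⟩
      · simp [e', this] at e
    · rintro ⟨i, hi, e⟩
      exact ⟨i, hi, h.right e⟩
  | some A =>
    obtain ⟨i, rfl, hi⟩ := (map_eq_some i₁ z A).1 h₁
    refine .inr ⟨(map_eq_none i₂ _).2 fun j hj => ?_, (map_eq_some hρ _ _).2 ⟨i, rfl, h.left hi⟩⟩
    by_contra hne
    obtain ⟨B, hB⟩ := Option.ne_none_iff_exists'.1 hne
    have := hρ j i B A (h.right hB) (h.left hi) hj
    subst this
    rcases h j with ⟨e, -⟩ | ⟨e, -⟩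
    · simp [hi] at e
    · simp [hB] at e

theorem injDom_instR {Δ : Ctx n} {x : Fin n} (hx : Δ x = none) (A : Tp) :
    InjDom (instR x) (cons A Δ) := by
  intro i j
  refine Fin.cases ?_ (fun i => ?_) i <;> refine Fin.cases ?_ (fun j => ?_) j
  · simp
  · intro B C _ hC e
    simp only [instR_zero, instR_succ] at e
    subst e; simp [hx] at hC
  · intro B C hB _ e
    simp only [instR_zero, instR_succ] at e
    subst e; simp [hx] at hB
  · intro B C _ _ e
    simpa using e

theorem map_instR {Δ : Ctx n} {x : Fin n} (hx : Δ x = none) (A : Tp) :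
    map (instR x) (cons A Δ) = Δ.set x A := by
  refine map_eq_of (injDom_instR hx A) fun z B => ?_
  rw [set_eq_some]
  constructor
  · rintro (⟨rfl, rfl⟩ | ⟨-, h⟩)
    · exact ⟨0, rfl, rfl⟩
    · exact ⟨z.succ, rfl, h⟩
  · rintro ⟨i, rfl, hi⟩
    induction i using Fin.cases with
    | zero => exact .inl ⟨rfl, by simpa using hi⟩
    | succ i =>
      refine .inr ⟨fun e => ?_, by simpa using hi⟩
      simp only [instR_succ] at e
      subst e
      simp [hx] at hi

theorem erase_self (Δ : Ctx n) (x : Fin n) : Δ.erase x x = none := by simp [erase]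

theorem restrict_none {Δ : Ctx n} {x : Fin n} (h : Δ x = none) (S : Finset (Fin n)) :
    Δ.restrict S x = none := by simp [restrict, h]

theorem map_pair {ρ : Fin n → Fin m} {x y : Fin n} {A B : Tp} (hxy : x ≠ y)
    (h : InjDom ρ ((empty.set x A).set y B)) :
    map ρ ((empty.set x A).set y B) = (empty.set (ρ x) A).set (ρ y) B := by
  have hy : (empty.set x A) y = none := by simp [set, empty, hxy.symm]
  rw [map_set h hy, map_set (h.of_set hy) rfl, map_empty]

theorem InjDom.pair_ne {ρ : Fin n → Fin m} {x y : Fin n} {A B : Tp} (hxy : x ≠ y)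
    (h : InjDom ρ ((empty.set x A).set y B)) : ρ x ≠ ρ y :=
  fun e => hxy (h x y A B (by simp [set, hxy]) (by simp [set]) e)

end Ctx

/-- Renaming of CP typing derivations, along a renaming that identifies no two channels of the
context. -/
def CPDer.rename : {n m : ℕ} → {Θ : Ctx n} → {P : CProc n} → CPDer Θ P →
    (ρ : Fin n → Fin m) → Ctx.InjDom ρ Θ → CPDer (Ctx.map ρ Θ) (P.rename ρ)
  | _, _, _, _, .id x y A hxy hΘ, ρ, hρ =>
    .id (ρ x) (ρ y) A (Ctx.InjDom.pair_ne hxy (hΘ ▸ hρ)) (by subst hΘ; exact Ctx.map_pair hxy hρ)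
  | _, _, _, _, .cut Δ₁ Δ₂ hΘ D₁ D₂, ρ, hρ =>
    have h₁ : Ctx.InjDom ρ Δ₁ := hρ.mono fun _ _ => hΘ.left
    have h₂ : Ctx.InjDom ρ Δ₂ := hρ.mono fun _ _ => hΘ.right
    .cut (Δ₁.map ρ) (Δ₂.map ρ) (hΘ.map hρ)
      (Ctx.map_cons h₁ _ ▸ D₁.rename (liftR ρ) (h₁.lift _))
      (Ctx.map_cons h₂ _ ▸ D₂.rename (liftR ρ) (h₂.lift _))
  | _, _, _, _, .tensor Δ Δ₁ Δ₂ x A B hΔ hx hΘ D₁ D₂, ρ, hρ =>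
    have hs : Ctx.InjDom ρ (Δ.set x (.tensor A B)) := hΘ ▸ hρ
    have h₀ : Ctx.InjDom ρ Δ := hs.of_set hx
    have h₁ : Ctx.InjDom ρ Δ₁ := h₀.mono fun _ _ => hΔ.left
    have h₂ : Ctx.InjDom ρ (Δ₂.set x B) := hs.set_congr fun _ _ h => ⟨_, hΔ.right h⟩
    .tensor (Δ.map ρ) (Δ₁.map ρ) (Δ₂.map ρ) (ρ x) A B (hΔ.map h₀) (Ctx.map_apply_none hs hx)
      (by subst hΘ; exact Ctx.map_set hs hx)
      (Ctx.map_cons h₁ _ ▸ D₁.rename (liftR ρ) (h₁.lift _))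
      (Ctx.map_set h₂ (hΔ.none hx).2 ▸ D₂.rename ρ h₂)
  | _, _, _, _, .par Δ x A B hx hΘ D, ρ, hρ =>
    have hs : Ctx.InjDom ρ (Δ.set x (.par A B)) := hΘ ▸ hρ
    have h₁ : Ctx.InjDom ρ (Δ.set x B) := hs.set_congr fun _ _ h => ⟨_, h⟩
    .par (Δ.map ρ) (ρ x) A B (Ctx.map_apply_none hs hx) (by subst hΘ; exact Ctx.map_set hs hx)
      (Ctx.map_set h₁ hx ▸ Ctx.map_cons h₁ A ▸ D.rename (liftR ρ) (h₁.lift _))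
  | _, _, _, _, .inl Δ x A B hx hΘ D, ρ, hρ =>
    have hs : Ctx.InjDom ρ (Δ.set x (.plus A B)) := hΘ ▸ hρ
    have h₁ : Ctx.InjDom ρ (Δ.set x A) := hs.set_congr fun _ _ h => ⟨_, h⟩
    .inl (Δ.map ρ) (ρ x) A B (Ctx.map_apply_none hs hx) (by subst hΘ; exact Ctx.map_set hs hx)
      (Ctx.map_set h₁ hx ▸ D.rename ρ h₁)
  | _, _, _, _, .inr Δ x A B hx hΘ D, ρ, hρ =>
    have hs : Ctx.InjDom ρ (Δ.set x (.plus A B)) := hΘ ▸ hρ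
    have h₁ : Ctx.InjDom ρ (Δ.set x B) := hs.set_congr fun _ _ h => ⟨_, h⟩
    .inr (Δ.map ρ) (ρ x) A B (Ctx.map_apply_none hs hx) (by subst hΘ; exact Ctx.map_set hs hx)
      (Ctx.map_set h₁ hx ▸ D.rename ρ h₁)
  | _, _, _, _, .wth Δ x A B hx hΘ D₁ D₂, ρ, hρ =>
    have hs : Ctx.InjDom ρ (Δ.set x (.wth A B)) := hΘ ▸ hρ
    have h₁ : Ctx.InjDom ρ (Δ.set x A) := hs.set_congr fun _ _ h => ⟨_, h⟩
    have h₂ : Ctx.InjDom ρ (Δ.set x B) := hs.set_congr fun _ _ h => ⟨_, h⟩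
    .wth (Δ.map ρ) (ρ x) A B (Ctx.map_apply_none hs hx) (by subst hΘ; exact Ctx.map_set hs hx)
      (Ctx.map_set h₁ hx ▸ D₁.rename ρ h₁) (Ctx.map_set h₂ hx ▸ D₂.rename ρ h₂)
  | _, _, _, _, .one x hΘ, ρ, hρ =>
    .one (ρ x) (by subst hΘ; rw [Ctx.map_set hρ rfl, Ctx.map_empty])
  | _, _, _, _, .bot Δ x hx hΘ D, ρ, hρ =>
    have hs : Ctx.InjDom ρ (Δ.set x .bot) := hΘ ▸ hρ
    .bot (Δ.map ρ) (ρ x) (Ctx.map_apply_none hs hx) (by subst hΘ; exact Ctx.map_set hs hx)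
      (D.rename ρ (hs.of_set hx))

/-! ## The encoding of CP derivations as derivations of linear SCP processes -/

theorem absR_eq_succ {n : ℕ} {x i z : Fin n} : absR x i = z.succ ↔ i = z ∧ z ≠ x := by
  unfold absR
  split_ifs with h
  · subst h
    constructor
    · exact fun e => absurd e (Fin.succ_ne_zero _).symm
    · rintro ⟨rfl, h⟩; exact absurd rfl h
  · constructor
    · intro e
      have := Fin.succ_injective _ e
      exact ⟨this, this ▸ h⟩
    · rintro ⟨rfl, -⟩; rfl

theorem succ_mem_fn_absR {n : ℕ} {P : SProc n} {x z : Fin n} :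
    z.succ ∈ (P.rename (absR x)).fn ↔ z ∈ P.fn ∧ z ≠ x := by
  rw [SProc.mem_fn_rename]
  simp only [absR_eq_succ]
  grind

theorem succ_succ_mem_fn_absR {n : ℕ} {P : SProc (n + 1)} {x z : Fin n} :
    z.succ.succ ∈ (P.rename (liftR (absR x))).fn ↔ z.succ ∈ P.fn ∧ z ≠ x := by
  rw [SProc.mem_fn_rename, exists_lift]
  simp only [absR_eq_succ]
  grind

/-- The free channels of a typed CP process are typed; the same then holds for its encoding. -/
theorem CPDer.fn_eps {n : ℕ} {Θ : Ctx n} {P : CProc n} (D : CPDer Θ P) :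
    ∀ z, Θ z = none → z ∉ (eps P).fn := by
  induction D with
  | id x y A hxy hΘ =>
    intro z hz
    subst hΘ
    have hy : z ≠ y := by rintro rfl; simp [Ctx.set] at hz
    have hx : z ≠ x := by rintro rfl; simp [Ctx.set, hxy] at hz
    simp [eps, SProc.fn, hx, hy]
  | cut Δ₁ Δ₂ hΘ D₁ D₂ ih₁ ih₂ =>
    intro z hz
    have h := hΘ.none hz
    simp [eps, SProc.fn, ih₁ z.succ h.1, ih₂ z.succ h.2]
  | tensor Δ Δ₁ Δ₂ x A B hΔ hx hΘ D₁ D₂ ih₁ ih₂ =>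
    intro z hz
    subst hΘ
    have hzx : z ≠ x := by rintro rfl; simp [Ctx.set] at hz
    have h := hΔ.none (i := z) (by simpa [Ctx.set, hzx] using hz)
    simp [eps, SProc.fn, ih₁ z.succ h.1, succ_mem_fn_absR, hzx,
      ih₂ z (by simpa [Ctx.set, hzx] using h.2)]
  | par Δ x A B hx hΘ D ih =>
    intro z hz
    subst hΘ
    have hzx : z ≠ x := by rintro rfl; simp [Ctx.set] at hz
    simp [eps, SProc.fn, succ_succ_mem_fn_absR, hzx,
      ih z.succ (by simpa [Ctx.set, hzx] using hz)]
  | inl Δ x A B hx hΘ D ih =>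
    intro z hz
    subst hΘ
    have hzx : z ≠ x := by rintro rfl; simp [Ctx.set] at hz
    simp [eps, SProc.fn, succ_mem_fn_absR, hzx, ih z (by simpa [Ctx.set, hzx] using hz)]
  | inr Δ x A B hx hΘ D ih =>
    intro z hz
    subst hΘ
    have hzx : z ≠ x := by rintro rfl; simp [Ctx.set] at hz
    simp [eps, SProc.fn, succ_mem_fn_absR, hzx, ih z (by simpa [Ctx.set, hzx] using hz)]
  | wth Δ x A B hx hΘ D₁ D₂ ih₁ ih₂ =>
    intro z hz
    subst hΘ
    have hzx : z ≠ x := by rintro rfl; simp [Ctx.set] at hz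
    simp [eps, SProc.fn, succ_mem_fn_absR, hzx, ih₁ z (by simpa [Ctx.set, hzx] using hz),
      ih₂ z (by simpa [Ctx.set, hzx] using hz)]
  | one x hΘ =>
    intro z hz
    subst hΘ
    have hzx : z ≠ x := by rintro rfl; simp [Ctx.set] at hz
    simp [eps, SProc.fn, hzx]
  | bot Δ x hx hΘ D ih =>
    intro z hz
    subst hΘ
    have hzx : z ≠ x := by rintro rfl; simp [Ctx.set] at hz
    simp [eps, SProc.fn, hzx, ih z (by simpa [Ctx.set, hzx] using hz)]

theorem Ctx.set_self_ne {n : ℕ} {Δ : Ctx n} {x : Fin n} {A : Tp} : Δ.set x A x ≠ none := by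
  simp [Ctx.set]

theorem Ctx.set_ne_of {n : ℕ} {Δ : Ctx n} {x z : Fin n} {A B : Tp} (h : Δ.set x A z ≠ none) :
    Δ.set x B z ≠ none := by
  by_cases e : z = x
  · subst e; simp [Ctx.set]
  · simpa [Ctx.set, e] using h

/-- The linearity of the new channel `w` in `[w/x]P`, from that of `x` in `P`. -/
def Lin.absSelf {n : ℕ} {x : Fin n} {P : SProc n} (L : Lin x P) : Lin 0 (P.rename (absR x)) :=
  absR_self x ▸ L.rename (absR x) (absR_injective x)

/-- The linearity of another channel `z` in `[w/x]P`, from that of `z` in `P`. -/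
def Lin.absNe {n : ℕ} {x z : Fin n} {P : SProc n} (L : Lin z P) (h : z ≠ x) :
    Lin z.succ (P.rename (absR x)) :=
  absR_ne h ▸ L.rename (absR x) (absR_injective x)

def Lin.liftAbsSelf {n : ℕ} {x : Fin n} {P : SProc (n + 1)} (L : Lin x.succ P) :
    Lin 1 (P.rename (liftR (absR x))) :=
  (show liftR (absR x) x.succ = 1 by rw [liftR_succ, absR_self]; rfl) ▸
    L.rename (liftR (absR x)) (liftR_injective (absR_injective x))

def Lin.liftAbsNe {n : ℕ} {x z : Fin n} {P : SProc (n + 1)} (L : Lin z.succ P) (h : z ≠ x) :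
    Lin z.succ.succ (P.rename (liftR (absR x))) :=
  (show liftR (absR x) z.succ = z.succ.succ by rw [liftR_succ, absR_ne h]) ▸
    L.rename (liftR (absR x)) (liftR_injective (absR_injective x))

/-- Transport along an equality of channels. -/
def Lin.cast {n : ℕ} {z x : Fin n} {P : SProc n} (h : z = x) (L : Lin x P) : Lin z P := h ▸ L

/-- If `Θ ⊢ P` then `lin(z; ε(P))` for all `z` in the domain of `Θ`. -/
def CPDer.lin : {n : ℕ} → {Θ : Ctx n} → {P : CProc n} → CPDer Θ P → (z : Fin n) →
    Θ z ≠ none → Lin z (eps P)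
  | _, _, _, .id x y A hxy hΘ, z, hz =>
    if h : z = x then .cast h (.fwd₁ hxy)
    else
      have e : z = y := by
        by_contra hy
        subst hΘ
        simp [Ctx.set, Ctx.empty, h, hy] at hz
      .cast e (.fwd₂ hxy)
  | _, _, _, .cut Δ₁ Δ₂ hΘ D₁ D₂, z, hz =>
    if h : Δ₁ z = none then
      have h₂ : Δ₂ z ≠ none := by
        rcases hΘ z with ⟨-, e⟩ | ⟨-, e⟩
        · rwa [← e]
        · exact absurd (e.trans h) hz
      .cut₂ (D₂.lin z.succ h₂) (D₁.fn_eps z.succ h)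
    else
      have h₂ : Δ₂ z = none := by
        rcases hΘ z with ⟨e, -⟩ | ⟨e, -⟩
        · exact absurd e h
        · exact e
      .cut₁ (D₁.lin z.succ h) (D₂.fn_eps z.succ h₂)
  | _, _, _, .tensor Δ Δ₁ Δ₂ x A B hΔ hx hΘ D₁ D₂, z, hz =>
    if h : z = x then
      .cast h (.out (D₂.lin x Ctx.set_self_ne).absSelf (D₁.fn_eps x.succ (hΔ.none hx).1)
        (fun hm => (succ_mem_fn_absR.1 hm).2 rfl))
    else
      have hz' : Δ z ≠ none := by subst hΘ; simpa [Ctx.set, h] using hz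
      if h₁ : Δ₁ z = none then
        have h₂ : Δ₂ z ≠ none := by
          rcases hΔ z with ⟨-, e⟩ | ⟨-, e⟩
          · rwa [← e]
          · exact absurd (e.trans h₁) hz'
        .out₃ h ((D₂.lin z (by simpa [Ctx.set, h] using h₂)).absNe h) (D₁.fn_eps z.succ h₁)
      else
        have h₂ : Δ₂ z = none := by
          rcases hΔ z with ⟨e, -⟩ | ⟨e, -⟩
          · exact absurd e h₁
          · exact e
        .out₂ h (D₁.lin z.succ h₁) (fun hm =>
          D₂.fn_eps z (by simpa [Ctx.set, h] using h₂) (succ_mem_fn_absR.1 hm).1)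
  | _, _, _, .par Δ x A B hx hΘ D, z, hz =>
    if h : z = x then
      .cast h (.inp (D.lin x.succ (Ctx.set_self_ne (Δ := Δ) (A := B))).liftAbsSelf
        (fun hm => (succ_succ_mem_fn_absR.1 hm).2 rfl))
    else .inp₂ h ((D.lin z.succ (Ctx.set_ne_of (hΘ ▸ hz))).liftAbsNe h)
  | _, _, _, .inl Δ x A B hx hΘ D, z, hz =>
    if h : z = x then
      .cast h (.inl (D.lin x Ctx.set_self_ne).absSelf (fun hm => (succ_mem_fn_absR.1 hm).2 rfl))
    else .inl₂ h ((D.lin z (Ctx.set_ne_of (hΘ ▸ hz))).absNe h)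
  | _, _, _, .inr Δ x A B hx hΘ D, z, hz =>
    if h : z = x then
      .cast h (.inr (D.lin x Ctx.set_self_ne).absSelf (fun hm => (succ_mem_fn_absR.1 hm).2 rfl))
    else .inr₂ h ((D.lin z (Ctx.set_ne_of (hΘ ▸ hz))).absNe h)
  | _, _, _, .wth Δ x A B hx hΘ D₁ D₂, z, hz =>
    if h : z = x then
      .cast h (.choice (D₁.lin x Ctx.set_self_ne).absSelf (D₂.lin x Ctx.set_self_ne).absSelf
        (fun hm => (succ_mem_fn_absR.1 hm).2 rfl) (fun hm => (succ_mem_fn_absR.1 hm).2 rfl))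
    else
      .choice₂ h ((D₁.lin z (Ctx.set_ne_of (hΘ ▸ hz))).absNe h)
        ((D₂.lin z (Ctx.set_ne_of (hΘ ▸ hz))).absNe h)
  | _, _, _, .one x hΘ, z, hz =>
    have e : z = x := by
      by_contra hx
      subst hΘ
      simp [Ctx.set, Ctx.empty, hx] at hz
    .cast e (.close)
  | _, _, _, .bot Δ x hx hΘ D, z, hz =>
    if h : z = x then .cast h (.wait (D.fn_eps x hx))
    else .wait₂ h (D.lin z (by subst hΘ; simpa [Ctx.set, h] using hz))

theorem Ctx.maps_absR {n : ℕ} {Δ Δ' : Ctx n} {x : Fin n} {A B : Tp}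
    (h : ∀ i C, Δ i = some C → Δ' i = some C) :
    Ctx.Maps (absR x) (Δ.set x A) (Ctx.cons A (Δ'.set x B)) := by
  intro i C hi
  rcases Ctx.set_eq_some.1 hi with ⟨rfl, rfl⟩ | ⟨hne, hi⟩
  · rw [absR_self]; rfl
  · rw [absR_ne hne]; simpa [Ctx.set, hne] using h i C hi

theorem Ctx.maps_set {n : ℕ} {Δ Δ' : Ctx n} {x : Fin n} {A : Tp} (hx : Δ' x = none)
    (h : ∀ i C, Δ i = some C → Δ' i = some C) : Ctx.Maps (fun i => i) Δ (Δ'.set x A) := by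
  intro i C hi
  have : i ≠ x := by rintro rfl; simp [h i C hi] at hx
  simpa [Ctx.set, this] using h i C hi

/-- The encoding `ε` of CP typing derivations as SCP typing derivations. -/
def epsDer : {n : ℕ} → {Θ : Ctx n} → {P : CProc n} → CPDer Θ P → SDer Θ (eps P)
  | _, _, _, .id x y A hxy hΘ =>
    .id A (by subst hΘ; simp [Ctx.set, hxy]) (by subst hΘ; simp [Ctx.set])
  | _, _, _, .cut Δ₁ Δ₂ hΘ D₁ D₂ =>
    .cut ((epsDer D₁).weaken (Ctx.Maps.cons (fun _ _ h => hΘ.left h) _)) (D₁.lin 0 (by simp))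
      ((epsDer D₂).weaken (Ctx.Maps.cons (fun _ _ h => hΘ.right h) _)) (D₂.lin 0 (by simp))
  | _, _, _, .tensor Δ Δ₁ Δ₂ x A B hΔ hx hΘ D₁ D₂ =>
    .tensor A B (by subst hΘ; simp [Ctx.set])
      ((epsDer D₁).weaken (Ctx.Maps.cons (hΘ ▸ Ctx.maps_set hx (fun _ _ h => hΔ.left h)) _))
      (D₁.lin 0 (by simp))
      ((epsDer D₂).rename (absR x) (absR_injective x)
        (hΘ ▸ Ctx.maps_absR (fun _ _ h => hΔ.right h)))
  | _, _, _, .par Δ x A B hx hΘ D =>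
    .par A B (by subst hΘ; simp [Ctx.set])
      ((epsDer D).rename (liftR (absR x)) (liftR_injective (absR_injective x))
        (Ctx.Maps.lift (hΘ ▸ Ctx.maps_absR (fun _ _ h => h)) A))
      ((D.lin 0 (by simp)).rename (liftR (absR x)) (liftR_injective (absR_injective x)))
  | _, _, _, .inl Δ x A B hx hΘ D =>
    .inl A B (by subst hΘ; simp [Ctx.set])
      ((epsDer D).rename (absR x) (absR_injective x) (hΘ ▸ Ctx.maps_absR (fun _ _ h => h)))
  | _, _, _, .inr Δ x A B hx hΘ D =>
    .inr A B (by subst hΘ; simp [Ctx.set])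
      ((epsDer D).rename (absR x) (absR_injective x) (hΘ ▸ Ctx.maps_absR (fun _ _ h => h)))
  | _, _, _, .wth Δ x A B hx hΘ D₁ D₂ =>
    .wth A B (by subst hΘ; simp [Ctx.set])
      ((epsDer D₁).rename (absR x) (absR_injective x) (hΘ ▸ Ctx.maps_absR (fun _ _ h => h)))
      ((epsDer D₂).rename (absR x) (absR_injective x) (hΘ ▸ Ctx.maps_absR (fun _ _ h => h)))
  | _, _, _, .one x hΘ => .one (by subst hΘ; simp [Ctx.set])
  | _, _, _, .bot Δ x hx hΘ D =>
    .bot (by subst hΘ; simp [Ctx.set])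
      ((epsDer D).weaken (hΘ ▸ Ctx.maps_set hx (fun _ _ h => h)))

/-! ## The decoding of SCP derivations as CP derivations

`δ` is a partial function on derivations. Given a derivation of `Γ ⊩ P` and a context `Δ` for the
conclusion, it applies the CP rule with the same name at each step, splitting contexts according
to the free channels of the subprocesses. It is undefined where the side conditions of the CP rule
fail. -/

/-- `[x/w]` on a derivation of `Δ, w : A ⊢ P`. -/
def CPDer.inst {n : ℕ} {Δ : Ctx n} {A : Tp} {P : CProc (n + 1)} (D : CPDer (Ctx.cons A Δ) P)
    {x : Fin n} (hx : Δ x = none) : CPDer (Δ.set x A) (P.rename (instR x)) :=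
  Ctx.map_instR hx A ▸ D.rename (instR x) (Ctx.injDom_instR hx A)

/-- `[x/w]` on a derivation of `Δ, w : B, y : A ⊢ P`. -/
def CPDer.liftInst {n : ℕ} {Δ : Ctx n} {A B : Tp} {P : CProc (n + 2)}
    (D : CPDer (Ctx.cons A (Ctx.cons B Δ)) P) {x : Fin n} (hx : Δ x = none) :
    CPDer (Ctx.cons A (Δ.set x B)) (P.rename (liftR (instR x))) :=
  Ctx.map_instR hx B ▸ Ctx.map_cons (Ctx.injDom_instR hx B) A ▸
    D.rename (liftR (instR x)) ((Ctx.injDom_instR hx B).lift A)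

def delDer : {n : ℕ} → (Δ : Ctx n) → {Γ : Ctx n} → {P : SProc n} → SDer Γ P →
    Option (CPDer Δ (del P))
  | _, Δ, _, .fwd x y, .id A _ _ =>
    if h : x ≠ y ∧ Δ = (Ctx.empty.set x A).set y A.dual then some (.id x y A h.1 h.2) else none
  | _, Δ, _, .cut A P Q, .cut D₁ _ D₂ _ =>
    if h : Ctx.Join (Δ.restrict (lower P.fn)) (Δ.restrict (lower Q.fn)) Δ then do
      let E₁ ← delDer (Ctx.cons A (Δ.restrict (lower P.fn))) D₁
      let E₂ ← delDer (Ctx.cons A.dual (Δ.restrict (lower Q.fn))) D₂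
      return .cut _ _ h E₁ E₂
    else none
  | _, Δ, _, .out x P Q, .tensor A B _ D₁ _ D₂ =>
    if h : Ctx.Join ((Δ.erase x).restrict (lower P.fn)) ((Δ.erase x).restrict (lower Q.fn))
        (Δ.erase x) ∧ Δ = (Δ.erase x).set x (.tensor A B) then do
      let E₁ ← delDer (Ctx.cons A ((Δ.erase x).restrict (lower P.fn))) D₁
      let E₂ ← delDer (Ctx.cons B ((Δ.erase x).restrict (lower Q.fn))) D₂
      return .tensor _ _ _ x A B h.1 (Δ.erase_self x) h.2 E₁
        (E₂.inst (Ctx.restrict_none (Δ.erase_self x) _))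
    else none
  | _, Δ, _, .inp x _, .par A B _ D _ =>
    if h : Δ = (Δ.erase x).set x (.par A B) then do
      let E ← delDer (Ctx.cons A (Ctx.cons B (Δ.erase x))) D
      return .par _ x A B (Δ.erase_self x) h (E.liftInst (Δ.erase_self x))
    else none
  | _, Δ, _, .inl x _, .inl A B _ D =>
    if h : Δ = (Δ.erase x).set x (.plus A B) then do
      let E ← delDer (Ctx.cons A (Δ.erase x)) D
      return .inl _ x A B (Δ.erase_self x) h (E.inst (Δ.erase_self x))
    else none
  | _, Δ, _, .inr x _, .inr A B _ D =>
    if h : Δ = (Δ.erase x).set x (.plus A B) then do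
      let E ← delDer (Ctx.cons B (Δ.erase x)) D
      return .inr _ x A B (Δ.erase_self x) h (E.inst (Δ.erase_self x))
    else none
  | _, Δ, _, .choice x _ _, .wth A B _ D₁ D₂ =>
    if h : Δ = (Δ.erase x).set x (.wth A B) then do
      let E₁ ← delDer (Ctx.cons A (Δ.erase x)) D₁
      let E₂ ← delDer (Ctx.cons B (Δ.erase x)) D₂
      return .wth _ x A B (Δ.erase_self x) h (E₁.inst (Δ.erase_self x))
        (E₂.inst (Δ.erase_self x))
    else none
  | _, Δ, _, .close x, .one _ =>
    if h : Δ = Ctx.empty.set x .one then some (.one x h) else none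
  | _, Δ, _, .wait x _, .bot _ D =>
    if h : Δ = (Δ.erase x).set x .bot then do
      let E ← delDer (Δ.erase x) D
      return .bot _ x (Δ.erase_self x) h E
    else none

/-! ## The logical framework LF, in canonical form

Canonical LF with hereditary substitution. Terms are β-normal by construction and the typing
rules only admit η-long ones. Variables are de Bruijn indices; contexts list the most recent
assumption first. -/

/-- Term constants of the signature. -/
inductive TmC : Type
  | one | bot | times | par | wth | plus
  | dOne | dBot | dTimes | dPar | dWth | dPlus
  | fwd | close | wait | inl | inr | choice | out | inp | pcomp
  | lFwd1 | lFwd2 | lClose | lWait | lOut | lInp | lInl | lInr | lChoice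
  | lWait2 | lOut2 | lOut3 | lInp2 | lInl2 | lInr2 | lChoice2 | lPcomp1 | lPcomp2
  | wtpFwd | wtpPcomp | wtpInl | wtpInr | wtpChoice | wtpOut | wtpInp | wtpClose | wtpWait
deriving DecidableEq

/-- Constants for type families of the signature. -/
inductive TyC : Type
  | tp | dual | name | proc | linear | hyp | wtp
deriving DecidableEq

/-- Canonical terms: `λ. M`, or a variable or a constant applied to a list of canonical terms. -/
inductive Tm : Type
  | lam : Tm → Tm
  | var : ℕ → List Tm → Tm
  | con : TmC → List Tm → Tm

/-- Canonical type families. -/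
inductive Ty : Type
  | atom : TyC → List Tm → Ty
  | pi : Ty → Ty → Ty

inductive Kind : Type
  | type : Kind
  | pi : Ty → Kind → Kind

/-- Extension of a renaming of variables under a binder. -/
def upN (ρ : ℕ → ℕ) : ℕ → ℕ
  | 0 => 0
  | k + 1 => ρ k + 1

mutual
def Tm.ren (ρ : ℕ → ℕ) : Tm → Tm
  | .lam M => .lam (M.ren (upN ρ))
  | .var i S => .var (ρ i) (Tm.renList ρ S)
  | .con c S => .con c (Tm.renList ρ S)
def Tm.renList (ρ : ℕ → ℕ) : List Tm → List Tm
  | [] => []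
  | M :: S => M.ren ρ :: Tm.renList ρ S
end

def Ty.ren (ρ : ℕ → ℕ) : Ty → Ty
  | .atom a S => .atom a (Tm.renList ρ S)
  | .pi A B => .pi (A.ren ρ) (B.ren (upN ρ))

/-- Simple types, which index hereditary substitution. -/
inductive STy : Type
  | base : STy
  | arr : STy → STy → STy

/-- The simple type underlying a type. -/
def Ty.erase : Ty → STy
  | .atom _ _ => .base
  | .pi A B => .arr A.erase B.erase

mutual
/-- Substitution of `N` for variable `k`, where `app N S` is the normal form of `N` applied to
the spine `S`. -/
def Tm.substWith (app : Tm → List Tm → Tm) (N : Tm) (k : ℕ) : Tm → Tm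
  | .lam M => .lam (Tm.substWith app N (k + 1) M)
  | .var i S =>
    if i < k then .var i (Tm.substWithList app N k S)
    else if i = k then app (N.ren (· + k)) (Tm.substWithList app N k S)
    else .var (i - 1) (Tm.substWithList app N k S)
  | .con c S => .con c (Tm.substWithList app N k S)
def Tm.substWithList (app : Tm → List Tm → Tm) (N : Tm) (k : ℕ) : List Tm → List Tm
  | [] => []
  | M :: S => Tm.substWith app N k M :: Tm.substWithList app N k S
end

/-- Hereditary application: the normal form of `M`, of simple type `α`, applied to a spine.
(On arguments that are not of the right simple type the value is arbitrary.) -/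
def Tm.happ : STy → Tm → List Tm → Tm
  | .arr α β, .lam M, N :: S => Tm.happ β (Tm.substWith (Tm.happ α) N 0 M) S
  | _, M, _ => M

/-- Hereditary substitution `[N/k]M`, where `N` has simple type `α`. -/
def Tm.hsub (α : STy) (N : Tm) (k : ℕ) (M : Tm) : Tm := Tm.substWith (Tm.happ α) N k M

def Ty.hsub (α : STy) (N : Tm) (k : ℕ) : Ty → Ty
  | .atom a S => .atom a (S.map (Tm.hsub α N k))
  | .pi A B => .pi (A.hsub α N k) (B.hsub α N (k + 1))

def Kind.hsub (α : STy) (N : Tm) (k : ℕ) : Kind → Kind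
  | .type => .type
  | .pi A K => .pi (A.hsub α N k) (K.hsub α N (k + 1))

/-! ### Notation for the objects of the signature -/

/-- The variable with index `k`, of atomic type. -/
abbrev v (k : ℕ) : Tm := .var k []

/-- η-long form of a variable of type `name → proc`. -/
abbrev eta1 (k : ℕ) : Tm := .lam (.var (k + 1) [v 0])

/-- η-long form of a variable of type `name → name → proc`. -/
abbrev eta2 (k : ℕ) : Tm := .lam (.lam (.var (k + 2) [v 1, v 0]))

namespace Ty

/-- The non-dependent function type `A → B`. -/
abbrev arrow (A B : Ty) : Ty := .pi A (B.ren Nat.succ)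

/-- Iterated Π-type. -/
abbrev pis (L : List Ty) (B : Ty) : Ty := L.foldr .pi B

abbrev tp : Ty := .atom .tp []
abbrev name : Ty := .atom .name []
abbrev proc : Ty := .atom .proc []
abbrev dual (A B : Tm) : Ty := .atom .dual [A, B]
abbrev hyp (x A : Tm) : Ty := .atom .hyp [x, A]
abbrev linear (P : Tm) : Ty := .atom .linear [P]
abbrev wtp (P : Tm) : Ty := .atom .wtp [P]

/-- `name → proc` -/
abbrev proc1 : Ty := .pi name proc

/-- `name → name → proc` -/
abbrev proc2 : Ty := .pi name proc1

/-- `name → name → name → proc` -/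
abbrev proc3 : Ty := .pi name proc2

end Ty

infixr:30 " ⟶ₗ " => Ty.arrow

/-! ### The signature -/

def TyC.kind : TyC → Kind
  | .tp => .type
  | .dual => .pi .tp (.pi .tp .type)
  | .name => .type
  | .proc => .type
  | .linear => .pi .proc1 .type
  | .hyp => .pi .name (.pi .tp .type)
  | .wtp => .pi .proc .type

open Ty in
/-- The types of the term constants. Metavariables which the concrete syntax leaves implicit are
Π-bound in front. In `A ⟶ₗ B` the type `B` lives in the same context as `A`. -/
def TmC.type : TmC → Ty
  | .one => tp
  | .bot => tp
  | .times => tp ⟶ₗ tp ⟶ₗ tp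
  | .par => tp ⟶ₗ tp ⟶ₗ tp
  | .wth => tp ⟶ₗ tp ⟶ₗ tp
  | .plus => tp ⟶ₗ tp ⟶ₗ tp
  -- duality; the metavariables are `A A' B B'`
  | .dOne => dual (.con .one []) (.con .bot [])
  | .dBot => dual (.con .bot []) (.con .one [])
  | .dTimes => pis [tp, tp, tp, tp] <| dual (v 3) (v 2) ⟶ₗ dual (v 1) (v 0) ⟶ₗ
      dual (.con .times [v 3, v 1]) (.con .par [v 2, v 0])
  | .dPar => pis [tp, tp, tp, tp] <| dual (v 3) (v 2) ⟶ₗ dual (v 1) (v 0) ⟶ₗ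
      dual (.con .par [v 3, v 1]) (.con .times [v 2, v 0])
  | .dWth => pis [tp, tp, tp, tp] <| dual (v 3) (v 2) ⟶ₗ dual (v 1) (v 0) ⟶ₗ
      dual (.con .wth [v 3, v 1]) (.con .plus [v 2, v 0])
  | .dPlus => pis [tp, tp, tp, tp] <| dual (v 3) (v 2) ⟶ₗ dual (v 1) (v 0) ⟶ₗ
      dual (.con .plus [v 3, v 1]) (.con .wth [v 2, v 0])
  -- processes
  | .fwd => name ⟶ₗ name ⟶ₗ proc
  | .close => name ⟶ₗ proc
  | .wait => name ⟶ₗ proc ⟶ₗ proc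
  | .inl => name ⟶ₗ proc1 ⟶ₗ proc
  | .inr => name ⟶ₗ proc1 ⟶ₗ proc
  | .choice => name ⟶ₗ proc1 ⟶ₗ proc1 ⟶ₗ proc
  | .out => name ⟶ₗ proc1 ⟶ₗ proc1 ⟶ₗ proc
  | .inp => name ⟶ₗ proc2 ⟶ₗ proc
  | .pcomp => tp ⟶ₗ proc1 ⟶ₗ proc1 ⟶ₗ proc
  -- linearity, principal cases
  | .lFwd1 => pis [name] <| linear (.lam (.con .fwd [v 0, v 1]))
  | .lFwd2 => pis [name] <| linear (.lam (.con .fwd [v 1, v 0]))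
  | .lClose => linear (.lam (.con .close [v 0]))
  | .lWait => pis [proc] <| linear (.lam (.con .wait [v 0, v 1]))
  | .lOut => pis [proc1, proc1] <| linear (eta1 0) ⟶ₗ
      linear (.lam (.con .out [v 0, eta1 2, eta1 1]))
  | .lInp => pis [proc2] <| pi name (linear (.lam (.var 2 [v 0, v 1]))) ⟶ₗ
      linear (.lam (.con .inp [v 0, eta2 1]))
  | .lInl => pis [proc1] <| linear (eta1 0) ⟶ₗ linear (.lam (.con .inl [v 0, eta1 1]))
  | .lInr => pis [proc1] <| linear (eta1 0) ⟶ₗ linear (.lam (.con .inr [v 0, eta1 1]))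
  | .lChoice => pis [proc1, proc1] <| linear (eta1 1) ⟶ₗ linear (eta1 0) ⟶ₗ
      linear (.lam (.con .choice [v 0, eta1 2, eta1 1]))
  -- linearity, congruence cases
  | .lWait2 => pis [name, proc1] <| linear (eta1 0) ⟶ₗ
      linear (.lam (.con .wait [v 2, .var 1 [v 0]]))
  | .lOut2 => pis [name, proc2, proc1] <|
      pi name (linear (.lam (.var 3 [v 0, v 1]))) ⟶ₗ
      linear (.lam (.con .out [v 3, .lam (.var 3 [v 1, v 0]), eta1 1]))
  | .lOut3 => pis [name, proc1, proc2] <|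
      pi name (linear (.lam (.var 2 [v 0, v 1]))) ⟶ₗ
      linear (.lam (.con .out [v 3, eta1 2, .lam (.var 2 [v 1, v 0])]))
  | .lInp2 => pis [name, proc3] <|
      pi name (pi name (linear (.lam (.var 3 [v 0, v 2, v 1])))) ⟶ₗ
      linear (.lam (.con .inp [v 2, .lam (.lam (.var 3 [v 2, v 1, v 0]))]))
  | .lInl2 => pis [name, proc2] <|
      pi name (linear (.lam (.var 2 [v 0, v 1]))) ⟶ₗ
      linear (.lam (.con .inl [v 2, .lam (.var 2 [v 1, v 0])]))
  | .lInr2 => pis [name, proc2] <|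
      pi name (linear (.lam (.var 2 [v 0, v 1]))) ⟶ₗ
      linear (.lam (.con .inr [v 2, .lam (.var 2 [v 1, v 0])]))
  | .lChoice2 => pis [name, proc2, proc2] <|
      pi name (linear (.lam (.var 3 [v 0, v 1]))) ⟶ₗ
      pi name (linear (.lam (.var 2 [v 0, v 1]))) ⟶ₗ
      linear (.lam (.con .choice [v 3, .lam (.var 3 [v 1, v 0]), .lam (.var 2 [v 1, v 0])]))
  | .lPcomp1 => pis [tp, proc2, proc1] <|
      pi name (linear (.lam (.var 3 [v 1, v 0]))) ⟶ₗ
      linear (.lam (.con .pcomp [v 3, .lam (.var 3 [v 0, v 1]), eta1 1]))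
  | .lPcomp2 => pis [tp, proc1, proc2] <|
      pi name (linear (.lam (.var 2 [v 1, v 0]))) ⟶ₗ
      linear (.lam (.con .pcomp [v 3, eta1 2, .lam (.var 2 [v 0, v 1])]))
  -- typing
  | .wtpFwd => pis [tp, tp] <| dual (v 1) (v 0) ⟶ₗ
      pi name (hyp (v 0) (v 2) ⟶ₗ pi name (hyp (v 0) (v 2) ⟶ₗ wtp (.con .fwd [v 1, v 0])))
  | .wtpPcomp => pis [tp, tp, proc1, proc1] <| dual (v 3) (v 2) ⟶ₗ
      pi name (hyp (v 0) (v 4) ⟶ₗ wtp (.var 2 [v 0])) ⟶ₗ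
      pi name (hyp (v 0) (v 3) ⟶ₗ wtp (.var 1 [v 0])) ⟶ₗ
      linear (eta1 1) ⟶ₗ linear (eta1 0) ⟶ₗ wtp (.con .pcomp [v 3, eta1 1, eta1 0])
  | .wtpInl => pis [tp, tp, proc1, name] <| hyp (v 0) (.con .plus [v 3, v 2]) ⟶ₗ
      pi name (hyp (v 0) (v 4) ⟶ₗ wtp (.var 2 [v 0])) ⟶ₗ wtp (.con .inl [v 0, eta1 1])
  | .wtpInr => pis [tp, tp, proc1, name] <| hyp (v 0) (.con .plus [v 3, v 2]) ⟶ₗ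
      pi name (hyp (v 0) (v 3) ⟶ₗ wtp (.var 2 [v 0])) ⟶ₗ wtp (.con .inr [v 0, eta1 1])
  | .wtpChoice => pis [tp, tp, proc1, proc1, name] <| hyp (v 0) (.con .wth [v 4, v 3]) ⟶ₗ
      pi name (hyp (v 0) (v 5) ⟶ₗ wtp (.var 3 [v 0])) ⟶ₗ
      pi name (hyp (v 0) (v 4) ⟶ₗ wtp (.var 2 [v 0])) ⟶ₗ
      wtp (.con .choice [v 0, eta1 2, eta1 1])
  | .wtpOut => pis [tp, tp, proc1, proc1, name] <| hyp (v 0) (.con .times [v 4, v 3]) ⟶ₗ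
      pi name (hyp (v 0) (v 5) ⟶ₗ wtp (.var 3 [v 0])) ⟶ₗ linear (eta1 2) ⟶ₗ
      pi name (hyp (v 0) (v 4) ⟶ₗ wtp (.var 2 [v 0])) ⟶ₗ
      wtp (.con .out [v 0, eta1 2, eta1 1])
  | .wtpInp => pis [tp, tp, proc2, name] <| hyp (v 0) (.con .par [v 3, v 2]) ⟶ₗ
      pi name (hyp (v 0) (v 3) ⟶ₗ pi name (hyp (v 0) (v 5) ⟶ₗ wtp (.var 3 [v 1, v 0]))) ⟶ₗ
      pi name (linear (.lam (.var 3 [v 1, v 0]))) ⟶ₗ wtp (.con .inp [v 0, eta2 1])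
  | .wtpClose => pis [name] <| hyp (v 0) (.con .one []) ⟶ₗ wtp (.con .close [v 0])
  | .wtpWait => pis [proc, name] <| hyp (v 0) (.con .bot []) ⟶ₗ wtp (v 1) ⟶ₗ
      wtp (.con .wait [v 0, v 1])

/-! ### Typing -/

mutual
/-- `Γ ⊢ M ⇐ A`: the canonical term `M` has type `A`. -/
inductive Chk : List Ty → Tm → Ty → Prop
  | lam {Γ : List Ty} {M : Tm} {A B : Ty} : Chk (A :: Γ) M B → Chk Γ (.lam M) (.pi A B)
  | var {Γ : List Ty} {i : ℕ} {A : Ty} {S : List Tm} {a : TyC} {T : List Tm} :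
      Γ[i]? = some A → ChkSp Γ (A.ren (· + (i + 1))) S (.atom a T) →
      Chk Γ (.var i S) (.atom a T)
  | con {Γ : List Ty} {c : TmC} {S : List Tm} {a : TyC} {T : List Tm} :
      ChkSp Γ c.type S (.atom a T) → Chk Γ (.con c S) (.atom a T)
/-- `ChkSp Γ A S C`: a head of type `A` applied to the spine `S` has type `C`. -/
inductive ChkSp : List Ty → Ty → List Tm → Ty → Prop
  | nil {Γ : List Ty} {A : Ty} : ChkSp Γ A [] A
  | cons {Γ : List Ty} {A B C : Ty} {M : Tm} {S : List Tm} :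
      Chk Γ M A → ChkSp Γ (B.hsub A.erase M 0) S C → ChkSp Γ (.pi A B) (M :: S) C
end

/-- `KindSp Γ K S`: a family of kind `K` applied to the spine `S` is a type. -/
inductive KindSp : List Ty → Kind → List Tm → Prop
  | nil {Γ : List Ty} : KindSp Γ .type []
  | cons {Γ : List Ty} {A : Ty} {K : Kind} {M : Tm} {S : List Tm} :
      Chk Γ M A → KindSp Γ (K.hsub A.erase M 0) S → KindSp Γ (.pi A K) (M :: S)

/-- `Γ ⊢ A : type` -/
inductive IsType : List Ty → Ty → Prop
  | atom {Γ : List Ty} {a : TyC} {S : List Tm} : KindSp Γ a.kind S → IsType Γ (.atom a S)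
  | pi {Γ : List Ty} {A B : Ty} : IsType Γ A → IsType (A :: Γ) B → IsType Γ (.pi A B)

/-- `Γ` is a well-formed context. -/
inductive IsCtx : List Ty → Prop
  | nil : IsCtx []
  | cons {Γ : List Ty} {A : Ty} : IsCtx Γ → IsType Γ A → IsCtx (A :: Γ)

/-- The judgment `Γ ⊢ M : A` of LF, for a canonical form `M`. -/
structure LF (Γ : List Ty) (M : Tm) (A : Ty) : Prop where
  ctx : IsCtx Γ
  type : IsType Γ A
  term : Chk Γ M A

/-! ## The encoding of SCP in LF

An environment `ρ : Fin n → ℕ` assigns an LF variable to each free channel. -/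

/-- Environment under a λ that binds the newest channel `0`. -/
def liftE {n : ℕ} (ρ : Fin n → ℕ) : Fin (n + 1) → ℕ := Fin.cases 0 (fun i => ρ i + 1)

/-- Environment under a λ that binds the channel `x`. -/
def bindE {n : ℕ} (ρ : Fin n → ℕ) (x : Fin n) : Fin n → ℕ :=
  fun i => if i = x then 0 else ρ i + 1

/-- Environment where the newest channel `0` has no variable (its value is never used). -/
def skipE {n : ℕ} (ρ : Fin n → ℕ) : Fin (n + 1) → ℕ := Fin.cases 0 ρ

/-- Environment for names under an additional block `x : name, h : hyp x A`. -/
def blockE {n : ℕ} (ρ : Fin n → ℕ) : Fin (n + 1) → ℕ := Fin.cases 1 (fun i => ρ i + 2)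

/-- Environment for typing assumptions under an additional block `x : name, h : hyp x A`. -/
def hypE {n : ℕ} (η : Fin n → ℕ) : Fin (n + 1) → ℕ := Fin.cases 0 (fun i => η i + 2)

/-- `⌜A⌝` -/
def encTp : Tp → Tm
  | .one => .con .one []
  | .bot => .con .bot []
  | .tensor A B => .con .times [encTp A, encTp B]
  | .par A B => .con .par [encTp A, encTp B]
  | .plus A B => .con .plus [encTp A, encTp B]
  | .wth A B => .con .wth [encTp A, encTp B]

/-- The canonical form of type `dual ⌜A⌝ ⌜A^⊥⌝`. -/
def encDual : Tp → Tm
  | .one => .con .dOne []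
  | .bot => .con .dBot []
  | .tensor A B => .con .dTimes
      [encTp A, encTp A.dual, encTp B, encTp B.dual, encDual A, encDual B]
  | .par A B => .con .dPar
      [encTp A, encTp A.dual, encTp B, encTp B.dual, encDual A, encDual B]
  | .plus A B => .con .dPlus
      [encTp A, encTp A.dual, encTp B, encTp B.dual, encDual A, encDual B]
  | .wth A B => .con .dWth
      [encTp A, encTp A.dual, encTp B, encTp B.dual, encDual A, encDual B]

/-- `⌜P⌝` -/
def encProc : {n : ℕ} → (Fin n → ℕ) → SProc n → Tm
  | _, ρ, .fwd x y => .con .fwd [v (ρ x), v (ρ y)]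
  | _, ρ, .cut A P Q =>
    .con .pcomp [encTp A, .lam (encProc (liftE ρ) P), .lam (encProc (liftE ρ) Q)]
  | _, ρ, .out x P Q =>
    .con .out [v (ρ x), .lam (encProc (liftE ρ) P), .lam (encProc (liftE ρ) Q)]
  | _, ρ, .inp x P => .con .inp [v (ρ x), .lam (.lam (encProc (liftE (liftE ρ)) P))]
  | _, ρ, .inl x P => .con .inl [v (ρ x), .lam (encProc (liftE ρ) P)]
  | _, ρ, .inr x P => .con .inr [v (ρ x), .lam (encProc (liftE ρ) P)]
  | _, ρ, .choice x P Q =>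
    .con .choice [v (ρ x), .lam (encProc (liftE ρ) P), .lam (encProc (liftE ρ) Q)]
  | _, ρ, .close x => .con .close [v (ρ x)]
  | _, ρ, .wait x P => .con .wait [v (ρ x), encProc ρ P]

/-- `⌜L⌝ : linear (λx. ⌜P⌝)` for a derivation `L` of `lin(x; P)`. Here `ρ` is the environment for
the channels other than `x`; its value at `x` is not used. -/
def encLin : {n : ℕ} → (Fin n → ℕ) → {x : Fin n} → {P : SProc n} → Lin x P → Tm
  | _, ρ, _, _, .fwd₁ (y := y) _ => .con .lFwd1 [v (ρ y)]
  | _, ρ, _, _, .fwd₂ (x := x) _ => .con .lFwd2 [v (ρ x)]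
  | _, _, _, _, .close => .con .lClose []
  | _, ρ, _, _, .wait (P := P) _ => .con .lWait [encProc ρ P]
  | _, ρ, _, _, .out (P := P) (Q := Q) L _ _ =>
    .con .lOut [.lam (encProc (liftE ρ) P), .lam (encProc (liftE ρ) Q), encLin (skipE ρ) L]
  | _, ρ, _, _, .inp (P := P) L _ =>
    .con .lInp [.lam (.lam (encProc (liftE (liftE ρ)) P)), .lam (encLin (liftE (skipE ρ)) L)]
  | _, ρ, _, _, .inl (P := P) L _ =>
    .con .lInl [.lam (encProc (liftE ρ) P), encLin (skipE ρ) L]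
  | _, ρ, _, _, .inr (P := P) L _ =>
    .con .lInr [.lam (encProc (liftE ρ) P), encLin (skipE ρ) L]
  | _, ρ, _, _, .choice (P := P) (Q := Q) L₁ L₂ _ _ =>
    .con .lChoice [.lam (encProc (liftE ρ) P), .lam (encProc (liftE ρ) Q),
      encLin (skipE ρ) L₁, encLin (skipE ρ) L₂]
  | _, ρ, _, _, .wait₂ (z := z) (x := x) (P := P) _ L =>
    .con .lWait2 [v (ρ x), .lam (encProc (bindE ρ z) P), encLin ρ L]
  | _, ρ, _, _, .out₂ (z := z) (x := x) (P := P) (Q := Q) _ L _ =>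
    .con .lOut2 [v (ρ x), .lam (.lam (encProc (liftE (bindE ρ z)) P)),
      .lam (encProc (liftE ρ) Q), .lam (encLin (liftE ρ) L)]
  | _, ρ, _, _, .out₃ (z := z) (x := x) (P := P) (Q := Q) _ L _ =>
    .con .lOut3 [v (ρ x), .lam (encProc (liftE ρ) P),
      .lam (.lam (encProc (liftE (bindE ρ z)) Q)), .lam (encLin (liftE ρ) L)]
  | _, ρ, _, _, .inp₂ (z := z) (x := x) (P := P) _ L =>
    .con .lInp2 [v (ρ x), .lam (.lam (.lam (encProc (liftE (liftE (bindE ρ z))) P))),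
      .lam (.lam (encLin (liftE (liftE ρ)) L))]
  | _, ρ, _, _, .inl₂ (z := z) (x := x) (P := P) _ L =>
    .con .lInl2 [v (ρ x), .lam (.lam (encProc (liftE (bindE ρ z)) P)),
      .lam (encLin (liftE ρ) L)]
  | _, ρ, _, _, .inr₂ (z := z) (x := x) (P := P) _ L =>
    .con .lInr2 [v (ρ x), .lam (.lam (encProc (liftE (bindE ρ z)) P)),
      .lam (encLin (liftE ρ) L)]
  | _, ρ, _, _, .choice₂ (z := z) (x := x) (P := P) (Q := Q) _ L₁ L₂ =>
    .con .lChoice2 [v (ρ x), .lam (.lam (encProc (liftE (bindE ρ z)) P)),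
      .lam (.lam (encProc (liftE (bindE ρ z)) Q)), .lam (encLin (liftE ρ) L₁),
      .lam (encLin (liftE ρ) L₂)]
  | _, ρ, _, _, .cut₁ (z := z) (A := A) (P := P) (Q := Q) L _ =>
    .con .lPcomp1 [encTp A, .lam (.lam (encProc (bindE (liftE ρ) z.succ) P)),
      .lam (encProc (liftE ρ) Q), .lam (encLin (liftE ρ) L)]
  | _, ρ, _, _, .cut₂ (z := z) (A := A) (P := P) (Q := Q) L _ =>
    .con .lPcomp2 [encTp A, .lam (encProc (liftE ρ) P),
      .lam (.lam (encProc (bindE (liftE ρ) z.succ) Q)), .lam (encLin (liftE ρ) L)]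

/-- `⌜D⌝ : wtp ⌜P⌝` for an SCP derivation `D` of `Γ ⊩ P`; the environments `ρ` and `η` assign to
each channel its LF variable and the LF variable for its typing assumption. -/
def encDer : {n : ℕ} → (ρ η : Fin n → ℕ) → {Γ : Ctx n} → {P : SProc n} → SDer Γ P → Tm
  | _, ρ, η, _, _, .id (x := x) (y := y) A _ _ =>
    .con .wtpFwd [encTp A, encTp A.dual, encDual A, v (ρ x), v (η x), v (ρ y), v (η y)]
  | _, ρ, η, _, _, .cut (A := A) (P := P) (Q := Q) D₁ L₁ D₂ L₂ =>
    .con .wtpPcomp [encTp A, encTp A.dual, .lam (encProc (liftE ρ) P),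
      .lam (encProc (liftE ρ) Q), encDual A,
      .lam (.lam (encDer (blockE ρ) (hypE η) D₁)), .lam (.lam (encDer (blockE ρ) (hypE η) D₂)),
      encLin (skipE ρ) L₁, encLin (skipE ρ) L₂]
  | _, ρ, η, _, _, .tensor (x := x) (P := P) (Q := Q) A B _ D₁ L₁ D₂ =>
    .con .wtpOut [encTp A, encTp B, .lam (encProc (liftE ρ) P), .lam (encProc (liftE ρ) Q),
      v (ρ x), v (η x), .lam (.lam (encDer (blockE ρ) (hypE η) D₁)), encLin (skipE ρ) L₁,
      .lam (.lam (encDer (blockE ρ) (hypE η) D₂))]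
  | _, ρ, η, _, _, .par (x := x) (P := P) A B _ D L =>
    .con .wtpInp [encTp A, encTp B, .lam (.lam (encProc (liftE (liftE ρ)) P)), v (ρ x), v (η x),
      .lam (.lam (.lam (.lam (encDer (blockE (blockE ρ)) (hypE (hypE η)) D)))),
      .lam (encLin (skipE (liftE ρ)) L)]
  | _, ρ, η, _, _, .inl (x := x) (P := P) A B _ D =>
    .con .wtpInl [encTp A, encTp B, .lam (encProc (liftE ρ) P), v (ρ x), v (η x),
      .lam (.lam (encDer (blockE ρ) (hypE η) D))]
  | _, ρ, η, _, _, .inr (x := x) (P := P) A B _ D =>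
    .con .wtpInr [encTp A, encTp B, .lam (encProc (liftE ρ) P), v (ρ x), v (η x),
      .lam (.lam (encDer (blockE ρ) (hypE η) D))]
  | _, ρ, η, _, _, .wth (x := x) (P := P) (Q := Q) A B _ D₁ D₂ =>
    .con .wtpChoice [encTp A, encTp B, .lam (encProc (liftE ρ) P), .lam (encProc (liftE ρ) Q),
      v (ρ x), v (η x), .lam (.lam (encDer (blockE ρ) (hypE η) D₁)),
      .lam (.lam (encDer (blockE ρ) (hypE η) D₂))]
  | _, ρ, η, _, _, .one (x := x) _ => .con .wtpClose [v (ρ x), v (η x)]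
  | _, ρ, η, _, _, .bot (x := x) (P := P) _ D =>
    .con .wtpWait [encProc ρ P, v (ρ x), v (η x), encDer ρ η D]

/-! ## The decoding of LF in SCP

A partial function on terms. -/

def decTp : Tm → Option Tp
  | .con .one [] => some .one
  | .con .bot [] => some .bot
  | .con .times [a, b] => do return .tensor (← decTp a) (← decTp b)
  | .con .par [a, b] => do return .par (← decTp a) (← decTp b)
  | .con .plus [a, b] => do return .plus (← decTp a) (← decTp b)
  | .con .wth [a, b] => do return .wth (← decTp a) (← decTp b)
  | _ => none

/-- The channel denoted by a variable. -/
def decName {n : ℕ} (ρ : Fin n → ℕ) : Tm → Option (Fin n)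
  | .var k [] => (List.finRange n).find? (fun i => ρ i = k)
  | _ => none

/-- `⌞M⌟`, where the environment `ρ` names the variables of `M`. -/
def decProc : {n : ℕ} → (Fin n → ℕ) → Tm → Option (SProc n)
  | _, ρ, .con .fwd [x, y] => do return .fwd (← decName ρ x) (← decName ρ y)
  | _, ρ, .con .pcomp [a, .lam p, .lam q] => do
    return .cut (← decTp a) (← decProc (liftE ρ) p) (← decProc (liftE ρ) q)
  | _, ρ, .con .out [x, .lam p, .lam q] => do
    return .out (← decName ρ x) (← decProc (liftE ρ) p) (← decProc (liftE ρ) q)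
  | _, ρ, .con .inp [x, .lam (.lam p)] => do
    return .inp (← decName ρ x) (← decProc (liftE (liftE ρ)) p)
  | _, ρ, .con .inl [x, .lam p] => do return .inl (← decName ρ x) (← decProc (liftE ρ) p)
  | _, ρ, .con .inr [x, .lam p] => do return .inr (← decName ρ x) (← decProc (liftE ρ) p)
  | _, ρ, .con .choice [x, .lam p, .lam q] => do
    return .choice (← decName ρ x) (← decProc (liftE ρ) p) (← decProc (liftE ρ) q)
  | _, ρ, .con .close [x] => do return .close (← decName ρ x)
  | _, ρ, .con .wait [x, p] => do return .wait (← decName ρ x) (← decProc ρ p)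
  | _, _, _ => none

/-- `⌞L⌟`, for a canonical form `L` of type `linear (λx. ⌜P⌝)`. -/
def decLin : {n : ℕ} → (x : Fin n) → (P : SProc n) → Tm → Option (Lin x P)
  | _, z, .fwd x y, .con .lFwd1 [_] =>
    if h : z = x ∧ x ≠ y then some (.cast h.1 (.fwd₁ h.2)) else none
  | _, z, .fwd x y, .con .lFwd2 [_] =>
    if h : z = y ∧ x ≠ y then some (.cast h.1 (.fwd₂ h.2)) else none
  | _, z, .close x, .con .lClose [] => if h : z = x then some (.cast h .close) else none
  | _, z, .wait x P, .con .lWait [_] =>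
    if h : z = x ∧ x ∉ P.fn then some (.cast h.1 (.wait h.2)) else none
  | _, z, .out x P Q, .con .lOut [_, _, l] =>
    if h : z = x ∧ x.succ ∉ P.fn ∧ x.succ ∉ Q.fn then do
      return .cast h.1 (.out (← decLin 0 Q l) h.2.1 h.2.2)
    else none
  | _, z, .inp x P, .con .lInp [_, .lam l] =>
    if h : z = x ∧ x.succ.succ ∉ P.fn then do
      return .cast h.1 (.inp (← decLin 1 P l) h.2)
    else none
  | _, z, .inl x P, .con .lInl [_, l] =>
    if h : z = x ∧ x.succ ∉ P.fn then do return .cast h.1 (.inl (← decLin 0 P l) h.2) else none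
  | _, z, .inr x P, .con .lInr [_, l] =>
    if h : z = x ∧ x.succ ∉ P.fn then do return .cast h.1 (.inr (← decLin 0 P l) h.2) else none
  | _, z, .choice x P Q, .con .lChoice [_, _, l₁, l₂] =>
    if h : z = x ∧ x.succ ∉ P.fn ∧ x.succ ∉ Q.fn then do
      return .cast h.1 (.choice (← decLin 0 P l₁) (← decLin 0 Q l₂) h.2.1 h.2.2)
    else none
  | _, z, .wait x P, .con .lWait2 [_, _, l] =>
    if h : z ≠ x then do return .wait₂ h (← decLin z P l) else none
  | _, z, .out x P Q, .con .lOut2 [_, _, _, .lam l] =>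
    if h : z ≠ x ∧ z.succ ∉ Q.fn then do return .out₂ h.1 (← decLin z.succ P l) h.2 else none
  | _, z, .out x P Q, .con .lOut3 [_, _, _, .lam l] =>
    if h : z ≠ x ∧ z.succ ∉ P.fn then do return .out₃ h.1 (← decLin z.succ Q l) h.2 else none
  | _, z, .inp x P, .con .lInp2 [_, _, .lam (.lam l)] =>
    if h : z ≠ x then do return .inp₂ h (← decLin z.succ.succ P l) else none
  | _, z, .inl x P, .con .lInl2 [_, _, .lam l] =>
    if h : z ≠ x then do return .inl₂ h (← decLin z.succ P l) else none
  | _, z, .inr x P, .con .lInr2 [_, _, .lam l] =>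
    if h : z ≠ x then do return .inr₂ h (← decLin z.succ P l) else none
  | _, z, .choice x P Q, .con .lChoice2 [_, _, _, .lam l₁, .lam l₂] =>
    if h : z ≠ x then do
      return .choice₂ h (← decLin z.succ P l₁) (← decLin z.succ Q l₂)
    else none
  | _, z, .cut _ P Q, .con .lPcomp1 [_, _, _, .lam l] =>
    if h : z.succ ∉ Q.fn then do return .cut₁ (← decLin z.succ P l) h else none
  | _, z, .cut _ P Q, .con .lPcomp2 [_, _, _, .lam l] =>
    if h : z.succ ∉ P.fn then do return .cut₂ (← decLin z.succ Q l) h else none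
  | _, _, _, _ => none

/-- `⌞W⌟`, for a canonical form `W` of type `wtp ⌜P⌝` in context `⌜Γ⌝`. -/
def decDer : {n : ℕ} → (Γ : Ctx n) → (P : SProc n) → Tm → Option (SDer Γ P)
  | _, Γ, .fwd x y, .con .wtpFwd [a, _, _, _, _, _, _] => do
    let A ← decTp a
    if h : Γ x = some A ∧ Γ y = some A.dual then some (.id A h.1 h.2) else none
  | _, Γ, .cut A P Q, .con .wtpPcomp [_, _, _, _, _, .lam (.lam d₁), .lam (.lam d₂), l₁, l₂] => do
    return .cut (← decDer (Ctx.cons A Γ) P d₁) (← decLin 0 P l₁)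
      (← decDer (Ctx.cons A.dual Γ) Q d₂) (← decLin 0 Q l₂)
  | _, Γ, .out x P Q, .con .wtpOut [a, b, _, _, _, _, .lam (.lam d₁), l₁, .lam (.lam d₂)] => do
    let A ← decTp a
    let B ← decTp b
    if h : Γ x = some (.tensor A B) then
      return .tensor A B h (← decDer (Ctx.cons A Γ) P d₁) (← decLin 0 P l₁)
        (← decDer (Ctx.cons B Γ) Q d₂)
    else none
  | _, Γ, .inp x P, .con .wtpInp [a, b, _, _, _, .lam (.lam (.lam (.lam d))), .lam l] => do
    let A ← decTp a
    let B ← decTp b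
    if h : Γ x = some (.par A B) then
      return .par A B h (← decDer (Ctx.cons A (Ctx.cons B Γ)) P d) (← decLin 0 P l)
    else none
  | _, Γ, .inl x P, .con .wtpInl [a, b, _, _, _, .lam (.lam d)] => do
    let A ← decTp a
    let B ← decTp b
    if h : Γ x = some (.plus A B) then return .inl A B h (← decDer (Ctx.cons A Γ) P d) else none
  | _, Γ, .inr x P, .con .wtpInr [a, b, _, _, _, .lam (.lam d)] => do
    let A ← decTp a
    let B ← decTp b
    if h : Γ x = some (.plus A B) then return .inr A B h (← decDer (Ctx.cons B Γ) P d) else none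
  | _, Γ, .choice x P Q, .con .wtpChoice [a, b, _, _, _, _, .lam (.lam d₁), .lam (.lam d₂)] => do
    let A ← decTp a
    let B ← decTp b
    if h : Γ x = some (.wth A B) then
      return .wth A B h (← decDer (Ctx.cons A Γ) P d₁) (← decDer (Ctx.cons B Γ) Q d₂)
    else none
  | _, Γ, .close x, .con .wtpClose [_, _] =>
    if h : Γ x = some .one then some (.one h) else none
  | _, Γ, .wait x P, .con .wtpWait [_, _, _, d] =>
    if h : Γ x = some .bot then do return .bot h (← decDer Γ P d) else none
  | _, _, _, _ => none

/-! ## The composite encoding of CP in LF -/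

/-- Context of blocks `x : name, h : hyp x T`, one for each `T` in the list (newest first). -/
def blockCtx : List Tm → List Ty
  | [] => []
  | T :: Ts => .hyp (v 0) T :: .name :: blockCtx Ts

/-- `⌜Δ⌝` for the typing context `Δ` with assumptions `i : A i`, where `i : Fin n`. -/
def encCtx {n : ℕ} (A : Fin n → Tp) : List Ty := blockCtx (List.ofFn fun i => encTp (A i))

/-- The variable for channel `i` in a context of blocks. -/
def nameVar {n : ℕ} (i : Fin n) : ℕ := 2 * i + 1

/-- The variable for the typing assumption about channel `i` in a context of blocks. -/
def hypVar {n : ℕ} (i : Fin n) : ℕ := 2 * i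

/-- `⌜S⌝`, a context with an assumption `i : name` for each channel `i ∈ S` (smallest first). -/
def nameCtx {n : ℕ} (S : Finset (Fin n)) : List Ty := List.replicate S.card .name

/-- The variable for channel `i` in `nameCtx S`. -/
def rankVar {n : ℕ} (S : Finset (Fin n)) (i : Fin n) : ℕ := (S.filter (· < i)).card

/-- `λx. M` as a term over `Γ` without `x : name, h : hyp x A`, where `M` is a term over a context
`Γ` of blocks and `x`, `h` form the block with number `i`. (`h` does not occur in `M` if `M` is a
process.) -/
def lamBlock (i : ℕ) (M : Tm) : Tm :=
  .lam (M.ren fun k => if k = 2 * i + 1 then 0 else if k < 2 * i then k + 1 else k - 1)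

/-- `ε∘` on processes. -/
def encCP {n : ℕ} (ρ : Fin n → ℕ) (P : CProc n) : Tm := encProc ρ (eps P)

/-- `ε∘` on typing derivations. -/
def encCPDer {n : ℕ} {Δ : Ctx n} {P : CProc n} (D : CPDer Δ P) : Tm :=
  encDer nameVar hypVar (epsDer D)

/-- `δ∘` on processes. -/
def decCP {n : ℕ} (ρ : Fin n → ℕ) (M : Tm) : Option (CProc n) := (decProc ρ M).map del

/-- `δ∘` on typing derivations: the decoding of a canonical form `W` of type `wtp M` in `⌜Δ⌝` is a
CP process together with a derivation of it from `Δ`. -/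
def decCPDer {n : ℕ} (Δ : Ctx n) (M W : Tm) : Option (Σ P : CProc n, CPDer Δ P) := do
  let P ← decProc nameVar M
  let D ← decDer Δ P W
  let E ← delDer Δ D
  return ⟨del P, E⟩

/-- The CP typing context with assumptions `i : A i` for all `i : Fin n`. -/
def Ctx.full {n : ℕ} (A : Fin n → Tp) : Ctx n := fun i => some (A i)

end CPLF

open CPLF

namespace CPLF

/-! ## Renamings -/

-- On processes, `δ ∘ ε` is the identity without any typing: `ε` names the continuation of `x` by a
-- fresh `w`, `δ` gives it the name `x` again, and `[x/w][w/x]` is the identity (`instR_comp_absR`,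
-- `del_rename`, `del_eps`). The composite `ε ∘ δ` is the identity only if the principal channel
-- does not occur in its own continuation, since `[x/w]` would otherwise merge two channels.
-- Linearity of the free channels, together with the linearity premises of the SCP rules for bound
-- channels, excludes this throughout the process (`eps_rename`, `eps_inst`, `eps_del`).
--
-- On derivations the round trips are never followed rule by rule, because derivations are unique.
-- Linearity rules for the same channel and process do not overlap, as a linear channel is free. An
-- SCP derivation takes its types from the context and from the annotation of the cut. In a CP
-- derivation the only choice is the splitting of the context, and the domain of a CP context is
-- exactly the set of free channels (`CPDer.dom`). So equality of derivations follows from equality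
-- of processes, and what remains is that `δ` is defined. This is `delDer_isSome`: if all free
-- channels are linear, the free channels of the components split the context, or, for `case`,
-- coincide.
--
-- The LF half is adequacy of the higher-order abstract syntax. Encodings are well typed
-- (`chk_encProc`, `chk_encLin`, `chk_encDer`), by induction, once the type of each constant has
-- been instantiated by hereditary substitution. Conversely, in a context of names and hypotheses
-- every canonical form of the relevant type is an encoding (`exists_encProc`, `exists_encLin`,
-- `exists_encDer`): its head must be a constant of the right family, its arguments are encodings by
-- induction, and injectivity of the encoding identifies the process in the conclusion. A
-- metavariable that does not depend on `x` decodes to a process in which `x` is not free, which is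
-- how the side conditions of linearity are recovered.
--
-- For the second part of the claim, well-formedness of the context supplies `Δ`, the terms `L i`
-- supply linearity of all channels, and the facts above apply.

theorem liftR_comp {n m k : ℕ} (σ : Fin m → Fin k) (ρ : Fin n → Fin m) :
    liftR σ ∘ liftR ρ = liftR (σ ∘ ρ) := by
  funext i
  induction i using Fin.cases <;> rfl

theorem liftR_id {n : ℕ} : liftR (id : Fin n → Fin n) = id := by
  funext i
  induction i using Fin.cases <;> rfl

theorem CProc.rename_rename {n : ℕ} (P : CProc n) : ∀ {m k : ℕ} (ρ : Fin n → Fin m)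
    (σ : Fin m → Fin k), (P.rename ρ).rename σ = P.rename (σ ∘ ρ) := by
  induction P <;> intros <;> simp_all [rename, liftR_comp]

theorem CProc.rename_id {n : ℕ} (P : CProc n) : P.rename id = P := by
  induction P <;> simp_all [rename, liftR_id]

theorem SProc.rename_rename {n : ℕ} (P : SProc n) : ∀ {m k : ℕ} (ρ : Fin n → Fin m)
    (σ : Fin m → Fin k), (P.rename ρ).rename σ = P.rename (σ ∘ ρ) := by
  induction P <;> intros <;> simp_all [rename, liftR_comp]

theorem SProc.rename_id {n : ℕ} (P : SProc n) : P.rename id = P := by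
  induction P <;> simp_all [rename, liftR_id]

/-- Two renamings which agree on `S` agree on a set of channels after lifting. -/
theorem liftR_congr {n m : ℕ} {S : Finset (Fin (n + 1))} {ρ σ : Fin n → Fin m}
    (h : ∀ i, i.succ ∈ S → ρ i = σ i) : ∀ i ∈ S, liftR ρ i = liftR σ i := by
  intro i hi
  induction i using Fin.cases with
  | zero => rfl
  | succ i => simp [h i hi]

theorem SProc.rename_congr {n : ℕ} (P : SProc n) : ∀ {m : ℕ} {ρ σ : Fin n → Fin m},
    (∀ i ∈ P.fn, ρ i = σ i) → P.rename ρ = P.rename σ := by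
  induction P with
  | fwd x y => intro m ρ σ h; simp_all [rename, fn]
  | close x => intro m ρ σ h; simp_all [rename, fn]
  | wait x P ih => intro m ρ σ h; simp_all [rename, fn]; exact ih h.2
  | cut A P Q ihP ihQ =>
    intro m ρ σ h
    simp only [fn, Finset.mem_union, mem_lower] at h
    simp only [rename]
    rw [ihP (liftR_congr fun i hi => h i (.inl hi)), ihQ (liftR_congr fun i hi => h i (.inr hi))]
  | out x P Q ihP ihQ | choice x P Q ihP ihQ =>
    intro m ρ σ h
    simp only [fn, Finset.mem_union, mem_lower, Finset.mem_insert] at h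
    simp only [rename]
    rw [h x (.inl rfl), ihP (liftR_congr fun i hi => h i (.inr (.inl hi))),
      ihQ (liftR_congr fun i hi => h i (.inr (.inr hi)))]
  | inl x P ihP | inr x P ihP =>
    intro m ρ σ h
    simp only [fn, mem_lower, Finset.mem_insert] at h
    simp only [rename]
    rw [h x (.inl rfl), ihP (liftR_congr fun i hi => h i (.inr hi))]
  | inp x P ihP =>
    intro m ρ σ h
    simp only [fn, mem_lower, Finset.mem_insert] at h
    simp only [rename]
    -- An input binds two channels, so agreement is lifted first from `lower (lower P.fn)` to `lower
    -- P.fn` and then to `P.fn`.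
    rw [h x (.inl rfl), ihP (liftR_congr (S := P.fn) fun i hi =>
      liftR_congr (S := lower P.fn) (fun i hi => h i (.inr (by simpa using hi))) i (by simpa using hi))]

theorem SProc.rename_eq_self {n : ℕ} {P : SProc n} {ρ : Fin n → Fin n}
    (h : ∀ i ∈ P.fn, ρ i = i) : P.rename ρ = P := by
  rw [P.rename_congr (σ := id) h, P.rename_id]

/-- This composite is the identity on all channels. The opposite one fails at `x.succ`, which is why
only `ε ∘ δ` needs linearity. -/
theorem instR_comp_absR {n : ℕ} (x : Fin n) : instR x ∘ absR x = id := by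
  funext i
  by_cases h : i = x
  · subst h; simp [absR_self]
  · simp [absR_ne h]

/-- Instantiation is natural in arbitrary renamings; no injectivity is involved. -/
theorem instR_comp_liftR {n m : ℕ} (ρ : Fin n → Fin m) (x : Fin n) :
    instR (ρ x) ∘ liftR ρ = ρ ∘ instR x := by
  funext i
  induction i using Fin.cases <;> rfl

/-! ## Decoding is left inverse to encoding on processes -/

/-- `δ` only substitutes existing names for bound ones, so identifying channels by `ρ` does no harm.
Compare `eps_rename`, which requires injectivity. -/
theorem del_rename {n : ℕ} (P : SProc n) : ∀ {m : ℕ} (ρ : Fin n → Fin m),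
    del (P.rename ρ) = (del P).rename ρ := by
  induction P <;> intros <;>
    simp_all [SProc.rename, del, CProc.rename, CProc.rename_rename, liftR_comp, instR_comp_liftR]

theorem del_eps {n : ℕ} (P : CProc n) : del (eps P) = P := by
  induction P <;>
    simp_all [eps, del, del_rename, CProc.rename_rename, liftR_comp, instR_comp_absR, liftR_id,
      CProc.rename_id]

/-- The continuation of `x` becomes bound, but `x` stays free as the principal channel of the
prefix. -/
theorem fn_eps {n : ℕ} (P : CProc n) : (eps P).fn = P.fn := by
  induction P <;> ext z <;>
    simp_all [eps, SProc.fn, CProc.fn, succ_mem_fn_absR, succ_succ_mem_fn_absR] <;> grind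

/-! ## Linear channels -/

/-- Linear means used exactly once, in particular at least once. This makes the linearity rules
exclusive and gives half of `CPDer.dom`. -/
theorem Lin.mem_fn {n : ℕ} {x : Fin n} {P : SProc n} (L : Lin x P) : x ∈ P.fn := by
  induction L <;> simp_all [SProc.fn]

/-- A principal and a congruence rule cannot both apply, because the latter requires `z ≠ x`. The
two congruence rules for an output or a cut cannot both apply, because `z` would be linear, hence
free, in a component where it is not free. -/
instance Lin.subsingleton {n : ℕ} (x : Fin n) (P : SProc n) : Subsingleton (Lin x P) where
  allEq L L' := by
    induction L <;> cases L' <;>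
      first
      | rfl
      | contradiction
      | (congr 1 <;> solve_by_elim)
      | (exfalso; exact absurd (Lin.mem_fn ‹_›) ‹_›)

/-- The process determines the rule, and the types in the rule are read off from the structural
context or, for a cut, from the annotation. -/
instance SDer.subsingleton {n : ℕ} (Γ : Ctx n) (P : SProc n) : Subsingleton (SDer Γ P) where
  allEq D D' := by
    induction D with
    | id A hx hy =>
      cases D' with | id A' hx' hy' =>
      obtain rfl : A = A' := by simpa [hx] using hx'
      rfl
    | cut D₁ L₁ D₂ L₂ ih₁ ih₂ =>
      cases D' with | cut D₁' L₁' D₂' L₂' =>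
      rw [ih₁ D₁', ih₂ D₂', Subsingleton.elim L₁ L₁', Subsingleton.elim L₂ L₂']
    | tensor A B hx D₁ L₁ D₂ ih₁ ih₂ =>
      cases D' with | tensor A' B' hx' D₁' L₁' D₂' =>
      obtain ⟨rfl, rfl⟩ : A = A' ∧ B = B' := by simpa [hx] using hx'
      rw [ih₁ D₁', ih₂ D₂', Subsingleton.elim L₁ L₁']
    | par A B hx D L ih =>
      cases D' with | par A' B' hx' D' L' =>
      obtain ⟨rfl, rfl⟩ : A = A' ∧ B = B' := by simpa [hx] using hx'
      rw [ih D', Subsingleton.elim L L']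
    | inl A B hx D ih =>
      cases D' with | inl A' B' hx' D' =>
      obtain ⟨rfl, rfl⟩ : A = A' ∧ B = B' := by simpa [hx] using hx'
      rw [ih D']
    | inr A B hx D ih =>
      cases D' with | inr A' B' hx' D' =>
      obtain ⟨rfl, rfl⟩ : A = A' ∧ B = B' := by simpa [hx] using hx'
      rw [ih D']
    | wth A B hx D₁ D₂ ih₁ ih₂ =>
      cases D' with | wth A' B' hx' D₁' D₂' =>
      obtain ⟨rfl, rfl⟩ : A = A' ∧ B = B' := by simpa [hx] using hx'
      rw [ih₁ D₁', ih₂ D₂']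
    | one hx => cases D'; rfl
    | bot hx D ih =>
      cases D' with | bot hx' D' =>
      rw [ih D']

-- Contexts recovered from their domains

namespace Ctx
variable {n : ℕ}

/-- A part of a disjoint union is determined by the union and its own domain; this turns knowledge
of free channels into uniqueness of the splitting. -/
theorem Join.eq_restrict_left {Δ₁ Δ₂ Θ : Ctx n} (h : Join Δ₁ Δ₂ Θ) {S : Finset (Fin n)}
    (hS : ∀ z, Δ₁ z ≠ Option.none ↔ z ∈ S) : Δ₁ = Θ.restrict S := by
  funext z
  have := hS z
  clear hS
  rcases h z with ⟨h₁, h₂⟩ | ⟨h₁, h₂⟩ <;> by_cases hz : z ∈ S <;> simp_all [restrict]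

theorem Join.symm {Δ₁ Δ₂ Θ : Ctx n} (h : Join Δ₁ Δ₂ Θ) : Join Δ₂ Δ₁ Θ := fun z => (h z).symm

theorem eq_erase {Δ Θ : Ctx n} {x : Fin n} {A : Tp} (hx : Δ x = none) (h : Θ = Δ.set x A) :
    Δ = Θ.erase x := by
  subst h
  funext z
  by_cases e : z = x
  · subst e; simp [erase, hx]
  · simp [erase, set, e]

theorem set_self (Δ : Ctx n) (x : Fin n) (A : Tp) : Δ.set x A x = some A := by simp [set]

theorem set_ne (Δ : Ctx n) {x z : Fin n} (A : Tp) (h : z ≠ x) : Δ.set x A z = Δ z := by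
  simp [set, h]

theorem erase_ne (Δ : Ctx n) {x z : Fin n} (h : z ≠ x) : Δ.erase x z = Δ z := by
  simp [erase, h]

theorem eq_set_erase {Δ : Ctx n} {x : Fin n} {A : Tp} (h : Δ x = some A) :
    Δ = (Δ.erase x).set x A := by
  funext z
  by_cases e : z = x
  · subst e; simp [set, h]
  · simp [erase, set, e]

end Ctx

/-- CP has no weakening: a typed channel is linear in the encoding, hence free in it, and `ε`
preserves free channels. -/
theorem CPDer.dom {n : ℕ} {Θ : Ctx n} {P : CProc n} (D : CPDer Θ P) (z : Fin n) :
    Θ z ≠ none ↔ z ∈ P.fn := by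
  rw [← CPLF.fn_eps]
  exact ⟨fun h => (D.lin z h).mem_fn, fun h h' => D.fn_eps z h' h⟩

/-- Types are forced by the context of the conclusion, and contexts of the premises by the free
channels of the components. -/
instance CPDer.subsingleton {n : ℕ} (Θ : Ctx n) (P : CProc n) : Subsingleton (CPDer Θ P) where
  allEq D D' := by
    induction D with
    | id x y A hxy hΘ =>
      cases D' with | id _ _ A' _ hΘ' =>
      obtain rfl : A = A' := by
        have := congrFun (hΘ.symm.trans hΘ') x
        simpa [Ctx.set, hxy] using this
      rfl
    | @cut _ _ Δ₁ Δ₂ A P Q hΘ D₁ D₂ ih₁ ih₂ =>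
      cases D' with | cut Δ₁' Δ₂' hΘ' D₁' D₂' =>
      have e₁ := hΘ.eq_restrict_left (S := lower P.fn) fun z => by
        rw [mem_lower]; exact D₁.dom z.succ
      have e₁' := hΘ'.eq_restrict_left (S := lower P.fn) fun z => by
        rw [mem_lower]; exact D₁'.dom z.succ
      have e₂ := hΘ.symm.eq_restrict_left (S := lower Q.fn) fun z => by
        rw [mem_lower]; exact D₂.dom z.succ
      have e₂' := hΘ'.symm.eq_restrict_left (S := lower Q.fn) fun z => by
        rw [mem_lower]; exact D₂'.dom z.succ
      obtain rfl := e₁.trans e₁'.symm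
      obtain rfl := e₂.trans e₂'.symm
      rw [ih₁ D₁', ih₂ D₂']
    | @tensor _ _ Δ Δ₁ Δ₂ x A B P Q hΔ hx hΘ D₁ D₂ ih₁ ih₂ =>
      cases D' with | tensor Δ' Δ₁' Δ₂' _ A' B' hΔ' hx' hΘ' D₁' D₂' =>
      obtain ⟨rfl, rfl⟩ : A = A' ∧ B = B' := by
        simpa [Ctx.set] using congrFun (hΘ.symm.trans hΘ') x
      obtain rfl := (Ctx.eq_erase hx hΘ).trans (Ctx.eq_erase hx' hΘ').symm
      have e₁ := hΔ.eq_restrict_left (S := lower P.fn) fun z => by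
        rw [mem_lower]; exact D₁.dom z.succ
      have e₁' := hΔ'.eq_restrict_left (S := lower P.fn) fun z => by
        rw [mem_lower]; exact D₁'.dom z.succ
      -- The premise for `Q` also types `x`, at the continuation type, so `x` is removed from the
      -- free channels of `Q`.
      have key : ∀ {Δ₂ : Ctx _}, CPDer (Δ₂.set x B) Q → Δ₂ x = none →
          ∀ z, Δ₂ z ≠ none ↔ z ∈ Finset.erase Q.fn x := by
        intro Δ₂ D h z
        rw [Finset.mem_erase, ← D.dom z]
        by_cases e : z = x
        · subst e; simp [h]
        · simp [e, Ctx.set_ne]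
      have e₂ := hΔ.symm.eq_restrict_left (key D₂ (hΔ.none hx).2)
      have e₂' := hΔ'.symm.eq_restrict_left (key D₂' (hΔ'.none hx).2)
      obtain rfl := e₁.trans e₁'.symm
      obtain rfl := e₂.trans e₂'.symm
      rw [ih₁ D₁', ih₂ D₂']
    | par Δ x A B hx hΘ D ih =>
      cases D' with | par Δ' _ A' B' hx' hΘ' D' =>
      obtain ⟨rfl, rfl⟩ : A = A' ∧ B = B' := by
        simpa [Ctx.set] using congrFun (hΘ.symm.trans hΘ') x
      obtain rfl := (Ctx.eq_erase hx hΘ).trans (Ctx.eq_erase hx' hΘ').symm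
      rw [ih D']
    | inl Δ x A B hx hΘ D ih =>
      cases D' with | inl Δ' _ A' B' hx' hΘ' D' =>
      obtain ⟨rfl, rfl⟩ : A = A' ∧ B = B' := by
        simpa [Ctx.set] using congrFun (hΘ.symm.trans hΘ') x
      obtain rfl := (Ctx.eq_erase hx hΘ).trans (Ctx.eq_erase hx' hΘ').symm
      rw [ih D']
    | inr Δ x A B hx hΘ D ih =>
      cases D' with | inr Δ' _ A' B' hx' hΘ' D' =>
      obtain ⟨rfl, rfl⟩ : A = A' ∧ B = B' := by
        simpa [Ctx.set] using congrFun (hΘ.symm.trans hΘ') x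
      obtain rfl := (Ctx.eq_erase hx hΘ).trans (Ctx.eq_erase hx' hΘ').symm
      rw [ih D']
    | wth Δ x A B hx hΘ D₁ D₂ ih₁ ih₂ =>
      cases D' with | wth Δ' _ A' B' hx' hΘ' D₁' D₂' =>
      obtain ⟨rfl, rfl⟩ : A = A' ∧ B = B' := by
        simpa [Ctx.set] using congrFun (hΘ.symm.trans hΘ') x
      obtain rfl := (Ctx.eq_erase hx hΘ).trans (Ctx.eq_erase hx' hΘ').symm
      rw [ih₁ D₁', ih₂ D₂']
    | one x hΘ => cases D'; rfl
    | bot Δ x hx hΘ D ih =>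
      cases D' with | bot Δ' _ hx' hΘ' D' =>
      obtain rfl := (Ctx.eq_erase hx hΘ).trans (Ctx.eq_erase hx' hΘ').symm
      rw [ih D']

/-! ## Definedness of the decoding of derivations -/

/-- All free channels of `P` are linear. -/
def SProc.Linear {n : ℕ} (P : SProc n) : Prop := ∀ z ∈ P.fn, Nonempty (Lin z P)

/-- The channel bound in `P` is invisible in the output, so its linearity must come separately, from
the premise of the typing rule. Every other free channel of `P` is linear by a congruence rule, the
competing rules asserting that it is not free in `P`. -/
theorem SProc.Linear.out_left {n : ℕ} {x : Fin n} {P Q : SProc (n + 1)}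
    (h : (SProc.out x P Q).Linear) (hP : Nonempty (Lin 0 P)) : P.Linear := by
  intro z hz
  induction z using Fin.cases with
  | zero => exact hP
  | succ z =>
    obtain ⟨L⟩ := h z (by simp [fn, hz])
    cases L <;> first | contradiction | exact ⟨‹_›⟩

/-- Here nothing has to be assumed about the bound channel: `x` is free in the output, and its
linearity can only come from the principal rule, which provides linearity of the continuation and
freshness of `x` in both components. -/
theorem SProc.Linear.out_right {n : ℕ} {x : Fin n} {P Q : SProc (n + 1)}
    (h : (SProc.out x P Q).Linear) : Q.Linear ∧ 0 ∈ Q.fn ∧ x.succ ∉ P.fn ∧ x.succ ∉ Q.fn := by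
  obtain ⟨L⟩ := h x (by simp [fn])
  cases L with
  | out L₀ hP hQ =>
    refine ⟨fun z hz => ?_, L₀.mem_fn, hP, hQ⟩
    induction z using Fin.cases with
    | zero => exact ⟨L₀⟩
    | succ z =>
      obtain ⟨L⟩ := h z (by simp [fn, hz])
      cases L <;> first | contradiction | exact ⟨‹_›⟩
  | out₂ h | out₃ h => exact absurd rfl h

theorem SProc.Linear.cut {n : ℕ} {A : Tp} {P Q : SProc (n + 1)} (h : (SProc.cut A P Q).Linear)
    (hP : Nonempty (Lin 0 P)) (hQ : Nonempty (Lin 0 Q)) : P.Linear ∧ Q.Linear := by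
  constructor <;> intro z hz <;> induction z using Fin.cases with
  | zero => assumption
  | succ z =>
    obtain ⟨L⟩ := h z (by simp [fn, hz])
    cases L <;> first | contradiction | exact ⟨‹_›⟩

/-- Linearity of the received channel `0` is a premise of the typing rule; that of the continuation
`1` comes from linearity of `x`. -/
theorem SProc.Linear.inp {n : ℕ} {x : Fin n} {P : SProc (n + 2)} (h : (SProc.inp x P).Linear)
    (hP : Nonempty (Lin 0 P)) : P.Linear ∧ 1 ∈ P.fn ∧ x.succ.succ ∉ P.fn := by
  obtain ⟨L⟩ := h x (by simp [fn])
  cases L with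
  | inp L₀ hx =>
    refine ⟨fun z hz => ?_, L₀.mem_fn, hx⟩
    induction z using Fin.cases with
    | zero => exact hP
    | succ z =>
      induction z using Fin.cases with
      | zero => exact ⟨L₀⟩
      | succ z =>
        obtain ⟨L⟩ := h z (by simp [fn, hz])
        cases L <;> first | contradiction | exact ⟨‹_›⟩
  | inp₂ h => exact absurd rfl h

theorem SProc.Linear.inl {n : ℕ} {x : Fin n} {P : SProc (n + 1)} (h : (SProc.inl x P).Linear) :
    P.Linear ∧ 0 ∈ P.fn ∧ x.succ ∉ P.fn := by
  obtain ⟨L⟩ := h x (by simp [fn])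
  cases L with
  | inl L₀ hx =>
    refine ⟨fun z hz => ?_, L₀.mem_fn, hx⟩
    induction z using Fin.cases with
    | zero => exact ⟨L₀⟩
    | succ z =>
      obtain ⟨L⟩ := h z (by simp [fn, hz])
      cases L <;> first | contradiction | exact ⟨‹_›⟩
  | inl₂ h => exact absurd rfl h

theorem SProc.Linear.inr {n : ℕ} {x : Fin n} {P : SProc (n + 1)} (h : (SProc.inr x P).Linear) :
    P.Linear ∧ 0 ∈ P.fn ∧ x.succ ∉ P.fn := by
  obtain ⟨L⟩ := h x (by simp [fn])
  cases L with
  | inr L₀ hx =>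
    refine ⟨fun z hz => ?_, L₀.mem_fn, hx⟩
    induction z using Fin.cases with
    | zero => exact ⟨L₀⟩
    | succ z =>
      obtain ⟨L⟩ := h z (by simp [fn, hz])
      cases L <;> first | contradiction | exact ⟨‹_›⟩
  | inr₂ h => exact absurd rfl h

theorem SProc.Linear.choice {n : ℕ} {x : Fin n} {P Q : SProc (n + 1)}
    (h : (SProc.choice x P Q).Linear) : (P.Linear ∧ 0 ∈ P.fn ∧ x.succ ∉ P.fn) ∧
      (Q.Linear ∧ 0 ∈ Q.fn ∧ x.succ ∉ Q.fn) := by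
  obtain ⟨L⟩ := h x (by simp [fn])
  cases L with
  | choice L₁ L₂ hP hQ =>
    refine ⟨⟨fun z hz => ?_, L₁.mem_fn, hP⟩, fun z hz => ?_, L₂.mem_fn, hQ⟩ <;>
    induction z using Fin.cases with
    | zero => exact ⟨‹_›⟩
    | succ z =>
      obtain ⟨L⟩ := h z (by simp [fn, hz])
      cases L <;> first | contradiction | exact ⟨‹_›⟩
  | choice₂ h => exact absurd rfl h

theorem SProc.Linear.wait {n : ℕ} {x : Fin n} {P : SProc n}
    (h : (SProc.wait x P).Linear) : P.Linear ∧ x ∉ P.fn := by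
  obtain ⟨L⟩ := h x (by simp [fn])
  cases L with
  | wait hx =>
    refine ⟨fun z hz => ?_, hx⟩
    obtain ⟨L⟩ := h z (by simp [fn, hz])
    cases L <;> first | contradiction | exact ⟨‹_›⟩
  | wait₂ h => exact absurd rfl h

/-- A channel of `ν x : A. (P ∥ Q)` or of an output is not free in both components. -/
theorem SProc.Linear.cut_disjoint {n : ℕ} {A : Tp} {P Q : SProc (n + 1)}
    (h : (SProc.cut A P Q).Linear) (z : Fin n) (hP : z.succ ∈ P.fn) : z.succ ∉ Q.fn := by
  obtain ⟨L⟩ := h z (by simp [fn, hP])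
  cases L <;> first | contradiction | assumption

theorem SProc.Linear.out_disjoint {n : ℕ} {x : Fin n} {P Q : SProc (n + 1)}
    (h : (SProc.out x P Q).Linear) (z : Fin n) (hP : z.succ ∈ P.fn) : z.succ ∉ Q.fn := by
  obtain ⟨L⟩ := h z (by simp [fn, hP])
  cases L <;> first | contradiction | assumption

theorem Ctx.cons_le {n : ℕ} {Δ Γ : Ctx n} (h : ∀ z A, Δ z = some A → Γ z = some A) (A : Tp) :
    ∀ z B, Ctx.cons A Δ z = some B → Ctx.cons A Γ z = some B := by
  intro z
  induction z using Fin.cases with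
  | zero => exact fun B h => h
  | succ z => exact fun B hB => h z B hB

theorem Ctx.cons_dom {n : ℕ} {Δ : Ctx n} {S : Finset (Fin (n + 1))} (h₀ : 0 ∈ S)
    (h : ∀ z, Δ z ≠ none ↔ z.succ ∈ S) (A : Tp) : ∀ z, Ctx.cons A Δ z ≠ none ↔ z ∈ S := by
  intro z
  induction z using Fin.cases with
  | zero => simp [h₀]
  | succ z => exact h z

/-- Each clause of `delDer` is a guard followed by recursive calls in the option monad; this lemma
and the next one discharge them one at a time. -/
theorem isSome_dite {α : Type*} {p : Prop} [Decidable p] {f : p → Option α} (h : p)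
    (hf : (f h).isSome) : (if h : p then f h else none).isSome := by
  rwa [dif_pos h]

theorem isSome_bind {α β : Type} {a : Option α} {x : α} {f : α → Option β} (h : a = some x)
    (hf : (f x).isSome) : (a >>= f).isSome := by
  subst h; exact hf

/-- `δ` is defined on derivations of `Γ ⊩ P` if all free channels of `P` are linear. -/
theorem delDer_isSome {n : ℕ} {Γ : Ctx n} {P : SProc n} (D : SDer Γ P) : ∀ (Δ : Ctx n),
    (∀ z A, Δ z = some A → Γ z = some A) → (∀ z, Δ z ≠ none ↔ z ∈ P.fn) → P.Linear →
    (delDer Δ D).isSome := by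
  -- The SCP context `Γ` never shrinks, while the CP context `Δ` retains exactly the free channels.
  -- On those the two agree, so the types found in `Γ` are those required in `Δ`.
  have some_of {n : ℕ} {Δ Γ : Ctx n} (h : ∀ z A, Δ z = some A → Γ z = some A) {x : Fin n} {A : Tp}
      (hx : Δ x ≠ none) (hΓ : Γ x = some A) : Δ x = some A := by
    obtain ⟨B, hB⟩ := Option.ne_none_iff_exists'.1 hx
    rw [hB, ← hΓ, h x B hB]
  have erase_le {n : ℕ} {Δ Γ : Ctx n} (h : ∀ z A, Δ z = some A → Γ z = some A) (x : Fin n) :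
      ∀ z A, Δ.erase x z = some A → Γ z = some A := by
    intro z A hz
    by_cases e : z = x
    · subst e; simp [Ctx.erase] at hz
    · exact h z A (by rwa [Ctx.erase_ne _ e] at hz)
  have restrict_le {n : ℕ} {Δ Γ : Ctx n} (h : ∀ z A, Δ z = some A → Γ z = some A)
      (S : Finset (Fin n)) : ∀ z A, Δ.restrict S z = some A → Γ z = some A := by
    intro z A hz
    simp only [Ctx.restrict] at hz
    split_ifs at hz
    exact h z A hz
  -- Freshness of the principal channel in its components makes the context without it match their
  -- free channels.
  have erase_dom {n : ℕ} {Δ : Ctx n} {x : Fin n} {S : Finset (Fin n)}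
      (h : ∀ z, Δ z ≠ none ↔ z ∈ insert x S) (hx : x ∉ S) : ∀ z, Δ.erase x z ≠ none ↔ z ∈ S := by
    intro z
    by_cases e : z = x
    · subst e; simp [Ctx.erase, hx]
    · rw [Ctx.erase_ne _ e, h]; simp [e]
  have restrict_dom {n : ℕ} {Δ : Ctx n} {S T : Finset (Fin n)}
      (h : ∀ z, Δ z ≠ none ↔ z ∈ T) (hS : S ⊆ T) :
      ∀ z, Δ.restrict S z ≠ none ↔ z ∈ S := by
    intro z
    by_cases e : z ∈ S
    · simp only [Ctx.restrict, e, if_true, h, hS e]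
    · simp [Ctx.restrict, e]
  -- Disjointness of the free channels of the components is what makes the restrictions a legitimate
  -- CP splitting.
  have join {n : ℕ} {Δ : Ctx n} {S T : Finset (Fin n)}
      (h : ∀ z, Δ z ≠ none ↔ z ∈ S ∪ T) (hS : ∀ z ∈ S, z ∉ T) :
      Ctx.Join (Δ.restrict S) (Δ.restrict T) Δ := by
    intro z
    by_cases hz : z ∈ S
    · exact .inr ⟨by simp [Ctx.restrict, hS z hz], by simp [Ctx.restrict, hz]⟩
    · refine .inl ⟨by simp [Ctx.restrict, hz], ?_⟩
      by_cases hz' : z ∈ T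
      · simp [Ctx.restrict, hz']
      · simpa [Ctx.restrict, hz, hz'] using h z
  induction D with
  | @id n Γ x y A hx hy =>
    intro Δ hΔ hd hl
    -- The SCP rule does not state that the channels differ; linearity of `x` in the forwarder does.
    have hxy : x ≠ y := by
      obtain ⟨L⟩ := hl x (by simp [SProc.fn])
      cases L <;> assumption
    have e : Δ = (Ctx.empty.set x A).set y A.dual := by
      funext z
      by_cases hz : z = y
      · subst hz
        rw [Ctx.set_self]
        exact some_of hΔ ((hd _).2 (by simp [SProc.fn])) hy
      · rw [Ctx.set_ne _ _ hz]
        by_cases hz' : z = x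
        · subst hz'
          rw [Ctx.set_self]
          exact some_of hΔ ((hd _).2 (by simp [SProc.fn])) hx
        · rw [Ctx.set_ne _ _ hz']
          simpa [SProc.fn, hz, hz', Ctx.empty] using hd z
    exact isSome_dite ⟨hxy, e⟩ rfl
  | @cut n Γ A P Q D₁ L₁ D₂ L₂ ih₁ ih₂ =>
    intro Δ hΔ hd hl
    simp only [SProc.fn] at hd
    obtain ⟨h₁, h₂⟩ := hl.cut ⟨L₁⟩ ⟨L₂⟩
    refine isSome_dite (join hd (by simpa using hl.cut_disjoint)) ?_
    obtain ⟨E₁, e₁⟩ := Option.isSome_iff_exists.1 (ih₁ (Ctx.cons A (Δ.restrict (lower P.fn)))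
      (Ctx.cons_le (restrict_le hΔ _) _) (Ctx.cons_dom L₁.mem_fn
        (fun z => (restrict_dom hd Finset.subset_union_left z).trans mem_lower) _) h₁)
    obtain ⟨E₂, e₂⟩ := Option.isSome_iff_exists.1 (ih₂ (Ctx.cons A.dual (Δ.restrict (lower Q.fn)))
      (Ctx.cons_le (restrict_le hΔ _) _) (Ctx.cons_dom L₂.mem_fn
        (fun z => (restrict_dom hd Finset.subset_union_right z).trans mem_lower) _) h₂)
    exact isSome_bind e₁ (isSome_bind e₂ rfl)
  | @tensor n Γ x P Q A B hx D₁ L₁ D₂ ih₁ ih₂ =>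
    intro Δ hΔ hd hl
    simp only [SProc.fn] at hd
    have h₁ := hl.out_left ⟨L₁⟩
    obtain ⟨h₂, h0, hP, hQ⟩ := hl.out_right
    have hd' := erase_dom hd (by simp [hP, hQ])
    refine isSome_dite ⟨join hd' (by simpa using hl.out_disjoint),
      Ctx.eq_set_erase (some_of hΔ ((hd x).2 (by simp)) hx)⟩ ?_
    obtain ⟨E₁, e₁⟩ := Option.isSome_iff_exists.1 (ih₁
      (Ctx.cons A ((Δ.erase x).restrict (lower P.fn)))
      (Ctx.cons_le (restrict_le (erase_le hΔ x) _) _) (Ctx.cons_dom L₁.mem_fn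
        (fun z => (restrict_dom hd' Finset.subset_union_left z).trans mem_lower) _) h₁)
    obtain ⟨E₂, e₂⟩ := Option.isSome_iff_exists.1 (ih₂
      (Ctx.cons B ((Δ.erase x).restrict (lower Q.fn)))
      (Ctx.cons_le (restrict_le (erase_le hΔ x) _) _) (Ctx.cons_dom h0
        (fun z => (restrict_dom hd' Finset.subset_union_right z).trans mem_lower) _) h₂)
    exact isSome_bind e₁ (isSome_bind e₂ rfl)
  | @par n Γ x P A B hx D L ih =>
    intro Δ hΔ hd hl
    simp only [SProc.fn] at hd
    obtain ⟨h, h1, hP⟩ := hl.inp ⟨L⟩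
    have hd' := erase_dom hd (by simp [hP])
    refine isSome_dite (Ctx.eq_set_erase (some_of hΔ ((hd x).2 (by simp)) hx)) ?_
    obtain ⟨E, e⟩ := Option.isSome_iff_exists.1 (ih (Ctx.cons A (Ctx.cons B (Δ.erase x)))
      (Ctx.cons_le (Ctx.cons_le (erase_le hΔ x) _) _) (Ctx.cons_dom L.mem_fn
        (fun z => (Ctx.cons_dom (S := lower P.fn) (by simpa using h1)
          (fun z => (hd' z).trans mem_lower) B z).trans mem_lower) _) h)
    exact isSome_bind e rfl
  | @inl n Γ x P A B hx D ih =>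
    intro Δ hΔ hd hl
    simp only [SProc.fn] at hd
    obtain ⟨h, h0, hP⟩ := hl.inl
    have hd' := erase_dom hd (by simp [hP])
    refine isSome_dite (Ctx.eq_set_erase (some_of hΔ ((hd x).2 (by simp)) hx)) ?_
    obtain ⟨E, e⟩ := Option.isSome_iff_exists.1 (ih (Ctx.cons A (Δ.erase x))
      (Ctx.cons_le (erase_le hΔ x) _) (Ctx.cons_dom h0 (fun z => (hd' z).trans mem_lower) _) h)
    exact isSome_bind e rfl
  | @inr n Γ x P A B hx D ih =>
    intro Δ hΔ hd hl
    simp only [SProc.fn] at hd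
    obtain ⟨h, h0, hP⟩ := hl.inr
    have hd' := erase_dom hd (by simp [hP])
    refine isSome_dite (Ctx.eq_set_erase (some_of hΔ ((hd x).2 (by simp)) hx)) ?_
    obtain ⟨E, e⟩ := Option.isSome_iff_exists.1 (ih (Ctx.cons B (Δ.erase x))
      (Ctx.cons_le (erase_le hΔ x) _) (Ctx.cons_dom h0 (fun z => (hd' z).trans mem_lower) _) h)
    exact isSome_bind e rfl
  | @wth n Γ x P Q A B hx D₁ D₂ ih₁ ih₂ =>
    intro Δ hΔ hd hl
    obtain ⟨⟨h₁, h₁0, hP⟩, h₂, h₂0, hQ⟩ := hl.choice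
    simp only [SProc.fn] at hd
    -- Both branches of a CP `case` are typed in the same context. They have the same free channels
    -- because the congruence rule requires linearity, hence occurrence, in both.
    have heq : lower P.fn = lower Q.fn := by
      ext z
      have key : z ∈ lower P.fn ∪ lower Q.fn → z ∈ lower P.fn ∧ z ∈ lower Q.fn := by
        intro hz
        obtain ⟨L⟩ := hl z (by simp only [SProc.fn]; exact Finset.mem_insert_of_mem hz)
        cases L with
        | choice => simp [hP, hQ] at hz
        | choice₂ _ L₁ L₂ => simp [L₁.mem_fn, L₂.mem_fn]
      exact ⟨fun h => (key (Finset.mem_union_left _ h)).2,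
        fun h => (key (Finset.mem_union_right _ h)).1⟩
    rw [heq, Finset.union_self] at hd
    have hd' := erase_dom hd (by simp [hQ])
    refine isSome_dite (Ctx.eq_set_erase (some_of hΔ ((hd x).2 (by simp)) hx)) ?_
    obtain ⟨E₁, e₁⟩ := Option.isSome_iff_exists.1 (ih₁ (Ctx.cons A (Δ.erase x))
      (Ctx.cons_le (erase_le hΔ x) _) (Ctx.cons_dom h₁0
        (fun z => (hd' z).trans (heq ▸ mem_lower)) _) h₁)
    obtain ⟨E₂, e₂⟩ := Option.isSome_iff_exists.1 (ih₂ (Ctx.cons B (Δ.erase x))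
      (Ctx.cons_le (erase_le hΔ x) _) (Ctx.cons_dom h₂0 (fun z => (hd' z).trans mem_lower) _) h₂)
    exact isSome_bind e₁ (isSome_bind e₂ rfl)
  | @one n Γ x hx =>
    intro Δ hΔ hd hl
    refine isSome_dite (α := CPDer Δ (.close x)) ?_ rfl
    · funext z
      by_cases hz : z = x
      · subst hz
        rw [Ctx.set_self]
        exact some_of hΔ ((hd _).2 (by simp [SProc.fn])) hx
      · rw [Ctx.set_ne _ _ hz]
        simpa [SProc.fn, hz, Ctx.empty] using hd z
  | @bot n Γ x P hx D ih =>
    intro Δ hΔ hd hl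
    simp only [SProc.fn] at hd
    obtain ⟨h, hP⟩ := hl.wait
    refine isSome_dite (Ctx.eq_set_erase (some_of hΔ ((hd x).2 (by simp)) hx)) ?_
    obtain ⟨E, e⟩ := Option.isSome_iff_exists.1 (ih (Δ.erase x) (erase_le hΔ x)
      (erase_dom hd hP) h)
    exact isSome_bind e rfl

/-! ## Encoding is left inverse to decoding on linear typed processes -/

/-- Renaming the image of `x` to the continuation would also capture any other channel that `ρ`
sends there; the hypothesis excludes this for `i`. -/
theorem absR_comp {n m : ℕ} {ρ : Fin n → Fin m} {x i : Fin n} (h : ρ i = ρ x → i = x) :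
    (absR (ρ x) ∘ ρ) i = (liftR ρ ∘ absR x) i := by
  by_cases e : i = x
  · subst e; simp [absR_self]
  · simp [absR_ne e, absR_ne (fun h' => e (h h'))]

theorem liftR_injOn {n m : ℕ} {S : Finset (Fin (n + 1))} {ρ : Fin n → Fin m}
    (h : Set.InjOn ρ (lower S)) : Set.InjOn (liftR ρ) S := by
  intro i hi j hj
  induction i using Fin.cases <;> induction j using Fin.cases
  · simp
  · simp [(Fin.succ_ne_zero _).symm]
  · simp [Fin.succ_ne_zero]
  · intro e
    exact congrArg Fin.succ (h (by simpa using hi) (by simpa using hj) (by simpa using e))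

/-- `ε` turns every occurrence of the principal channel into its continuation, so it commutes with a
renaming that does not merge free channels. Injectivity on free channels is enough, and `[x/w]` is
not injective on all channels. -/
theorem eps_rename {n : ℕ} (P : CProc n) : ∀ {m : ℕ} (ρ : Fin n → Fin m),
    Set.InjOn ρ P.fn → eps (P.rename ρ) = (eps P).rename ρ := by
  -- The common step for continuations: the two orders of renaming agree on the free channels, where
  -- `ρ` separates `x` from the rest.
  have key {n m : ℕ} {ρ : Fin n → Fin m} {x : Fin n} {S : Finset (Fin n)} (P : CProc n)
      (h : Set.InjOn ρ (insert x S : Finset (Fin n))) (hP : P.fn ⊆ S) :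
      (eps P).rename (absR (ρ x) ∘ ρ) = (eps P).rename (liftR ρ ∘ absR x) :=
    SProc.rename_congr _ fun i hi => absR_comp
      (h (Finset.mem_insert_of_mem (hP ((fn_eps P).subset hi))) (by simp))
  induction P with
  | fwd | close => intros; rfl
  | wait x P ih =>
    intro m ρ h
    simp only [CProc.fn] at h
    simp [CProc.rename, eps, SProc.rename, ih ρ (h.mono (by simp))]
  | cut A P Q ihP ihQ =>
    intro m ρ h
    simp only [CProc.fn] at h
    simp [CProc.rename, eps, SProc.rename, ihP _ (liftR_injOn (h.mono (by simp))),
      ihQ _ (liftR_injOn (h.mono (by simp)))]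
  | out x P Q ihP ihQ =>
    intro m ρ h
    simp only [CProc.fn] at h
    simp [CProc.rename, eps, SProc.rename, SProc.rename_rename,
      ihP _ (liftR_injOn (h.mono fun i hi => by simp at hi; simp [hi])),
      ihQ ρ (h.mono fun i hi => by simp at hi; simp [hi]), key Q h (by simp)]
  | inp x P ih =>
    intro m ρ h
    simp only [CProc.fn] at h
    simp only [CProc.rename, eps, SProc.rename, SProc.rename_rename, liftR_comp,
      ih _ (liftR_injOn (h.mono (by simp)))]
    congr 1
    refine SProc.rename_congr _ (liftR_congr fun i hi => absR_comp (h ?_ (by simp)))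
    simp [← fn_eps, hi]
  | inl x P ih | inr x P ih =>
    intro m ρ h
    simp only [CProc.fn] at h
    simp [CProc.rename, eps, SProc.rename, SProc.rename_rename, ih ρ (h.mono (by simp)),
      key P h (by simp)]
  | choice x P Q ihP ihQ =>
    intro m ρ h
    simp only [CProc.fn] at h
    simp [CProc.rename, eps, SProc.rename, SProc.rename_rename,
      ihP ρ (h.mono fun i hi => by simp at hi; simp [hi]),
      ihQ ρ (h.mono fun i hi => by simp at hi; simp [hi]), key P h (by simp), key Q h (by simp)]

/-- The channel `x.succ` is excluded because `instR x` merges it with the bound channel `0`. -/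
theorem absR_instR {n : ℕ} {x : Fin n} {i : Fin (n + 1)} (h : i ≠ x.succ) :
    absR x (instR x i) = i := by
  induction i using Fin.cases with
  | zero => simp [absR_self]
  | succ i => exact absR_ne fun e => h (by simpa using e)

theorem instR_injOn {n : ℕ} {x : Fin n} {S : Finset (Fin (n + 1))} (h : x.succ ∉ S) :
    Set.InjOn (instR x) S := by
  intro i hi j hj e
  have key {i : Fin (n + 1)} (hi : i ∈ S) : absR x (instR x i) = i :=
    absR_instR fun e => h (e ▸ hi)
  rw [← key hi, e, key hj]

/-- Once the old principal channel is absent from the continuation, `[x/w]` loses no information and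
`[w/x]` undoes it. -/
theorem eps_inst {n : ℕ} {x : Fin n} {P : CProc (n + 1)} (h : x.succ ∉ P.fn) :
    (eps (P.rename (instR x))).rename (absR x) = eps P := by
  rw [eps_rename P _ (instR_injOn h), SProc.rename_rename]
  refine SProc.rename_eq_self fun i hi => absR_instR ?_
  rintro rfl
  exact h (fn_eps P ▸ hi)

theorem eps_liftInst {n : ℕ} {x : Fin n} {P : CProc (n + 2)} (h : x.succ.succ ∉ P.fn) :
    (eps (P.rename (liftR (instR x)))).rename (liftR (absR x)) = eps P := by
  rw [eps_rename P _ (liftR_injOn (instR_injOn (by simpa using h))), SProc.rename_rename,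
    liftR_comp]
  refine SProc.rename_eq_self fun i hi => ?_
  induction i using Fin.cases with
  | zero => rfl
  | succ i =>
    rw [liftR_succ, Function.comp_apply, absR_instR]
    rintro rfl
    exact h (fn_eps P ▸ hi)

/-- The hypothesis `h` concerns free channels only. The derivation supplies linearity of the
channels bound by cut, output and input, so that the hypothesis passes to the components; there
linearity of `x` gives the freshness needed for `eps_inst` and `eps_liftInst`. -/
theorem eps_del {n : ℕ} {Γ : Ctx n} {P : SProc n} (D : SDer Γ P) (h : P.Linear) :
    eps (del P) = P := by
  -- Freshness is known for `P` and wanted for its decoding; the inductive hypothesis and invariance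
  -- of free channels under `ε` transfer it.
  have notMem {n : ℕ} {x : Fin n} {P : SProc n} (h : eps (del P) = P) (hx : x ∉ P.fn) :
      x ∉ (del P).fn := by rwa [← fn_eps, h]
  induction D with
  | id | one => rfl
  | cut D₁ L₁ D₂ L₂ ih₁ ih₂ =>
    obtain ⟨h₁, h₂⟩ := h.cut ⟨L₁⟩ ⟨L₂⟩
    simp [del, eps, ih₁ h₁, ih₂ h₂]
  | tensor A B hx D₁ L₁ D₂ ih₁ ih₂ =>
    have h₁ := h.out_left ⟨L₁⟩
    obtain ⟨h₂, -, -, hQ⟩ := h.out_right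
    simp [del, eps, eps_inst (notMem (ih₂ h₂) hQ), ih₁ h₁, ih₂ h₂]
  | par A B hx D L ih =>
    obtain ⟨h', -, hP⟩ := h.inp ⟨L⟩
    simp [del, eps, eps_liftInst (notMem (ih h') hP), ih h']
  | inl A B hx D ih =>
    obtain ⟨h', -, hP⟩ := h.inl
    simp [del, eps, eps_inst (notMem (ih h') hP), ih h']
  | inr A B hx D ih =>
    obtain ⟨h', -, hP⟩ := h.inr
    simp [del, eps, eps_inst (notMem (ih h') hP), ih h']
  | wth A B hx D₁ D₂ ih₁ ih₂ =>
    obtain ⟨⟨h₁, -, hP⟩, h₂, -, hQ⟩ := h.choice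
    simp [del, eps, eps_inst (notMem (ih₁ h₁) hP), eps_inst (notMem (ih₂ h₂) hQ), ih₁ h₁, ih₂ h₂]
  | bot hx D ih => simp [del, eps, ih h.wait.1]

/-! ## Decoding is left inverse to encoding in LF -/

theorem liftE_injective {n : ℕ} {ρ : Fin n → ℕ} (h : Function.Injective ρ) :
    Function.Injective (liftE ρ) := by
  intro i j
  refine Fin.cases ?_ (fun i => ?_) i <;> refine Fin.cases ?_ (fun j => ?_) j <;>
    simp [liftE, h.eq_iff]

theorem decTp_encTp (A : Tp) : decTp (encTp A) = some A := by
  induction A <;> simp_all [encTp, decTp]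

theorem encTp_injective : Function.Injective encTp := fun A B h => by
  simpa [decTp_encTp] using congrArg decTp h

theorem decName_var {n : ℕ} {ρ : Fin n → ℕ} (h : Function.Injective ρ) (x : Fin n) :
    decName ρ (v (ρ x)) = some x := by
  simp only [decName]
  cases hf : (List.finRange n).find? (fun i => ρ i = ρ x) with
  | none => simpa using List.find?_eq_none.1 hf x (List.mem_finRange x)
  | some j =>
    have := List.find?_some hf
    exact congrArg some (h (by simpa using this))

/-- Injectivity of the environment lets a channel be recovered from its variable, and it survives
passage under a binder. -/
theorem decProc_encProc {n : ℕ} (P : SProc n) : ∀ {ρ : Fin n → ℕ}, Function.Injective ρ →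
    decProc ρ (encProc ρ P) = some P := by
  have ih2 {n : ℕ} {P : SProc (n + 2)} (ih : ∀ {ρ : Fin (n + 2) → ℕ}, Function.Injective ρ →
      decProc ρ (encProc ρ P) = some P) {ρ : Fin n → ℕ} (h : Function.Injective ρ) :=
    ih (liftE_injective (liftE_injective h))
  induction P <;> intro ρ h <;>
    simp_all [encProc, decProc, decTp_encTp, decName_var, liftE_injective]

theorem encProc_injective {n : ℕ} {ρ : Fin n → ℕ} (h : Function.Injective ρ) :
    Function.Injective (encProc ρ) := fun P Q e => by
  simpa [decProc_encProc _ h] using congrArg (decProc ρ) e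

/-- The environment is arbitrary because the decoding reads only the rule constants and the
subderivations. Names and processes are taken from `x` and `P`. -/
theorem decLin_encLin {n : ℕ} {x : Fin n} {P : SProc n} (L : Lin x P) : ∀ ρ : Fin n → ℕ,
    decLin x P (encLin ρ L) = some L := by
  induction L <;> intro ρ <;> simp_all [encLin, decLin, Lin.cast]

/-- As for linearity, variables are ignored. Only the types that the process does not display are
decoded, and those are closed terms. -/
theorem decDer_encDer {n : ℕ} {Γ : Ctx n} {P : SProc n} (D : SDer Γ P) : ∀ ρ η : Fin n → ℕ,
    decDer Γ P (encDer ρ η D) = some D := by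
  induction D with
  | id A hx hy =>
    intro ρ η
    simp only [encDer, decDer, decTp_encTp]
    exact dif_pos ⟨hx, hy⟩
  | cut D₁ L₁ D₂ L₂ ih₁ ih₂ =>
    intro ρ η
    simp only [encDer, decDer, decLin_encLin, ih₁, ih₂]
    rfl
  | tensor A B hx D₁ L₁ D₂ ih₁ ih₂ =>
    intro ρ η
    simp only [encDer, decDer, decTp_encTp, decLin_encLin]
    refine (dif_pos hx).trans ?_
    simp only [ih₁, ih₂]
    rfl
  | par A B hx D L ih =>
    intro ρ η
    simp only [encDer, decDer, decTp_encTp, decLin_encLin]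
    refine (dif_pos hx).trans ?_
    simp only [ih]
    rfl
  | inl A B hx D ih | inr A B hx D ih =>
    intro ρ η
    simp only [encDer, decDer, decTp_encTp]
    refine (dif_pos hx).trans ?_
    simp only [ih]
    rfl
  | wth A B hx D₁ D₂ ih₁ ih₂ =>
    intro ρ η
    simp only [encDer, decDer, decTp_encTp]
    refine (dif_pos hx).trans ?_
    simp only [ih₁, ih₂]
    rfl
  | one hx =>
    intro ρ η
    simp only [encDer, decDer]
    exact dif_pos hx
  | bot hx D ih =>
    intro ρ η
    simp only [encDer, decDer, ih]
    exact dif_pos hx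

/-! ## Environments in normal form -/

/-- The environments met below are built from a base environment by `consE`, `shE` and `bndE`.
Weakening and substitution pass through these operations by arithmetic on indices, so equality of
environments can be decided by normalization. The operations `liftE`, `skipE`, `blockE` and `bindE`
are special cases. -/
def consE {n : ℕ} (a : ℕ) (ρ : Fin n → ℕ) : Fin (n + 1) → ℕ := Fin.cases a ρ

def shE {n : ℕ} (c : ℕ) (ρ : Fin n → ℕ) : Fin n → ℕ := fun i => ρ i + c

def bndE {n : ℕ} (z : Fin n) (a c : ℕ) (ρ : Fin n → ℕ) : Fin n → ℕ :=
  fun i => if i = z then a else ρ i + c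

/-- Weakening of variables: those from `d` on are raised by `c`. -/
def wk (d c i : ℕ) : ℕ := if i < d then i else i + c

/-- Instantiation of variable `k` by variable `j`. -/
def sbv (k j i : ℕ) : ℕ := if i < k then i else if i = k then j + k else i - 1

/-- Removal of variable `k`. -/
def strv (k i : ℕ) : ℕ := if i < k then i else i - 1

def wkE {n : ℕ} (d c : ℕ) (ρ : Fin n → ℕ) : Fin n → ℕ := fun i => wk d c (ρ i)
def sbvE {n : ℕ} (k j : ℕ) (ρ : Fin n → ℕ) : Fin n → ℕ := fun i => sbv k j (ρ i)
def strE {n : ℕ} (k : ℕ) (ρ : Fin n → ℕ) : Fin n → ℕ := fun i => strv k (ρ i)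
-- The condition under which substitution for variable `k` does nothing but close the gap in the
-- indices.
def Avoids {n : ℕ} (k : ℕ) (ρ : Fin n → ℕ) : Prop := ∀ i, ρ i ≠ k

section
variable {n : ℕ} (ρ : Fin n → ℕ)

theorem liftE_eq : liftE ρ = consE 0 (shE 1 ρ) := rfl
theorem skipE_eq : skipE ρ = consE 0 (shE 0 ρ) := rfl
theorem blockE_eq : blockE ρ = consE 1 (shE 2 ρ) := rfl
theorem bindE_eq (z : Fin n) : bindE ρ z = bndE z 0 1 ρ := rfl

theorem shE_consE (a c : ℕ) : shE c (consE a ρ) = consE (a + c) (shE c ρ) := by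
  funext i; induction i using Fin.cases <;> rfl
theorem shE_shE (c d : ℕ) : shE c (shE d ρ) = shE (d + c) ρ := by
  funext i; simp [shE, add_assoc]
theorem shE_bndE (z : Fin n) (a c d : ℕ) : shE c (bndE z a d ρ) = bndE z (a + c) (d + c) ρ := by
  funext i; simp only [shE, bndE]; split_ifs <;> simp [add_assoc]
theorem bndE_shE (z : Fin n) (a c d : ℕ) : bndE z a c (shE d ρ) = bndE z a (d + c) ρ := by
  funext i; simp [shE, bndE, add_assoc]
theorem bndE_zero_consE (a b c : ℕ) : bndE 0 a c (consE b ρ) = consE a (shE c ρ) := by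
  funext i; induction i using Fin.cases <;> simp [bndE, consE, shE, Fin.succ_ne_zero]
theorem bndE_succ_consE (z : Fin n) (a b c : ℕ) :
    bndE z.succ a c (consE b ρ) = consE (b + c) (bndE z a c ρ) := by
  funext i; induction i using Fin.cases <;>
    simp [bndE, consE, (Fin.succ_ne_zero _).symm]
theorem bndE_one_consE (ρ : Fin (n + 1) → ℕ) (a b c : ℕ) :
    bndE 1 a c (consE b ρ) = consE (b + c) (bndE 0 a c ρ) := bndE_succ_consE ρ 0 a b c

theorem wkE_consE (d c a : ℕ) : wkE d c (consE a ρ) = consE (wk d c a) (wkE d c ρ) := by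
  funext i; induction i using Fin.cases <;> rfl
theorem wkE_shE {d e : ℕ} (h : d ≤ e) (c : ℕ) : wkE d c (shE e ρ) = shE (e + c) ρ := by
  funext i; grind [wkE, wk, shE]
theorem wkE_zero (c : ℕ) : wkE 0 c ρ = shE c ρ := rfl
theorem wkE_bndE {d e : ℕ} (h : d ≤ e) (z : Fin n) (a c : ℕ) :
    wkE d c (bndE z a e ρ) = bndE z (wk d c a) (e + c) ρ := by
  funext i; simp only [wkE, wk, bndE]; split_ifs <;> omega

theorem sbvE_consE (k j a : ℕ) : sbvE k j (consE a ρ) = consE (sbv k j a) (sbvE k j ρ) := by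
  funext i; induction i using Fin.cases <;> rfl
theorem sbvE_shE {k e : ℕ} (h : k < e) (j : ℕ) : sbvE k j (shE e ρ) = shE (e - 1) ρ := by
  funext i; grind [sbvE, sbv, shE]
theorem sbvE_bndE {k e : ℕ} (h : k < e) (z : Fin n) (a j : ℕ) :
    sbvE k j (bndE z a e ρ) = bndE z (sbv k j a) (e - 1) ρ := by
  funext i; simp only [sbvE, sbv, bndE]; split_ifs <;> omega

theorem strE_consE (k a : ℕ) : strE k (consE a ρ) = consE (strv k a) (strE k ρ) := by
  funext i; induction i using Fin.cases <;> rfl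
theorem strE_shE {k e : ℕ} (h : k < e) : strE k (shE e ρ) = shE (e - 1) ρ := by
  funext i; grind [strE, strv, shE]
theorem strE_bndE {k e : ℕ} (h : k < e) (z : Fin n) (a : ℕ) :
    strE k (bndE z a e ρ) = bndE z (strv k a) (e - 1) ρ := by
  funext i; simp only [strE, strv, bndE]; split_ifs <;> omega

theorem avoids_consE (k a : ℕ) : Avoids k (consE a ρ) ↔ a ≠ k ∧ Avoids k ρ :=
  Fin.forall_fin_succ
theorem avoids_shE {k e : ℕ} (h : k < e) : Avoids k (shE e ρ) := fun i => by
  simp only [shE]; omega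
theorem avoids_bndE {k e a : ℕ} (h : k < e) (ha : a ≠ k) (z : Fin n) :
    Avoids k (bndE z a e ρ) := fun i => by
  simp only [bndE]; split_ifs <;> omega

end

/-! ## Renaming and hereditary substitution -/

theorem upN_wk (d c : ℕ) : upN (wk d c) = wk (d + 1) c := by
  funext i
  cases i with
  | zero => simp [upN, wk]
  | succ i => simp only [upN, wk]; split_ifs <;> omega

theorem succ_eq_wk : Nat.succ = wk 0 1 := rfl

theorem upN_comp (f : ℕ → ℕ) {n : ℕ} (ρ : Fin n → ℕ) : upN f ∘ liftE ρ = liftE (f ∘ ρ) := by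
  funext i; induction i using Fin.cases <;> rfl

theorem Tm.ren_encTp (f : ℕ → ℕ) (A : Tp) : (encTp A).ren f = encTp A := by
  induction A <;> simp_all [encTp, Tm.ren, Tm.renList]

theorem Tm.substWith_encTp (app : Tm → List Tm → Tm) (N : Tm) (k : ℕ) (A : Tp) :
    Tm.substWith app N k (encTp A) = encTp A := by
  induction A <;> simp_all [encTp, Tm.substWith, Tm.substWithList]

theorem Tm.ren_encProc {n : ℕ} (P : SProc n) : ∀ (f : ℕ → ℕ) (ρ : Fin n → ℕ),
    (encProc ρ P).ren f = encProc (f ∘ ρ) P := by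
  induction P <;> intro f ρ <;> simp_all [encProc, Tm.ren, Tm.renList, upN_comp, Tm.ren_encTp]

theorem Tm.ren_encProc_wk {n : ℕ} (P : SProc n) (d c : ℕ) (ρ : Fin n → ℕ) :
    (encProc ρ P).ren (wk d c) = encProc (wkE d c ρ) P := Tm.ren_encProc P _ _

theorem Tm.happ_base (M : Tm) (S : List Tm) : Tm.happ .base M S = M := by
  cases M <;> cases S <;> simp [Tm.happ]

theorem Tm.happ_var (α : STy) (i : ℕ) (T S : List Tm) : Tm.happ α (.var i T) S = .var i T := by
  cases α <;> cases S <;> simp [Tm.happ]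

theorem Tm.happ_lam (α β : STy) (M N : Tm) (S : List Tm) :
    Tm.happ (.arr α β) (.lam M) (N :: S) = Tm.happ β (Tm.substWith (Tm.happ α) N 0 M) S := by
  simp [Tm.happ]

/-- A channel variable has atomic type and heads no application, so substituting a variable for it
creates no redex and amounts to a change of environment. This computes the application of an
abstracted process to names. -/
theorem Tm.substWith_encProc_var {n : ℕ} (P : SProc n) (α : STy) (j : ℕ) :
    ∀ (k : ℕ) (ρ : Fin n → ℕ),
    Tm.substWith (Tm.happ α) (v j) k (encProc ρ P) = encProc (sbvE k j ρ) P := by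
  have key (k i : ℕ) : Tm.substWith (Tm.happ α) (v j) k (v i) = v (sbv k j i) := by
    simp only [Tm.substWith, sbv, Tm.ren, Tm.renList, Tm.substWithList, Tm.happ_var]
    split_ifs <;> rfl
  have lift (k : ℕ) {n : ℕ} (ρ : Fin n → ℕ) : sbvE (k + 1) j (liftE ρ) = liftE (sbvE k j ρ) := by
    funext i
    induction i using Fin.cases with
    | zero => rfl
    | succ i => simp only [sbvE, liftE, Fin.cases_succ, sbv]; grind
  induction P <;> intro k ρ <;>
    simp_all only [encProc, Tm.substWith, Tm.substWithList, Tm.substWith_encTp] <;>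
    simp [sbvE]

/-- `app` and `N` are arbitrary because they are never used: no channel is mapped to variable `k`.
This covers the instantiation of other metavariables in an already instantiated type. -/
theorem Tm.substWith_encProc {n : ℕ} (P : SProc n) (app : Tm → List Tm → Tm) (N : Tm) :
    ∀ (k : ℕ) (ρ : Fin n → ℕ), Avoids k ρ →
    Tm.substWith app N k (encProc ρ P) = encProc (strE k ρ) P := by
  have key {k i : ℕ} (h : i ≠ k) : Tm.substWith app N k (v i) = v (strv k i) := by
    simp only [Tm.substWith, strv, Tm.substWithList]
    split_ifs <;> rfl
  have avoid {k n : ℕ} {ρ : Fin n → ℕ} (h : Avoids k ρ) : Avoids (k + 1) (liftE ρ) := by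
    intro i
    induction i using Fin.cases with
    | zero => simp [liftE]
    | succ i => simpa [liftE] using h i
  have lift (k : ℕ) {n : ℕ} (ρ : Fin n → ℕ) (h : Avoids k ρ) :
      strE (k + 1) (liftE ρ) = liftE (strE k ρ) := by
    funext i
    induction i using Fin.cases with
    | zero => rfl
    | succ i => have := h i; simp only [strE, liftE, Fin.cases_succ, strv]; grind
  have con (k : ℕ) (c : TmC) (S : List Tm) : Tm.substWith app N k (.con c S) =
      .con c (Tm.substWithList app N k S) := by simp only [Tm.substWith]
  have lam (k : ℕ) (M : Tm) : Tm.substWith app N k (.lam M) =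
      .lam (Tm.substWith app N (k + 1) M) := by simp only [Tm.substWith]
  induction P <;> intro k ρ h <;>
    simp only [encProc, Tm.substWithList, Tm.substWith_encTp, key (h _), *, avoid h,
      avoid (avoid h), lift _ _ h, lift _ _ (avoid h)] <;>
    simp [strE]

/-! ## Typing rules of LF as equivalences -/

theorem chk_lam_iff {Γ : List Ty} {M : Tm} {A B : Ty} :
    Chk Γ (.lam M) (.pi A B) ↔ Chk (A :: Γ) M B :=
  ⟨fun | .lam h => h, .lam⟩

theorem chk_con_iff {Γ : List Ty} {c : TmC} {S : List Tm} {a : TyC} {T : List Tm} :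
    Chk Γ (.con c S) (.atom a T) ↔ ChkSp Γ c.type S (.atom a T) :=
  ⟨fun | .con h => h, .con⟩

theorem chkSp_nil_iff {Γ : List Ty} {A C : Ty} : ChkSp Γ A [] C ↔ A = C :=
  ⟨fun | .nil => rfl, fun h => h ▸ .nil⟩

theorem chkSp_cons_iff {Γ : List Ty} {A B C : Ty} {M : Tm} {S : List Tm} :
    ChkSp Γ (.pi A B) (M :: S) C ↔ Chk Γ M A ∧ ChkSp Γ (B.hsub A.erase M 0) S C :=
  ⟨fun | .cons h h' => ⟨h, h'⟩, fun h => .cons h.1 h.2⟩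

theorem chk_encTp (Γ : List Ty) (A : Tp) : Chk Γ (encTp A) .tp := by
  induction A <;>
    simp_all [encTp, chk_con_iff, chkSp_cons_iff, chkSp_nil_iff, TmC.type, Ty.hsub, Ty.ren,
      Tm.renList]

-- Evaluation of hereditary substitutions

theorem Tm.substWith_var (app : Tm → List Tm → Tm) (N : Tm) (k i : ℕ) (S : List Tm) :
    Tm.substWith app N k (.var i S) =
      if i < k then .var i (Tm.substWithList app N k S)
      else if i = k then app (N.ren (wk 0 k)) (Tm.substWithList app N k S)
      else .var (i - 1) (Tm.substWithList app N k S) := by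
  simp only [Tm.substWith]
  rfl

theorem Tm.substWith_lam (app : Tm → List Tm → Tm) (N : Tm) (k : ℕ) (M : Tm) :
    Tm.substWith app N k (.lam M) = .lam (Tm.substWith app N (k + 1) M) := by
  simp only [Tm.substWith]

theorem Tm.substWith_con (app : Tm → List Tm → Tm) (N : Tm) (k : ℕ) (c : TmC) (S : List Tm) :
    Tm.substWith app N k (.con c S) = .con c (Tm.substWithList app N k S) := by
  simp only [Tm.substWith]

theorem not_add_lt {i c k : ℕ} (h : k ≤ c) : ¬ i + c < k := by omega

theorem shE_zero {n : ℕ} (ρ : Fin n → ℕ) : shE 0 ρ = ρ := rfl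

-- With these rules the type of a constant is evaluated on a spine of encodings: metavariables are
-- replaced, abstracted processes are applied to their names, and the resulting environments are
-- normalized, so that both sides of the equivalences below become the same expression.
attribute [simp] not_add_lt shE_zero chk_lam_iff chk_con_iff chkSp_nil_iff chkSp_cons_iff chk_encTp
  TmC.type
  Ty.ren Tm.ren Tm.renList Ty.hsub Tm.hsub Ty.erase Tm.substWith_var Tm.substWith_lam
  Tm.substWith_con Tm.substWithList
  Tm.happ_lam Tm.happ_base liftE_eq skipE_eq blockE_eq bindE_eq shE_consE shE_shE shE_bndE
  bndE_shE bndE_zero_consE bndE_succ_consE bndE_one_consE wkE_consE wkE_shE wkE_zero wkE_bndE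
  sbvE_consE sbvE_shE sbvE_bndE strE_consE strE_shE strE_bndE avoids_consE avoids_shE avoids_bndE
  succ_eq_wk upN_wk Tm.ren_encTp Tm.ren_encProc_wk Tm.substWith_encProc_var
  Tm.substWith_encProc Tm.substWith_encTp wk sbv strv

-- Typing of the process constants

section processes
variable {Γ : List Ty}

theorem chk_fwd {x y : Tm} : Chk Γ (.con .fwd [x, y]) .proc ↔
    Chk Γ x .name ∧ Chk Γ y .name := by
  simp

theorem chk_close {x : Tm} : Chk Γ (.con .close [x]) .proc ↔
    Chk Γ x .name := by
  simp

theorem chk_wait {x p : Tm} : Chk Γ (.con .wait [x, p]) .proc ↔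
    Chk Γ x .name ∧ Chk Γ p .proc := by
  simp

theorem chk_inl {x p : Tm} : Chk Γ (.con .inl [x, p]) .proc ↔
    Chk Γ x .name ∧ Chk Γ p .proc1 := by
  simp

theorem chk_inr {x p : Tm} : Chk Γ (.con .inr [x, p]) .proc ↔
    Chk Γ x .name ∧ Chk Γ p .proc1 := by
  simp

theorem chk_choice {x p q : Tm} : Chk Γ (.con .choice [x, p, q]) .proc ↔
    Chk Γ x .name ∧ Chk Γ p .proc1 ∧ Chk Γ q .proc1 := by
  simp

theorem chk_out {x p q : Tm} : Chk Γ (.con .out [x, p, q]) .proc ↔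
    Chk Γ x .name ∧ Chk Γ p .proc1 ∧ Chk Γ q .proc1 := by
  simp

theorem chk_inp {x p : Tm} : Chk Γ (.con .inp [x, p]) .proc ↔
    Chk Γ x .name ∧ Chk Γ p .proc2 := by
  simp

theorem chk_pcomp {a p q : Tm} : Chk Γ (.con .pcomp [a, p, q]) .proc ↔
    Chk Γ a .tp ∧ Chk Γ p .proc1 ∧ Chk Γ q .proc1 := by
  simp

end processes

-- Typing of the duality constants

section duality
variable {Γ : List Ty} {A A' B B' : Tp} {d e a b : Tm}

theorem chk_dOne : Chk Γ (.con .dOne []) (.dual a b) ↔ .con .one [] = a ∧ .con .bot [] = b := by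
  simp

theorem chk_dBot : Chk Γ (.con .dBot []) (.dual a b) ↔ .con .bot [] = a ∧ .con .one [] = b := by
  simp

theorem chk_dTimes : Chk Γ (.con .dTimes [encTp A, encTp A', encTp B, encTp B', d, e]) (.dual a b) ↔
    Chk Γ d (.dual (encTp A) (encTp A')) ∧ Chk Γ e (.dual (encTp B) (encTp B')) ∧
      .con .times [encTp A, encTp B] = a ∧ .con .par [encTp A', encTp B'] = b := by
  simp

theorem chk_dPar : Chk Γ (.con .dPar [encTp A, encTp A', encTp B, encTp B', d, e]) (.dual a b) ↔
    Chk Γ d (.dual (encTp A) (encTp A')) ∧ Chk Γ e (.dual (encTp B) (encTp B')) ∧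
      .con .par [encTp A, encTp B] = a ∧ .con .times [encTp A', encTp B'] = b := by
  simp

theorem chk_dWth : Chk Γ (.con .dWth [encTp A, encTp A', encTp B, encTp B', d, e]) (.dual a b) ↔
    Chk Γ d (.dual (encTp A) (encTp A')) ∧ Chk Γ e (.dual (encTp B) (encTp B')) ∧
      .con .wth [encTp A, encTp B] = a ∧ .con .plus [encTp A', encTp B'] = b := by
  simp

theorem chk_dPlus : Chk Γ (.con .dPlus [encTp A, encTp A', encTp B, encTp B', d, e]) (.dual a b) ↔
    Chk Γ d (.dual (encTp A) (encTp A')) ∧ Chk Γ e (.dual (encTp B) (encTp B')) ∧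
      .con .plus [encTp A, encTp B] = a ∧ .con .wth [encTp A', encTp B'] = b := by
  simp

end duality

-- Typing of the linearity constants

section linearity
variable {Γ : List Ty} {n : ℕ} {ρ : Fin n → ℕ} {z : Fin n} {i : ℕ} {l l' C : Tm}

/-- The index `C` is left general, with the conclusion of the rule as an equation. Read from right
to left such an equivalence types an encoding; read from left to right it inverts the rule and
identifies the process. -/
theorem chk_lFwd1 : Chk Γ (.con .lFwd1 [v i]) (.linear C) ↔
    Chk Γ (v i) .name ∧ .lam (.con .fwd [v 0, v (i + 1)]) = C := by
  simp

theorem chk_lFwd2 : Chk Γ (.con .lFwd2 [v i]) (.linear C) ↔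
    Chk Γ (v i) .name ∧ .lam (.con .fwd [v (i + 1), v 0]) = C := by
  simp

theorem chk_lClose : Chk Γ (.con .lClose []) (.linear C) ↔ .lam (.con .close [v 0]) = C := by
  simp

theorem chk_lWait {P : SProc n} : Chk Γ (.con .lWait [encProc ρ P]) (.linear C) ↔
    Chk Γ (encProc ρ P) .proc ∧ .lam (.con .wait [v 0, encProc (shE 1 ρ) P]) = C := by
  simp

/-- `P` and `Q` do not depend on the principal name, so they are merely shifted under its
abstraction. In the premise the continuation has no variable of its own in `Γ`; it is the abstracted
channel. -/
theorem chk_lOut {P Q : SProc (n + 1)} :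
    Chk Γ (.con .lOut [.lam (encProc (liftE ρ) P), .lam (encProc (liftE ρ) Q), l]) (.linear C) ↔
      Chk (.name :: Γ) (encProc (liftE ρ) P) .proc ∧
      Chk (.name :: Γ) (encProc (liftE ρ) Q) .proc ∧
      Chk Γ l (.linear (.lam (encProc (bindE (skipE ρ) 0) Q))) ∧
      .lam (.con .out [v 0, .lam (encProc (liftE (shE 1 ρ)) P),
        .lam (encProc (liftE (shE 1 ρ)) Q)]) = C := by
  simp

/-- The received channel is Π-quantified before the continuation is abstracted, which is why the
abstracted channel is number `1`. -/
theorem chk_lInp {P : SProc (n + 2)} :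
    Chk Γ (.con .lInp [.lam (.lam (encProc (liftE (liftE ρ)) P)), l]) (.linear C) ↔
      Chk (.name :: .name :: Γ) (encProc (liftE (liftE ρ)) P) .proc ∧
      Chk Γ l (.pi .name (.linear (.lam (encProc (bindE (liftE (skipE ρ)) 1) P)))) ∧
      .lam (.con .inp [v 0, .lam (.lam (encProc (liftE (liftE (shE 1 ρ))) P))]) = C := by
  simp

theorem chk_lInl {P : SProc (n + 1)} :
    Chk Γ (.con .lInl [.lam (encProc (liftE ρ) P), l]) (.linear C) ↔
      Chk (.name :: Γ) (encProc (liftE ρ) P) .proc ∧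
      Chk Γ l (.linear (.lam (encProc (bindE (skipE ρ) 0) P))) ∧
      .lam (.con .inl [v 0, .lam (encProc (liftE (shE 1 ρ)) P)]) = C := by
  simp

theorem chk_lInr {P : SProc (n + 1)} :
    Chk Γ (.con .lInr [.lam (encProc (liftE ρ) P), l]) (.linear C) ↔
      Chk (.name :: Γ) (encProc (liftE ρ) P) .proc ∧
      Chk Γ l (.linear (.lam (encProc (bindE (skipE ρ) 0) P))) ∧
      .lam (.con .inr [v 0, .lam (encProc (liftE (shE 1 ρ)) P)]) = C := by
  simp

theorem chk_lChoice {P Q : SProc (n + 1)} :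
    Chk Γ (.con .lChoice [.lam (encProc (liftE ρ) P), .lam (encProc (liftE ρ) Q), l, l'])
        (.linear C) ↔
      Chk (.name :: Γ) (encProc (liftE ρ) P) .proc ∧
      Chk (.name :: Γ) (encProc (liftE ρ) Q) .proc ∧
      Chk Γ l (.linear (.lam (encProc (bindE (skipE ρ) 0) P))) ∧
      Chk Γ l' (.linear (.lam (encProc (bindE (skipE ρ) 0) Q))) ∧
      .lam (.con .choice [v 0, .lam (encProc (liftE (shE 1 ρ)) P),
        .lam (encProc (liftE (shE 1 ρ)) Q)]) = C := by
  simp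

theorem chk_lWait2 {P : SProc n} :
    Chk Γ (.con .lWait2 [v i, .lam (encProc (bindE ρ z) P), l]) (.linear C) ↔
      Chk Γ (v i) .name ∧ Chk (.name :: Γ) (encProc (bindE ρ z) P) .proc ∧
      Chk Γ l (.linear (.lam (encProc (bindE ρ z) P))) ∧
      .lam (.con .wait [v (i + 1), encProc (bindE ρ z) P]) = C := by
  simp

theorem chk_lOut2 {P Q : SProc (n + 1)} :
    Chk Γ (.con .lOut2 [v i, .lam (.lam (encProc (liftE (bindE ρ z)) P)),
        .lam (encProc (liftE ρ) Q), l]) (.linear C) ↔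
      Chk Γ (v i) .name ∧ Chk (.name :: .name :: Γ) (encProc (liftE (bindE ρ z)) P) .proc ∧
      Chk (.name :: Γ) (encProc (liftE ρ) Q) .proc ∧
      Chk Γ l (.pi .name (.linear (.lam (encProc (bindE (liftE ρ) z.succ) P)))) ∧
      .lam (.con .out [v (i + 1), .lam (encProc (liftE (bindE ρ z)) P),
        .lam (encProc (liftE (shE 1 ρ)) Q)]) = C := by
  simp

theorem chk_lOut3 {P Q : SProc (n + 1)} :
    Chk Γ (.con .lOut3 [v i, .lam (encProc (liftE ρ) P),
        .lam (.lam (encProc (liftE (bindE ρ z)) Q)), l]) (.linear C) ↔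
      Chk Γ (v i) .name ∧ Chk (.name :: Γ) (encProc (liftE ρ) P) .proc ∧
      Chk (.name :: .name :: Γ) (encProc (liftE (bindE ρ z)) Q) .proc ∧
      Chk Γ l (.pi .name (.linear (.lam (encProc (bindE (liftE ρ) z.succ) Q)))) ∧
      .lam (.con .out [v (i + 1), .lam (encProc (liftE (shE 1 ρ)) P),
        .lam (encProc (liftE (bindE ρ z)) Q)]) = C := by
  simp

theorem chk_lInp2 {P : SProc (n + 2)} :
    Chk Γ (.con .lInp2 [v i, .lam (.lam (.lam (encProc (liftE (liftE (bindE ρ z))) P))), l])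
        (.linear C) ↔
      Chk Γ (v i) .name ∧
      Chk (.name :: .name :: .name :: Γ) (encProc (liftE (liftE (bindE ρ z))) P) .proc ∧
      Chk Γ l (.pi .name (.pi .name
        (.linear (.lam (encProc (bindE (liftE (liftE ρ)) z.succ.succ) P))))) ∧
      .lam (.con .inp [v (i + 1), .lam (.lam (encProc (liftE (liftE (bindE ρ z))) P))]) = C := by
  simp

theorem chk_lInl2 {P : SProc (n + 1)} :
    Chk Γ (.con .lInl2 [v i, .lam (.lam (encProc (liftE (bindE ρ z)) P)), l]) (.linear C) ↔
      Chk Γ (v i) .name ∧ Chk (.name :: .name :: Γ) (encProc (liftE (bindE ρ z)) P) .proc ∧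
      Chk Γ l (.pi .name (.linear (.lam (encProc (bindE (liftE ρ) z.succ) P)))) ∧
      .lam (.con .inl [v (i + 1), .lam (encProc (liftE (bindE ρ z)) P)]) = C := by
  simp

theorem chk_lInr2 {P : SProc (n + 1)} :
    Chk Γ (.con .lInr2 [v i, .lam (.lam (encProc (liftE (bindE ρ z)) P)), l]) (.linear C) ↔
      Chk Γ (v i) .name ∧ Chk (.name :: .name :: Γ) (encProc (liftE (bindE ρ z)) P) .proc ∧
      Chk Γ l (.pi .name (.linear (.lam (encProc (bindE (liftE ρ) z.succ) P)))) ∧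
      .lam (.con .inr [v (i + 1), .lam (encProc (liftE (bindE ρ z)) P)]) = C := by
  simp

theorem chk_lChoice2 {P Q : SProc (n + 1)} :
    Chk Γ (.con .lChoice2 [v i, .lam (.lam (encProc (liftE (bindE ρ z)) P)),
        .lam (.lam (encProc (liftE (bindE ρ z)) Q)), l, l']) (.linear C) ↔
      Chk Γ (v i) .name ∧ Chk (.name :: .name :: Γ) (encProc (liftE (bindE ρ z)) P) .proc ∧
      Chk (.name :: .name :: Γ) (encProc (liftE (bindE ρ z)) Q) .proc ∧
      Chk Γ l (.pi .name (.linear (.lam (encProc (bindE (liftE ρ) z.succ) P)))) ∧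
      Chk Γ l' (.pi .name (.linear (.lam (encProc (bindE (liftE ρ) z.succ) Q)))) ∧
      .lam (.con .choice [v (i + 1), .lam (encProc (liftE (bindE ρ z)) P),
        .lam (encProc (liftE (bindE ρ z)) Q)]) = C := by
  simp

/-- The metavariable of this constant takes the channel of the cut first and `z` second, contrary to
the order used for outputs. The argument therefore has environment `bindE (liftE ρ) z.succ`, and the
conclusion, where the two arguments are exchanged, has `liftE (bindE ρ z)`. -/
theorem chk_lPcomp1 {A : Tp} {P Q : SProc (n + 1)} :
    Chk Γ (.con .lPcomp1 [encTp A, .lam (.lam (encProc (bindE (liftE ρ) z.succ) P)),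
        .lam (encProc (liftE ρ) Q), l]) (.linear C) ↔
      Chk (.name :: .name :: Γ) (encProc (bindE (liftE ρ) z.succ) P) .proc ∧
      Chk (.name :: Γ) (encProc (liftE ρ) Q) .proc ∧
      Chk Γ l (.pi .name (.linear (.lam (encProc (bindE (liftE ρ) z.succ) P)))) ∧
      .lam (.con .pcomp [encTp A, .lam (encProc (liftE (bindE ρ z)) P),
        .lam (encProc (liftE (shE 1 ρ)) Q)]) = C := by
  simp

theorem chk_lPcomp2 {A : Tp} {P Q : SProc (n + 1)} :
    Chk Γ (.con .lPcomp2 [encTp A, .lam (encProc (liftE ρ) P),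
        .lam (.lam (encProc (bindE (liftE ρ) z.succ) Q)), l]) (.linear C) ↔
      Chk (.name :: Γ) (encProc (liftE ρ) P) .proc ∧
      Chk (.name :: .name :: Γ) (encProc (bindE (liftE ρ) z.succ) Q) .proc ∧
      Chk Γ l (.pi .name (.linear (.lam (encProc (bindE (liftE ρ) z.succ) Q)))) ∧
      .lam (.con .pcomp [encTp A, .lam (encProc (liftE (shE 1 ρ)) P),
        .lam (encProc (liftE (bindE ρ z)) Q)]) = C := by
  simp

end linearity

-- Typing of the constants for typing derivations

section typing
variable {Γ : List Ty} {n : ℕ} {ρ : Fin n → ℕ} {i j : ℕ} {A A' B : Tp}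
  {h h' d d' e l l' C : Tm}

theorem chk_wtpFwd :
    Chk Γ (.con .wtpFwd [encTp A, encTp A', e, v i, h, v j, h']) (.wtp C) ↔
      Chk Γ e (.dual (encTp A) (encTp A')) ∧ Chk Γ (v i) .name ∧ Chk Γ h (.hyp (v i) (encTp A)) ∧
      Chk Γ (v j) .name ∧ Chk Γ h' (.hyp (v j) (encTp A')) ∧ .con .fwd [v i, v j] = C := by
  simp

/-- The premises for `d` and `d'` introduce a name and its hypothesis, so old channels move by two
variables; the linearity premises abstract just the name. -/
theorem chk_wtpPcomp {P Q : SProc (n + 1)} :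
    Chk Γ (.con .wtpPcomp [encTp A, encTp A', .lam (encProc (liftE ρ) P),
        .lam (encProc (liftE ρ) Q), e, d, d', l, l']) (.wtp C) ↔
      Chk (.name :: Γ) (encProc (liftE ρ) P) .proc ∧
      Chk (.name :: Γ) (encProc (liftE ρ) Q) .proc ∧
      Chk Γ e (.dual (encTp A) (encTp A')) ∧
      Chk Γ d (.pi .name (.pi (.hyp (v 0) (encTp A)) (.wtp (encProc (blockE ρ) P)))) ∧
      Chk Γ d' (.pi .name (.pi (.hyp (v 0) (encTp A')) (.wtp (encProc (blockE ρ) Q)))) ∧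
      Chk Γ l (.linear (.lam (encProc (bindE (skipE ρ) 0) P))) ∧
      Chk Γ l' (.linear (.lam (encProc (bindE (skipE ρ) 0) Q))) ∧
      .con .pcomp [encTp A, .lam (encProc (liftE ρ) P), .lam (encProc (liftE ρ) Q)] = C := by
  simp

theorem chk_wtpInl {P : SProc (n + 1)} :
    Chk Γ (.con .wtpInl [encTp A, encTp B, .lam (encProc (liftE ρ) P), v i, h, d]) (.wtp C) ↔
      Chk (.name :: Γ) (encProc (liftE ρ) P) .proc ∧ Chk Γ (v i) .name ∧
      Chk Γ h (.hyp (v i) (.con .plus [encTp A, encTp B])) ∧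
      Chk Γ d (.pi .name (.pi (.hyp (v 0) (encTp A)) (.wtp (encProc (blockE ρ) P)))) ∧
      .con .inl [v i, .lam (encProc (liftE ρ) P)] = C := by
  simp

theorem chk_wtpInr {P : SProc (n + 1)} :
    Chk Γ (.con .wtpInr [encTp A, encTp B, .lam (encProc (liftE ρ) P), v i, h, d]) (.wtp C) ↔
      Chk (.name :: Γ) (encProc (liftE ρ) P) .proc ∧ Chk Γ (v i) .name ∧
      Chk Γ h (.hyp (v i) (.con .plus [encTp A, encTp B])) ∧
      Chk Γ d (.pi .name (.pi (.hyp (v 0) (encTp B)) (.wtp (encProc (blockE ρ) P)))) ∧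
      .con .inr [v i, .lam (encProc (liftE ρ) P)] = C := by
  simp

theorem chk_wtpChoice {P Q : SProc (n + 1)} :
    Chk Γ (.con .wtpChoice [encTp A, encTp B, .lam (encProc (liftE ρ) P),
        .lam (encProc (liftE ρ) Q), v i, h, d, d']) (.wtp C) ↔
      Chk (.name :: Γ) (encProc (liftE ρ) P) .proc ∧
      Chk (.name :: Γ) (encProc (liftE ρ) Q) .proc ∧ Chk Γ (v i) .name ∧
      Chk Γ h (.hyp (v i) (.con .wth [encTp A, encTp B])) ∧
      Chk Γ d (.pi .name (.pi (.hyp (v 0) (encTp A)) (.wtp (encProc (blockE ρ) P)))) ∧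
      Chk Γ d' (.pi .name (.pi (.hyp (v 0) (encTp B)) (.wtp (encProc (blockE ρ) Q)))) ∧
      .con .choice [v i, .lam (encProc (liftE ρ) P), .lam (encProc (liftE ρ) Q)] = C := by
  simp

theorem chk_wtpOut {P Q : SProc (n + 1)} :
    Chk Γ (.con .wtpOut [encTp A, encTp B, .lam (encProc (liftE ρ) P),
        .lam (encProc (liftE ρ) Q), v i, h, d, l, d']) (.wtp C) ↔
      Chk (.name :: Γ) (encProc (liftE ρ) P) .proc ∧
      Chk (.name :: Γ) (encProc (liftE ρ) Q) .proc ∧ Chk Γ (v i) .name ∧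
      Chk Γ h (.hyp (v i) (.con .times [encTp A, encTp B])) ∧
      Chk Γ d (.pi .name (.pi (.hyp (v 0) (encTp A)) (.wtp (encProc (blockE ρ) P)))) ∧
      Chk Γ l (.linear (.lam (encProc (bindE (skipE ρ) 0) P))) ∧
      Chk Γ d' (.pi .name (.pi (.hyp (v 0) (encTp B)) (.wtp (encProc (blockE ρ) Q)))) ∧
      .con .out [v i, .lam (encProc (liftE ρ) P), .lam (encProc (liftE ρ) Q)] = C := by
  simp

/-- The block of the continuation, of type `B`, comes before that of the received channel. Linearity
is demanded for the received channel only, uniformly in the continuation. -/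
theorem chk_wtpInp {P : SProc (n + 2)} :
    Chk Γ (.con .wtpInp [encTp A, encTp B, .lam (.lam (encProc (liftE (liftE ρ)) P)), v i, h, d, l])
        (.wtp C) ↔
      Chk (.name :: .name :: Γ) (encProc (liftE (liftE ρ)) P) .proc ∧ Chk Γ (v i) .name ∧
      Chk Γ h (.hyp (v i) (.con .par [encTp A, encTp B])) ∧
      Chk Γ d (.pi .name (.pi (.hyp (v 0) (encTp B)) (.pi .name (.pi (.hyp (v 0) (encTp A))
        (.wtp (encProc (blockE (blockE ρ)) P)))))) ∧
      Chk Γ l (.pi .name (.linear (.lam (encProc (bindE (skipE (liftE ρ)) 0) P)))) ∧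
      .con .inp [v i, .lam (.lam (encProc (liftE (liftE ρ)) P))] = C := by
  simp

theorem chk_wtpClose : Chk Γ (.con .wtpClose [v i, h]) (.wtp C) ↔
    Chk Γ (v i) .name ∧ Chk Γ h (.hyp (v i) (encTp .one)) ∧ .con .close [v i] = C := by
  simp [encTp]

theorem chk_wtpWait {P : SProc n} : Chk Γ (.con .wtpWait [encProc ρ P, v i, h, d]) (.wtp C) ↔
    Chk Γ (encProc ρ P) .proc ∧ Chk Γ (v i) .name ∧ Chk Γ h (.hyp (v i) (encTp .bot)) ∧
      Chk Γ d (.wtp (encProc ρ P)) ∧ .con .wait [v i, encProc ρ P] = C := by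
  simp [encTp]

end typing

/-! ## Encodings are well typed -/

/-- Values of an environment at channels that are not free are irrelevant. Arbitrary values there
are thus permitted, in particular for channels without a variable. -/
theorem encProc_congr {n : ℕ} (P : SProc n) : ∀ {ρ σ : Fin n → ℕ},
    (∀ i ∈ P.fn, ρ i = σ i) → encProc ρ P = encProc σ P := by
  have lift {n : ℕ} {S : Finset (Fin (n + 1))} {ρ σ : Fin n → ℕ}
      (h : ∀ i, i.succ ∈ S → ρ i = σ i) : ∀ i ∈ S, liftE ρ i = liftE σ i := by
    intro i hi
    induction i using Fin.cases with
    | zero => rfl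
    | succ i => exact congrArg (· + 1) (h i hi)
  induction P with
  | fwd x y => intro ρ σ h; simp_all [encProc, SProc.fn]
  | close x => intro ρ σ h; simp_all [encProc, SProc.fn]
  | wait x P ih =>
    intro ρ σ h
    simp only [SProc.fn, Finset.mem_insert] at h
    simp only [encProc]
    rw [h x (.inl rfl), ih fun i hi => h i (.inr hi)]
  | cut A P Q ihP ihQ =>
    intro ρ σ h
    simp only [SProc.fn, Finset.mem_union, mem_lower] at h
    simp only [encProc]
    rw [ihP (lift fun i hi => h i (.inl hi)), ihQ (lift fun i hi => h i (.inr hi))]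
  | out x P Q ihP ihQ | choice x P Q ihP ihQ =>
    intro ρ σ h
    simp only [SProc.fn, Finset.mem_union, mem_lower, Finset.mem_insert] at h
    simp only [encProc]
    rw [h x (.inl rfl), ihP (lift fun i hi => h i (.inr (.inl hi))),
      ihQ (lift fun i hi => h i (.inr (.inr hi)))]
  | inl x P ihP | inr x P ihP =>
    intro ρ σ h
    simp only [SProc.fn, mem_lower, Finset.mem_insert] at h
    simp only [encProc]
    rw [h x (.inl rfl), ihP (lift fun i hi => h i (.inr hi))]
  | inp x P ihP =>
    intro ρ σ h
    simp only [SProc.fn, mem_lower, Finset.mem_insert] at h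
    simp only [encProc]
    rw [h x (.inl rfl), ihP (lift fun i hi => lift (S := lower P.fn)
      (fun i hi => h i (.inr (by simpa using hi))) i (by simpa using hi))]

theorem bindE_self {n : ℕ} (ρ : Fin n → ℕ) (x : Fin n) : bindE ρ x x = 0 := if_pos rfl

theorem bindE_ne {n : ℕ} (ρ : Fin n → ℕ) {x i : Fin n} (h : i ≠ x) : bindE ρ x i = ρ i + 1 :=
  if_neg h

/-- Here a side condition becomes non-dependence in LF: under `λx`, a process in which `x` is not
free is just a weakened process. -/
theorem encProc_bindE {n : ℕ} {ρ : Fin n → ℕ} {x : Fin n} {P : SProc n} (h : x ∉ P.fn) :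
    encProc (shE 1 ρ) P = encProc (bindE ρ x) P :=
  encProc_congr P fun i hi => (bindE_ne ρ (by rintro rfl; exact h hi)).symm

theorem liftE_shE_eq {n : ℕ} {S : Finset (Fin (n + 1))} {ρ : Fin n → ℕ} {x : Fin n}
    (h : x.succ ∉ S) : ∀ i ∈ S, liftE (shE 1 ρ) i = liftE (bindE ρ x) i := by
  intro i hi
  induction i using Fin.cases with
  | zero => rfl
  | succ i => exact congrArg (· + 1) (bindE_ne ρ (by rintro rfl; exact h hi)).symm

theorem encProc_liftE_bindE {n : ℕ} {ρ : Fin n → ℕ} {x : Fin n} {P : SProc (n + 1)}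
    (h : x.succ ∉ P.fn) : encProc (liftE (shE 1 ρ)) P = encProc (liftE (bindE ρ x)) P :=
  encProc_congr P (liftE_shE_eq h)

theorem encProc_liftE_liftE_bindE {n : ℕ} {ρ : Fin n → ℕ} {x : Fin n} {P : SProc (n + 2)}
    (h : x.succ.succ ∉ P.fn) :
    encProc (liftE (liftE (shE 1 ρ))) P = encProc (liftE (liftE (bindE ρ x))) P := by
  refine encProc_congr P fun i hi => ?_
  induction i using Fin.cases with
  | zero => rfl
  | succ i =>
    exact congrArg (· + 1) (liftE_shE_eq (S := lower P.fn) (by simpa using h) i (by simpa using hi))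

-- Environments with values among the declared names

section names
variable {Γ : List Ty} {n : ℕ} {ρ : Fin n → ℕ}

/-- Relative to a predicate `S`, later the free channels of a process, since only these need to be
declared in the context. -/
theorem names_liftE {S : Fin (n + 1) → Prop} (h : ∀ i, S i.succ → Γ[ρ i]? = some .name) :
    ∀ i, S i → (Ty.name :: Γ)[liftE ρ i]? = some .name := by
  intro i hi
  induction i using Fin.cases with
  | zero => rfl
  | succ i => exact h i hi

theorem names_liftE_ne {S : Fin (n + 1) → Prop} {z : Fin n}
    (h : ∀ i, S i.succ → i ≠ z → Γ[ρ i]? = some .name) :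
    ∀ i, S i → i ≠ z.succ → (Ty.name :: Γ)[liftE ρ i]? = some .name :=
  fun i hi hz => names_liftE (S := fun i => S i ∧ i ≠ z.succ)
    (fun i hi => h i hi.1 fun e => hi.2 (e ▸ rfl)) i ⟨hi, hz⟩

theorem names_skipE {S : Fin (n + 1) → Prop} (h : ∀ i, S i.succ → Γ[ρ i]? = some .name) :
    ∀ i, S i → i ≠ 0 → Γ[skipE ρ i]? = some .name := by
  intro i hi h0
  induction i using Fin.cases with
  | zero => exact absurd rfl h0
  | succ i => exact h i hi

theorem names_bindE {S : Fin n → Prop} {z : Fin n}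
    (h : ∀ i, S i → i ≠ z → Γ[ρ i]? = some .name) :
    ∀ i, S i → (Ty.name :: Γ)[bindE ρ z i]? = some .name := by
  intro i hi
  by_cases e : i = z
  · subst e; rw [bindE_self]; rfl
  · rw [bindE_ne ρ e]; exact h i hi e

end names

theorem chk_name {Γ : List Ty} {i : ℕ} (h : Γ[i]? = some .name) : Chk Γ (v i) .name :=
  .var h .nil

/-- Only free channels have to be declared, which makes the small contexts of the linearity
statements sufficient. -/
theorem chk_encProc {n : ℕ} (P : SProc n) : ∀ {Γ : List Ty} {ρ : Fin n → ℕ},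
    (∀ i, i ∈ P.fn → Γ[ρ i]? = some .name) → Chk Γ (encProc ρ P) .proc := by
  induction P with
  | fwd x y =>
    intro Γ ρ h
    exact chk_fwd.2 ⟨chk_name (h x (by simp [SProc.fn])), chk_name (h y (by simp [SProc.fn]))⟩
  | close x => intro Γ ρ h; exact chk_close.2 (chk_name (h x (by simp [SProc.fn])))
  | wait x P ih =>
    intro Γ ρ h
    exact chk_wait.2 ⟨chk_name (h x (by simp [SProc.fn])),
      ih fun i hi => h i (by simp [SProc.fn, hi])⟩
  | cut A P Q ihP ihQ =>
    intro Γ ρ h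
    exact chk_pcomp.2 ⟨chk_encTp _ _,
      .lam (ihP (names_liftE fun i hi => h i (by simp [SProc.fn, hi]))),
      .lam (ihQ (names_liftE fun i hi => h i (by simp [SProc.fn, hi])))⟩
  | out x P Q ihP ihQ =>
    intro Γ ρ h
    exact chk_out.2 ⟨chk_name (h x (by simp [SProc.fn])),
      .lam (ihP (names_liftE fun i hi => h i (by simp [SProc.fn, hi]))),
      .lam (ihQ (names_liftE fun i hi => h i (by simp [SProc.fn, hi])))⟩
  | choice x P Q ihP ihQ =>
    intro Γ ρ h
    exact chk_choice.2 ⟨chk_name (h x (by simp [SProc.fn])),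
      .lam (ihP (names_liftE fun i hi => h i (by simp [SProc.fn, hi]))),
      .lam (ihQ (names_liftE fun i hi => h i (by simp [SProc.fn, hi])))⟩
  | inl x P ih =>
    intro Γ ρ h
    exact chk_inl.2 ⟨chk_name (h x (by simp [SProc.fn])),
      .lam (ih (names_liftE fun i hi => h i (by simp [SProc.fn, hi])))⟩
  | inr x P ih =>
    intro Γ ρ h
    exact chk_inr.2 ⟨chk_name (h x (by simp [SProc.fn])),
      .lam (ih (names_liftE fun i hi => h i (by simp [SProc.fn, hi])))⟩
  | inp x P ih =>
    intro Γ ρ h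
    exact chk_inp.2 ⟨chk_name (h x (by simp [SProc.fn])),
      .lam (.lam (ih (names_liftE (names_liftE (S := fun i => i.succ ∈ P.fn)
        fun i hi => h i (by simp [SProc.fn, hi])))))⟩

/-- Every case instantiates the equivalence for its constant. The final equation compares the
environment of the rule with that of the encoded process, and holds because of the freshness side
conditions of the rule. -/
theorem chk_encLin {n : ℕ} {x : Fin n} {P : SProc n} (L : Lin x P) :
    ∀ {Γ : List Ty} {ρ : Fin n → ℕ}, (∀ i, i ∈ P.fn → i ≠ x → Γ[ρ i]? = some .name) →
    Chk Γ (encLin ρ L) (.linear (.lam (encProc (bindE ρ x) P))) := by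
  -- Channels free in a component where `x` is fresh differ from `x`, so they are declared in `Γ`.
  have ne {n : ℕ} {x i : Fin n} {S : Finset (Fin n)} (h : x ∉ S) (hi : i ∈ S) : i ≠ x :=
    fun e => h (e ▸ hi)
  have ne' {n : ℕ} {x i : Fin n} {S : Finset (Fin (n + 1))} (h : x.succ ∉ S) (hi : i.succ ∈ S) :
      i ≠ x := fun e => h (e ▸ hi)
  have ne'' {n : ℕ} {x i : Fin n} {S : Finset (Fin (n + 2))} (h : x.succ.succ ∉ S)
      (hi : i.succ.succ ∈ S) : i ≠ x := fun e => h (e ▸ hi)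
  induction L with
  | @fwd₁ n x y hxy =>
    intro Γ ρ h
    refine chk_lFwd1.2 ⟨chk_name (h y (by simp [SProc.fn]) hxy.symm), ?_⟩
    simp only [encProc]
    rw [bindE_self, bindE_ne _ hxy.symm]
  | @fwd₂ n x y hxy =>
    intro Γ ρ h
    refine chk_lFwd2.2 ⟨chk_name (h x (by simp [SProc.fn]) hxy), ?_⟩
    simp only [encProc]
    rw [bindE_self, bindE_ne _ hxy]
  | close =>
    intro Γ ρ h
    refine chk_lClose.2 ?_
    simp only [encProc]
    rw [bindE_self]
  | wait hx =>
    intro Γ ρ h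
    refine chk_lWait.2 ⟨chk_encProc _ fun i hi => h i (by simp [SProc.fn, hi]) (ne hx hi), ?_⟩
    simp only [encProc]
    rw [bindE_self, encProc_bindE hx]
  | out L hP hQ ih =>
    intro Γ ρ h
    refine chk_lOut.2 ⟨
      chk_encProc _ (names_liftE fun i hi => h i (by simp [SProc.fn, hi]) (ne' hP hi)),
      chk_encProc _ (names_liftE fun i hi => h i (by simp [SProc.fn, hi]) (ne' hQ hi)),
      ih (names_skipE fun i hi => h i (by simp [SProc.fn, hi]) (ne' hQ hi)), ?_⟩
    simp only [encProc]
    rw [bindE_self, encProc_liftE_bindE hP, encProc_liftE_bindE hQ]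
  | @inp n x P L hP ih =>
    intro Γ ρ h
    refine chk_lInp.2 ⟨
      chk_encProc _ (names_liftE (names_liftE (S := fun i => i.succ ∈ P.fn)
        fun i hi => h i (by simp [SProc.fn, hi]) (ne'' hP hi))),
      -- The continuation is channel `1`, that is `Fin.succ 0`; it is the one left undeclared.
      .lam (ih (names_liftE_ne (z := 0) (names_skipE (S := fun i => i.succ ∈ P.fn)
        fun i hi => h i (by simp [SProc.fn, hi]) (ne'' hP hi)))), ?_⟩
    simp only [encProc]
    rw [bindE_self, encProc_liftE_liftE_bindE hP]
  | inl L hP ih =>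
    intro Γ ρ h
    refine chk_lInl.2 ⟨
      chk_encProc _ (names_liftE fun i hi => h i (by simp [SProc.fn, hi]) (ne' hP hi)),
      ih (names_skipE fun i hi => h i (by simp [SProc.fn, hi]) (ne' hP hi)), ?_⟩
    simp only [encProc]
    rw [bindE_self, encProc_liftE_bindE hP]
  | inr L hP ih =>
    intro Γ ρ h
    refine chk_lInr.2 ⟨
      chk_encProc _ (names_liftE fun i hi => h i (by simp [SProc.fn, hi]) (ne' hP hi)),
      ih (names_skipE fun i hi => h i (by simp [SProc.fn, hi]) (ne' hP hi)), ?_⟩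
    simp only [encProc]
    rw [bindE_self, encProc_liftE_bindE hP]
  | choice L₁ L₂ hP hQ ih₁ ih₂ =>
    intro Γ ρ h
    refine chk_lChoice.2 ⟨
      chk_encProc _ (names_liftE fun i hi => h i (by simp [SProc.fn, hi]) (ne' hP hi)),
      chk_encProc _ (names_liftE fun i hi => h i (by simp [SProc.fn, hi]) (ne' hQ hi)),
      ih₁ (names_skipE fun i hi => h i (by simp [SProc.fn, hi]) (ne' hP hi)),
      ih₂ (names_skipE fun i hi => h i (by simp [SProc.fn, hi]) (ne' hQ hi)), ?_⟩
    simp only [encProc]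
    rw [bindE_self, encProc_liftE_bindE hP, encProc_liftE_bindE hQ]
  | @wait₂ n z x P hz L ih =>
    intro Γ ρ h
    have hP := fun i (hi : i ∈ P.fn) hne => h i (by simp [SProc.fn, hi]) hne
    refine chk_lWait2.2 ⟨chk_name (h _ (by simp [SProc.fn]) hz.symm),
      chk_encProc _ (names_bindE hP), ih hP, ?_⟩
    simp only [encProc]
    rw [bindE_ne _ hz.symm]
  | out₂ hz L hQ ih =>
    intro Γ ρ h
    refine chk_lOut2.2 ⟨chk_name (h _ (by simp [SProc.fn]) hz.symm),
      chk_encProc _ (names_liftE (names_bindE (S := fun i => i.succ ∈ _)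
        fun i hi => h i (by simp [SProc.fn, hi]))),
      chk_encProc _ (names_liftE fun i hi => h i (by simp [SProc.fn, hi]) (ne' hQ hi)),
      .lam (ih (names_liftE_ne fun i hi => h i (by simp [SProc.fn, hi]))), ?_⟩
    simp only [encProc]
    rw [bindE_ne _ hz.symm, encProc_liftE_bindE hQ]
  | out₃ hz L hP ih =>
    intro Γ ρ h
    refine chk_lOut3.2 ⟨chk_name (h _ (by simp [SProc.fn]) hz.symm),
      chk_encProc _ (names_liftE fun i hi => h i (by simp [SProc.fn, hi]) (ne' hP hi)),
      chk_encProc _ (names_liftE (names_bindE (S := fun i => i.succ ∈ _)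
        fun i hi => h i (by simp [SProc.fn, hi]))),
      .lam (ih (names_liftE_ne fun i hi => h i (by simp [SProc.fn, hi]))), ?_⟩
    simp only [encProc]
    rw [bindE_ne _ hz.symm, encProc_liftE_bindE hP]
  | @inp₂ n z x P hz L ih =>
    intro Γ ρ h
    refine chk_lInp2.2 ⟨chk_name (h _ (by simp [SProc.fn]) hz.symm),
      chk_encProc _ (names_liftE (names_liftE (S := fun i => i.succ ∈ P.fn)
        (names_bindE (S := fun i => i.succ.succ ∈ P.fn)
        fun i hi => h i (by simp [SProc.fn, hi])))),
      .lam (.lam (ih (names_liftE_ne (names_liftE_ne (S := fun i => i.succ ∈ P.fn)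
        fun i hi => h i (by simp [SProc.fn, hi]))))), ?_⟩
    simp only [encProc]
    rw [bindE_ne _ hz.symm]
  | inl₂ hz L ih =>
    intro Γ ρ h
    refine chk_lInl2.2 ⟨chk_name (h _ (by simp [SProc.fn]) hz.symm),
      chk_encProc _ (names_liftE (names_bindE (S := fun i => i.succ ∈ _)
        fun i hi => h i (by simp [SProc.fn, hi]))),
      .lam (ih (names_liftE_ne fun i hi => h i (by simp [SProc.fn, hi]))), ?_⟩
    simp only [encProc]
    rw [bindE_ne _ hz.symm]
  | inr₂ hz L ih =>
    intro Γ ρ h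
    refine chk_lInr2.2 ⟨chk_name (h _ (by simp [SProc.fn]) hz.symm),
      chk_encProc _ (names_liftE (names_bindE (S := fun i => i.succ ∈ _)
        fun i hi => h i (by simp [SProc.fn, hi]))),
      .lam (ih (names_liftE_ne fun i hi => h i (by simp [SProc.fn, hi]))), ?_⟩
    simp only [encProc]
    rw [bindE_ne _ hz.symm]
  | choice₂ hz L₁ L₂ ih₁ ih₂ =>
    intro Γ ρ h
    refine chk_lChoice2.2 ⟨chk_name (h _ (by simp [SProc.fn]) hz.symm),
      chk_encProc _ (names_liftE (names_bindE (S := fun i => i.succ ∈ _)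
        fun i hi => h i (by simp [SProc.fn, hi]))),
      chk_encProc _ (names_liftE (names_bindE (S := fun i => i.succ ∈ _)
        fun i hi => h i (by simp [SProc.fn, hi]))),
      .lam (ih₁ (names_liftE_ne fun i hi => h i (by simp [SProc.fn, hi]))),
      .lam (ih₂ (names_liftE_ne fun i hi => h i (by simp [SProc.fn, hi]))), ?_⟩
    simp only [encProc]
    rw [bindE_ne _ hz.symm]
  | cut₁ L hQ ih =>
    intro Γ ρ h
    refine chk_lPcomp1.2 ⟨
      chk_encProc _ (names_bindE (names_liftE_ne fun i hi => h i (by simp [SProc.fn, hi]))),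
      chk_encProc _ (names_liftE fun i hi => h i (by simp [SProc.fn, hi]) (ne' hQ hi)),
      .lam (ih (names_liftE_ne fun i hi => h i (by simp [SProc.fn, hi]))), ?_⟩
    simp only [encProc]
    rw [encProc_liftE_bindE hQ]
  | cut₂ L hP ih =>
    intro Γ ρ h
    refine chk_lPcomp2.2 ⟨
      chk_encProc _ (names_liftE fun i hi => h i (by simp [SProc.fn, hi]) (ne' hP hi)),
      chk_encProc _ (names_bindE (names_liftE_ne fun i hi => h i (by simp [SProc.fn, hi]))),
      .lam (ih (names_liftE_ne fun i hi => h i (by simp [SProc.fn, hi]))), ?_⟩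
    simp only [encProc]
    rw [encProc_liftE_bindE hP]

theorem chk_encDual (Γ : List Ty) (A : Tp) :
    Chk Γ (encDual A) (.dual (encTp A) (encTp A.dual)) := by
  induction A with
  | one => exact chk_dOne.2 ⟨rfl, rfl⟩
  | bot => exact chk_dBot.2 ⟨rfl, rfl⟩
  | tensor A B ihA ihB => exact chk_dTimes.2 ⟨ihA, ihB, rfl, rfl⟩
  | par A B ihA ihB => exact chk_dPar.2 ⟨ihA, ihB, rfl, rfl⟩
  | plus A B ihA ihB => exact chk_dPlus.2 ⟨ihA, ihB, rfl, rfl⟩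
  | wth A B ihA ihB => exact chk_dWth.2 ⟨ihA, ihB, rfl, rfl⟩

/-- Hence `Blocks` provides a name variable for each free channel of a typed process, although it
speaks of typed channels only. -/
theorem SDer.fn_typed {n : ℕ} {Δ : Ctx n} {P : SProc n} (D : SDer Δ P) :
    ∀ i, i ∈ P.fn → ∃ A, Δ i = some A := by
  induction D with
  | id A hx hy =>
    intro i hi
    simp only [SProc.fn, Finset.mem_insert, Finset.mem_singleton] at hi
    rcases hi with rfl | rfl <;> exact ⟨_, ‹_›⟩
  | cut D₁ L₁ D₂ L₂ ih₁ ih₂ =>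
    intro i hi
    simp only [SProc.fn, Finset.mem_union, mem_lower] at hi
    rcases hi with hi | hi
    exacts [ih₁ _ hi, ih₂ _ hi]
  | tensor A B hx D₁ L D₂ ih₁ ih₂ | wth A B hx D₁ D₂ ih₁ ih₂ =>
    intro i hi
    simp only [SProc.fn, Finset.mem_insert, Finset.mem_union, mem_lower] at hi
    rcases hi with rfl | hi | hi
    exacts [⟨_, hx⟩, ih₁ _ hi, ih₂ _ hi]
  | par A B hx D L ih | inl A B hx D ih | inr A B hx D ih =>
    intro i hi
    simp only [SProc.fn, Finset.mem_insert, mem_lower] at hi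
    rcases hi with rfl | hi
    exacts [⟨_, hx⟩, ih _ hi]
  | one hx =>
    intro i hi
    simp only [SProc.fn, Finset.mem_singleton] at hi
    exact ⟨_, hi ▸ hx⟩
  | bot hx D ih =>
    intro i hi
    simp only [SProc.fn, Finset.mem_insert] at hi
    rcases hi with rfl | hi
    exacts [⟨_, hx⟩, ih _ hi]

/-- In the LF context `Γ`, variable `ρ i` is a name and `η i` is the assumption `hyp (ρ i) A`
declared right after it, for each assumption `i : A` of `Δ`. -/
def Blocks {n : ℕ} (Γ : List Ty) (ρ η : Fin n → ℕ) (Δ : Ctx n) : Prop :=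
  ∀ i A, Δ i = some A →
    Γ[ρ i]? = some .name ∧ Γ[η i]? = some (.hyp (v 0) (encTp A)) ∧ ρ i = η i + 1

-- Blocks of a name and its typing assumption

section Blocks
variable {n : ℕ} {Γ : List Ty} {ρ η : Fin n → ℕ} {Δ : Ctx n}

theorem Blocks.cons (h : Blocks Γ ρ η Δ) (A : Tp) :
    Blocks (.hyp (v 0) (encTp A) :: .name :: Γ) (blockE ρ) (hypE η) (Ctx.cons A Δ) := by
  intro i
  induction i using Fin.cases with
  | zero => rintro B hB; cases hB; exact ⟨rfl, rfl, rfl⟩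
  | succ i =>
    intro B hB
    obtain ⟨h₁, h₂, h₃⟩ := h i B hB
    exact ⟨h₁, h₂, congrArg (· + 2) h₃⟩

theorem Blocks.name (h : Blocks Γ ρ η Δ) {i : Fin n} {A : Tp} (hi : Δ i = some A) :
    Chk Γ (v (ρ i)) .name := chk_name (h i A hi).1

/-- The declaration of a hypothesis refers to the name just before it as variable `0`. Seen from the
whole context this is variable `η i + 1`, which is `ρ i`. -/
theorem Blocks.hyp (h : Blocks Γ ρ η Δ) {i : Fin n} {A : Tp} (hi : Δ i = some A) :
    Chk Γ (v (η i)) (.hyp (v (ρ i)) (encTp A)) := by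
  obtain ⟨-, h₂, h₃⟩ := h i A hi
  refine .var h₂ ?_
  simp [h₃]

theorem Blocks.lift (h : Blocks Γ ρ η Δ) {A : Tp} {P : SProc (n + 1)} (D : SDer (Ctx.cons A Δ) P) :
    Chk (.name :: Γ) (encProc (liftE ρ) P) .proc :=
  chk_encProc P (names_liftE fun i hi => by
    obtain ⟨B, hB⟩ := D.fn_typed i.succ hi
    exact (h i B hB).1)

theorem Blocks.lin (h : Blocks Γ ρ η Δ) {A : Tp} {P : SProc (n + 1)} (D : SDer (Ctx.cons A Δ) P)
    (L : Lin 0 P) : Chk Γ (encLin (skipE ρ) L) (.linear (.lam (encProc (bindE (skipE ρ) 0) P))) :=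
  chk_encLin L (names_skipE fun i hi => by
    obtain ⟨B, hB⟩ := D.fn_typed i.succ hi
    exact (h i B hB).1)

end Blocks

theorem chk_encDer {n : ℕ} {Δ : Ctx n} {P : SProc n} (D : SDer Δ P) :
    ∀ {Γ : List Ty} {ρ η : Fin n → ℕ}, Blocks Γ ρ η Δ →
    Chk Γ (encDer ρ η D) (.wtp (encProc ρ P)) := by
  induction D with
  | id A hx hy =>
    intro Γ ρ η h
    exact chk_wtpFwd.2 ⟨chk_encDual _ _, h.name hx, h.hyp hx, h.name hy, h.hyp hy, rfl⟩
  | cut D₁ L₁ D₂ L₂ ih₁ ih₂ =>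
    intro Γ ρ η h
    exact chk_wtpPcomp.2 ⟨h.lift D₁, h.lift D₂, chk_encDual _ _, .lam (.lam (ih₁ (h.cons _))),
      .lam (.lam (ih₂ (h.cons _))), h.lin D₁ L₁, h.lin D₂ L₂, rfl⟩
  | tensor A B hx D₁ L₁ D₂ ih₁ ih₂ =>
    intro Γ ρ η h
    exact chk_wtpOut.2 ⟨h.lift D₁, h.lift D₂, h.name hx, h.hyp hx, .lam (.lam (ih₁ (h.cons _))),
      h.lin D₁ L₁, .lam (.lam (ih₂ (h.cons _))), rfl⟩
  | @par n Δ x P A B hx D L ih =>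
    intro Γ ρ η h
    have hP : ∀ i : Fin n, i.succ.succ ∈ P.fn → Γ[ρ i]? = some .name := fun i hi => by
      obtain ⟨B, hB⟩ := D.fn_typed i.succ.succ hi
      exact (h i B hB).1
    exact chk_wtpInp.2 ⟨chk_encProc P (names_liftE (names_liftE (S := fun i => i.succ ∈ P.fn) hP)),
      h.name hx, h.hyp hx, .lam (.lam (.lam (.lam (ih ((h.cons _).cons _))))),
      .lam (chk_encLin L (names_skipE (names_liftE (S := fun i => i.succ ∈ P.fn) hP))), rfl⟩
  | inl A B hx D ih =>
    intro Γ ρ η h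
    exact chk_wtpInl.2 ⟨h.lift D, h.name hx, h.hyp hx, .lam (.lam (ih (h.cons _))), rfl⟩
  | inr A B hx D ih =>
    intro Γ ρ η h
    exact chk_wtpInr.2 ⟨h.lift D, h.name hx, h.hyp hx, .lam (.lam (ih (h.cons _))), rfl⟩
  | wth A B hx D₁ D₂ ih₁ ih₂ =>
    intro Γ ρ η h
    exact chk_wtpChoice.2 ⟨h.lift D₁, h.lift D₂, h.name hx, h.hyp hx,
      .lam (.lam (ih₁ (h.cons _))), .lam (.lam (ih₂ (h.cons _))), rfl⟩
  | one hx =>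
    intro Γ ρ η h
    exact chk_wtpClose.2 ⟨h.name hx, h.hyp hx, rfl⟩
  | bot hx D ih =>
    intro Γ ρ η h
    refine chk_wtpWait.2 ⟨chk_encProc _ fun i hi => ?_, h.name hx, h.hyp hx, ih h, rfl⟩
    obtain ⟨B, hB⟩ := D.fn_typed i hi
    exact (h i B hB).1

/-! ## Inversion of LF typing -/

/-- The family in which a head of this type ends up. Being stable under substitution, it selects the
constants that can head a term of a given atomic type. -/
def Ty.target : Ty → TyC
  | .atom a _ => a
  | .pi _ B => B.target

theorem Ty.target_hsub (α : STy) (N : Tm) (A : Ty) : ∀ k, (A.hsub α N k).target = A.target := by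
  induction A with
  | atom a S => intro k; rfl
  | pi A B _ ih => intro k; exact ih (k + 1)

theorem ChkSp.target_eq {Γ : List Ty} {S : List Tm} : ∀ {A : Ty} {a : TyC} {T : List Tm},
    ChkSp Γ A S (.atom a T) → A.target = a := by
  induction S with
  | nil => rintro A a T ⟨⟩; rfl
  | cons M S ih =>
    intro A a T h
    cases h with
    | @cons _ A B _ _ _ h₁ h₂ => exact (Ty.target_hsub _ _ B 0).symm.trans (ih h₂)

/-- Canonical forms are η-long: an atomic result forces the spine to exhaust the arguments of the
head. -/
theorem ChkSp.pi_inv {Γ : List Ty} {A B : Ty} {S : List Tm} {a : TyC} {T : List Tm}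
    (h : ChkSp Γ (.pi A B) S (.atom a T)) :
    ∃ M S', S = M :: S' ∧ Chk Γ M A ∧ ChkSp Γ (B.hsub A.erase M 0) S' (.atom a T) := by
  cases h with
  | cons h₁ h₂ => exact ⟨_, _, rfl, h₁, h₂⟩

theorem ChkSp.atom_inv {Γ : List Ty} {b : TyC} {U S : List Tm} {a : TyC} {T : List Tm}
    (h : ChkSp Γ (.atom b U) S (.atom a T)) : S = [] := by
  cases h; rfl

theorem Chk.pi_inv {Γ : List Ty} {M : Tm} {A B : Ty} (h : Chk Γ M (.pi A B)) :
    ∃ M', M = .lam M' ∧ Chk (A :: Γ) M' B := by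
  cases h with
  | lam h => exact ⟨_, rfl, h⟩

/-- All assumptions of `Γ` are of the form `x : name` or `h : hyp x T`. -/
def NamesAndHyps (Γ : List Ty) : Prop := ∀ A ∈ Γ, A = .name ∨ ∃ x T, A = .hyp x T

theorem NamesAndHyps.name {Γ : List Ty} (h : NamesAndHyps Γ) : NamesAndHyps (.name :: Γ) := by
  intro A hA
  rcases List.mem_cons.1 hA with rfl | hA
  exacts [.inl rfl, h A hA]

theorem NamesAndHyps.hyp {Γ : List Ty} (h : NamesAndHyps Γ) (x T : Tm) :
    NamesAndHyps (.hyp x T :: Γ) := by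
  intro A hA
  rcases List.mem_cons.1 hA with rfl | hA
  exacts [.inr ⟨_, _, rfl⟩, h A hA]

/-- A variable in such a context inhabits only `name` or `hyp`, so in the other families a canonical
form of atomic type is headed by a constant. -/
theorem Chk.con_inv {Γ : List Ty} {M : Tm} {a : TyC} {T : List Tm} (hΓ : NamesAndHyps Γ)
    (h : Chk Γ M (.atom a T)) (ha : a ≠ .name) (ha' : a ≠ .hyp) :
    ∃ c S, M = .con c S ∧ c.type.target = a ∧ ChkSp Γ c.type S (.atom a T) := by
  cases h with
  | var hi hS =>
    have ht := hS.target_eq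
    rcases hΓ _ (List.mem_of_getElem? hi) with rfl | ⟨x, U, rfl⟩
    exacts [absurd ht.symm ha, absurd ht.symm ha']
  | con hS => exact ⟨_, _, rfl, hS.target_eq, hS⟩

theorem Chk.name_inv {Γ : List Ty} {M : Tm} (hΓ : NamesAndHyps Γ) (h : Chk Γ M .name) :
    ∃ k, M = v k ∧ Γ[k]? = some .name := by
  cases h with
  | var hi hS =>
    rcases hΓ _ (List.mem_of_getElem? hi) with rfl | ⟨x, U, rfl⟩
    · obtain rfl := hS.atom_inv
      exact ⟨_, rfl, hi⟩
    · exact nomatch hS.target_eq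
  | @con _ c _ _ _ hS =>
    have ht := hS.target_eq
    -- No constant of the signature produces a name; only variables do.
    cases c <;> exact nomatch ht

theorem Chk.hyp_inv {Γ : List Ty} {M x T : Tm} (hΓ : NamesAndHyps Γ) (h : Chk Γ M (.hyp x T)) :
    ∃ k y U, M = v k ∧ Γ[k]? = some (.hyp y U) ∧
      y.ren (· + (k + 1)) = x ∧ U.ren (· + (k + 1)) = T := by
  cases h with
  | var hi hS =>
    rcases hΓ _ (List.mem_of_getElem? hi) with rfl | ⟨y, U, rfl⟩
    · exact nomatch hS.target_eq
    · obtain rfl := hS.atom_inv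
      refine ⟨_, y, U, rfl, hi, ?_⟩
      cases hS
      exact ⟨rfl, rfl⟩
  | @con _ c _ _ _ hS =>
    have ht := hS.target_eq
    cases c <;> exact nomatch ht

/-! ### Types and duality -/

/-- The induction is on a bound for the size, since the arguments of a head are nested inside a
list; the later inversion lemmas follow the same scheme. -/
theorem exists_encTp {Γ : List Ty} (hΓ : NamesAndHyps Γ) (N : ℕ) : ∀ M : Tm, sizeOf M < N →
    Chk Γ M .tp → ∃ A, M = encTp A := by
  induction N with
  | zero => intro M h; exact absurd h (Nat.not_lt_zero _)
  | succ N ih =>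
    intro M hs h
    obtain ⟨c, S, rfl, ht, hS⟩ := h.con_inv hΓ (by decide) (by decide)
    have bin {c : TmC} {S : List Tm} (hs : sizeOf (Tm.con c S) < N + 1)
        (hS : ChkSp Γ (.pi .tp (.pi .tp .tp)) S .tp) : ∃ A B, S = [encTp A, encTp B] := by
      obtain ⟨a, S, rfl, ha, h⟩ := hS.pi_inv
      obtain ⟨b, S, rfl, hb, h⟩ := ChkSp.pi_inv h
      obtain rfl := ChkSp.atom_inv h
      simp at hs
      obtain ⟨A, rfl⟩ := ih a (by omega) ha
      obtain ⟨B, rfl⟩ := ih b (by omega) hb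
      exact ⟨A, B, rfl⟩
    cases c with
    | one => obtain rfl := ChkSp.atom_inv hS; exact ⟨.one, rfl⟩
    | bot => obtain rfl := ChkSp.atom_inv hS; exact ⟨.bot, rfl⟩
    | times => obtain ⟨A, B, rfl⟩ := bin hs hS; exact ⟨.tensor A B, rfl⟩
    | par => obtain ⟨A, B, rfl⟩ := bin hs hS; exact ⟨.par A B, rfl⟩
    | wth => obtain ⟨A, B, rfl⟩ := bin hs hS; exact ⟨.wth A B, rfl⟩
    | plus => obtain ⟨A, B, rfl⟩ := bin hs hS; exact ⟨.plus A B, rfl⟩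
    | _ => exact nomatch ht

theorem Chk.tp_inv {Γ : List Ty} {M : Tm} (hΓ : NamesAndHyps Γ) (h : Chk Γ M .tp) :
    ∃ A, M = encTp A := exists_encTp hΓ _ M (Nat.lt_succ_self _) h

/-- The premises give duality of the components by induction. Injectivity of `encTp` then identifies
the metavariables with the types found there, so that the second index is forced to be the dual. -/
theorem exists_encDual {Γ : List Ty} (hΓ : NamesAndHyps Γ) (N : ℕ) : ∀ d a b : Tm, sizeOf d < N →
    Chk Γ d (.dual a b) → ∃ A, a = encTp A ∧ b = encTp A.dual ∧ d = encDual A := by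
  induction N with
  | zero => intro _ _ _ h; exact absurd h (Nat.not_lt_zero _)
  | succ N ih =>
    intro d a b hs h
    obtain ⟨c, S, rfl, ht, hS⟩ := h.con_inv hΓ (by decide) (by decide)
    -- Only the shape of the spine is extracted here, so `X` and `Y` stay unspecified; the types of
    -- the two subderivations are obtained afterwards from the equivalence for the constant.
    have bin {S : List Tm} {X Y : Ty} {U : List Tm}
        (hS : ChkSp Γ (.pi .tp (.pi .tp (.pi .tp (.pi .tp (.pi X (.pi Y (.atom .dual U)))))))
          S (.dual a b)) :
        ∃ A A' B B' d e, S = [encTp A, encTp A', encTp B, encTp B', d, e] := by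
      obtain ⟨A, S, rfl, hA, hS⟩ := hS.pi_inv
      obtain ⟨A', S, rfl, hA', hS⟩ := ChkSp.pi_inv hS
      obtain ⟨B, S, rfl, hB, hS⟩ := ChkSp.pi_inv hS
      obtain ⟨B', S, rfl, hB', hS⟩ := ChkSp.pi_inv hS
      obtain ⟨d, S, rfl, hd, hS⟩ := ChkSp.pi_inv hS
      obtain ⟨e, S, rfl, he, hS⟩ := ChkSp.pi_inv hS
      obtain rfl := ChkSp.atom_inv hS
      obtain ⟨A, rfl⟩ := Chk.tp_inv hΓ hA
      obtain ⟨A', rfl⟩ := Chk.tp_inv hΓ hA'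
      obtain ⟨B, rfl⟩ := Chk.tp_inv hΓ hB
      obtain ⟨B', rfl⟩ := Chk.tp_inv hΓ hB'
      exact ⟨A, A', B, B', d, e, rfl⟩
    have prem {c : TmC} {A A' B B' : Tp} {d e : Tm}
        (hs : sizeOf (Tm.con c [encTp A, encTp A', encTp B, encTp B', d, e]) < N + 1)
        (hd : Chk Γ d (.dual (encTp A) (encTp A'))) (he : Chk Γ e (.dual (encTp B) (encTp B'))) :
        A' = A.dual ∧ B' = B.dual ∧ d = encDual A ∧ e = encDual B := by
      simp only [Tm.con.sizeOf_spec, List.cons.sizeOf_spec, List.nil.sizeOf_spec] at hs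
      obtain ⟨A₁, h₁, h₂, rfl⟩ := ih d _ _ (by omega) hd
      obtain ⟨B₁, h₃, h₄, rfl⟩ := ih e _ _ (by omega) he
      obtain rfl := encTp_injective h₁
      obtain rfl := encTp_injective h₃
      exact ⟨encTp_injective h₂, encTp_injective h₄, rfl, rfl⟩
    cases c with
    | dOne =>
      obtain rfl := ChkSp.atom_inv hS
      obtain ⟨rfl, rfl⟩ := chk_dOne.1 h
      exact ⟨.one, rfl, rfl, rfl⟩
    | dBot =>
      obtain rfl := ChkSp.atom_inv hS
      obtain ⟨rfl, rfl⟩ := chk_dBot.1 h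
      exact ⟨.bot, rfl, rfl, rfl⟩
    | dTimes =>
      obtain ⟨A, A', B, B', d, e, rfl⟩ := bin hS
      obtain ⟨hd, he, rfl, rfl⟩ := chk_dTimes.1 h
      obtain ⟨rfl, rfl, rfl, rfl⟩ := prem hs hd he
      exact ⟨.tensor A B, rfl, rfl, rfl⟩
    | dPar =>
      obtain ⟨A, A', B, B', d, e, rfl⟩ := bin hS
      obtain ⟨hd, he, rfl, rfl⟩ := chk_dPar.1 h
      obtain ⟨rfl, rfl, rfl, rfl⟩ := prem hs hd he
      exact ⟨.par A B, rfl, rfl, rfl⟩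
    | dWth =>
      obtain ⟨A, A', B, B', d, e, rfl⟩ := bin hS
      obtain ⟨hd, he, rfl, rfl⟩ := chk_dWth.1 h
      obtain ⟨rfl, rfl, rfl, rfl⟩ := prem hs hd he
      exact ⟨.wth A B, rfl, rfl, rfl⟩
    | dPlus =>
      obtain ⟨A, A', B, B', d, e, rfl⟩ := bin hS
      obtain ⟨hd, he, rfl, rfl⟩ := chk_dPlus.1 h
      obtain ⟨rfl, rfl, rfl, rfl⟩ := prem hs hd he
      exact ⟨.plus A B, rfl, rfl, rfl⟩
    | _ => exact nomatch ht

theorem Chk.dual_inv {Γ : List Ty} {d a b : Tm} (hΓ : NamesAndHyps Γ) (h : Chk Γ d (.dual a b)) :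
    ∃ A, a = encTp A ∧ b = encTp A.dual ∧ d = encDual A :=
  exists_encDual hΓ _ d a b (Nat.lt_succ_self _) h

/-! ### Processes -/

/-- The predicate `T` on channels, extended to a newly bound channel, where it holds. -/
def liftS {n : ℕ} (T : Fin n → Prop) : Fin (n + 1) → Prop := Fin.cases True T

/-- The predicate `T` on channels, extended to a newly bound channel, where it fails. -/
def skipS {n : ℕ} (T : Fin n → Prop) : Fin (n + 1) → Prop := Fin.cases False T

/-- The predicate `T` on channels, extended to `x`. -/
def orS {n : ℕ} (x : Fin n) (T : Fin n → Prop) : Fin n → Prop := fun i => i = x ∨ T i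

/-- All free channels of `P` satisfy `T`. -/
def SProc.In {n : ℕ} (T : Fin n → Prop) (P : SProc n) : Prop := ∀ i ∈ P.fn, T i

namespace SProc
variable {n : ℕ} {T : Fin n → Prop}

theorem In.mono {T' : Fin n → Prop} {P : SProc n} (h : P.In T) (hT : ∀ i, T i → T' i) : P.In T' :=
  fun i hi => hT i (h i hi)

theorem in_liftS {P : SProc (n + 1)} : P.In (liftS T) ↔ ∀ i ∈ lower P.fn, T i := by
  constructor
  · intro h i hi
    exact h i.succ (mem_lower.1 hi)
  · intro h i hi
    induction i using Fin.cases with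
    | zero => trivial
    | succ i => exact h i (mem_lower.2 hi)

theorem in_liftS_liftS {P : SProc (n + 2)} :
    P.In (liftS (liftS T)) ↔ ∀ i ∈ lower (lower P.fn), T i := by
  rw [in_liftS]
  constructor
  · intro h i hi
    exact h i.succ (mem_lower.1 hi)
  · intro h i hi
    induction i using Fin.cases with
    | zero => trivial
    | succ i => exact h i (mem_lower.2 hi)

theorem in_fwd {x y : Fin n} : (fwd x y).In T ↔ T x ∧ T y := by
  simp [In, fn]

theorem in_close {x : Fin n} : (close x).In T ↔ T x := by
  simp [In, fn]

theorem in_wait {x : Fin n} {P : SProc n} : (wait x P).In T ↔ T x ∧ P.In T := by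
  simp [In, fn]

theorem in_cut {A : Tp} {P Q : SProc (n + 1)} :
    (cut A P Q).In T ↔ P.In (liftS T) ∧ Q.In (liftS T) := by
  simp only [in_liftS]
  simp only [In, fn, Finset.mem_union, or_imp, forall_and]

theorem in_out {x : Fin n} {P Q : SProc (n + 1)} :
    (out x P Q).In T ↔ T x ∧ P.In (liftS T) ∧ Q.In (liftS T) := by
  simp only [in_liftS]
  simp only [In, fn, Finset.mem_insert, Finset.mem_union, or_imp, forall_and, forall_eq]

theorem in_choice {x : Fin n} {P Q : SProc (n + 1)} :
    (choice x P Q).In T ↔ T x ∧ P.In (liftS T) ∧ Q.In (liftS T) := by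
  simp only [in_liftS]
  simp only [In, fn, Finset.mem_insert, Finset.mem_union, or_imp, forall_and, forall_eq]

theorem in_inl {x : Fin n} {P : SProc (n + 1)} : (inl x P).In T ↔ T x ∧ P.In (liftS T) := by
  simp only [in_liftS]
  simp only [In, fn, Finset.mem_insert, or_imp, forall_and, forall_eq]

theorem in_inr {x : Fin n} {P : SProc (n + 1)} : (inr x P).In T ↔ T x ∧ P.In (liftS T) := by
  simp only [in_liftS]
  simp only [In, fn, Finset.mem_insert, or_imp, forall_and, forall_eq]

theorem in_inp {x : Fin n} {P : SProc (n + 2)} :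
    (inp x P).In T ↔ T x ∧ P.In (liftS (liftS T)) := by
  rw [in_liftS_liftS]
  simp only [In, fn, Finset.mem_insert, or_imp, forall_and, forall_eq]

theorem In.not_mem {P : SProc n} (h : P.In T) {x : Fin n} (hx : ¬ T x) : x ∉ P.fn :=
  fun hi => hx (h x hi)

theorem In.or {P : SProc n} (h : P.In T) (x : Fin n) : P.In (orS x T) := h.mono fun _ => .inr

theorem In.lift_or {P : SProc (n + 1)} (h : P.In (liftS T)) (x : Fin n) :
    P.In (liftS (orS x T)) := by
  rw [in_liftS] at h ⊢
  exact fun i hi => .inr (h i hi)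

theorem In.lift_lift_or {P : SProc (n + 2)} (h : P.In (liftS (liftS T))) (x : Fin n) :
    P.In (liftS (liftS (orS x T))) := by
  rw [in_liftS_liftS] at h ⊢
  exact fun i hi => .inr (h i hi)

theorem liftS_orS {x : Fin n} : liftS (orS x T) = orS x.succ (liftS T) := by
  funext i
  induction i using Fin.cases with
  | zero => exact propext ⟨fun _ => .inr trivial, fun _ => trivial⟩
  | succ i => simp [liftS, orS]

/-- A bound channel may be an ordinary variable in scope, or have no variable and be the channel
tested for linearity. The process may use it in either case. -/
theorem liftS_eq : liftS T = orS 0 (skipS T) := by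
  funext i
  induction i using Fin.cases with
  | zero => exact propext ⟨fun _ => .inl rfl, fun _ => trivial⟩
  | succ i => simp [liftS, orS, skipS]

end SProc

/-- `Γ` consists of names and hypotheses; its names are the variables `ρ i` for the channels `i`
satisfying `T`, and these are pairwise different. -/
structure Scope {n : ℕ} (Γ : List Ty) (ρ : Fin n → ℕ) (T : Fin n → Prop) : Prop where
  hyps : NamesAndHyps Γ
  enum : ∀ k, Γ[k]? = some .name → ∃ i, T i ∧ ρ i = k
  inj : ∀ i j, T i → T j → ρ i = ρ j → i = j

-- Scopes under binders, and decoding of names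

namespace Scope
variable {n : ℕ} {Γ : List Ty} {ρ : Fin n → ℕ} {T : Fin n → Prop}

theorem lift (h : Scope Γ ρ T) : Scope (.name :: Γ) (liftE ρ) (liftS T) where
  hyps := h.hyps.name
  enum
    | 0, _ => ⟨0, trivial, rfl⟩
    | k + 1, hk => by
      obtain ⟨i, hi, rfl⟩ := h.enum k hk
      exact ⟨i.succ, hi, rfl⟩
  inj i j hi hj e := by
    induction i using Fin.cases with
    | zero =>
      induction j using Fin.cases with
      | zero => rfl
      | succ j => exact nomatch e
    | succ i =>
      induction j using Fin.cases with
      | zero => exact nomatch e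
      | succ j => exact congrArg Fin.succ (h.inj i j hi hj (Nat.succ.inj e))

theorem skip (h : Scope Γ ρ T) : Scope Γ (skipE ρ) (skipS T) where
  hyps := h.hyps
  enum k hk := by
    obtain ⟨i, hi, rfl⟩ := h.enum k hk
    exact ⟨i.succ, hi, rfl⟩
  inj i j hi hj e := by
    induction i using Fin.cases with
    | zero => exact hi.elim
    | succ i =>
      induction j using Fin.cases with
      | zero => exact hj.elim
      | succ j => exact congrArg Fin.succ (h.inj i j hi hj e)

/-- The channel under test was outside the scope and enters it as variable `0`. -/
theorem bind (h : Scope Γ ρ T) {x : Fin n} (hx : ¬ T x) :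
    Scope (.name :: Γ) (bindE ρ x) (orS x T) where
  hyps := h.hyps.name
  enum
    | 0, _ => ⟨x, .inl rfl, bindE_self ρ x⟩
    | k + 1, hk => by
      obtain ⟨i, hi, rfl⟩ := h.enum k hk
      exact ⟨i, .inr hi, bindE_ne ρ fun e => hx (e ▸ hi)⟩
  inj i j hi hj e := by
    have ne {i} (hi : T i) : i ≠ x := fun e => hx (e ▸ hi)
    rcases hi with rfl | hi
    · rcases hj with rfl | hj
      · rfl
      · rw [bindE_self, bindE_ne ρ (ne hj)] at e; exact nomatch e
    · rcases hj with rfl | hj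
      · rw [bindE_self, bindE_ne ρ (ne hi)] at e; exact nomatch e
      · rw [bindE_ne ρ (ne hi), bindE_ne ρ (ne hj)] at e
        exact h.inj i j hi hj (Nat.succ.inj e)

theorem block (h : Scope Γ ρ T) (x A : Tm) :
    Scope (.hyp x A :: .name :: Γ) (blockE ρ) (liftS T) where
  hyps := h.hyps.name.hyp x A
  enum
    | 0, hk => by simp at hk
    | 1, _ => ⟨0, trivial, rfl⟩
    | k + 2, hk => by
      obtain ⟨i, hi, rfl⟩ := h.enum k hk
      exact ⟨i.succ, hi, rfl⟩
  inj i j hi hj e := by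
    induction i using Fin.cases with
    | zero =>
      induction j using Fin.cases with
      | zero => rfl
      | succ j => exact absurd e (by simp [blockE])
    | succ i =>
      induction j using Fin.cases with
      | zero => exact absurd e (by simp [blockE])
      | succ j => exact congrArg Fin.succ (h.inj i j hi hj (by simpa [blockE] using e))

theorem name_inv (h : Scope Γ ρ T) {M : Tm} (hM : Chk Γ M .name) : ∃ i, T i ∧ M = v (ρ i) := by
  obtain ⟨k, rfl, hk⟩ := Chk.name_inv h.hyps hM
  obtain ⟨i, hi, rfl⟩ := h.enum k hk
  exact ⟨i, hi, rfl⟩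

/-- The environment separates the channels in scope only, so it is modified elsewhere to become
injective, which changes neither encoding. -/
theorem encProc_inj (h : Scope Γ ρ T) {P Q : SProc n} (hP : P.In T) (hQ : Q.In T)
    (e : encProc ρ P = encProc ρ Q) : P = Q := by
  classical
  obtain ⟨N, hN⟩ : ∃ N, ∀ i, ρ i < N :=
    ⟨∑ i, ρ i + 1, fun i => Nat.lt_succ_of_le (Finset.single_le_sum (fun _ _ => Nat.zero_le _)
      (Finset.mem_univ i))⟩
  -- Since `N` exceeds every value of `ρ`, the values outside `T` are distinct from each other and
  -- from those on `T`.
  let σ : Fin n → ℕ := fun i => if T i then ρ i else N + i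
  have hσ : Function.Injective σ := by
    intro i j e
    have hi := hN i
    have hj := hN j
    by_cases h₁ : T i <;> by_cases h₂ : T j <;> simp only [σ, h₁, h₂, if_true, if_false] at e
    · exact h.inj i j h₁ h₂ e
    · omega
    · omega
    · exact Fin.ext (by omega)
  have eq {P : SProc n} (hP : P.In T) : encProc ρ P = encProc σ P :=
    encProc_congr P fun i hi => (if_pos (hP i hi)).symm
  exact encProc_injective hσ ((eq hP).symm.trans (e.trans (eq hQ)))

end Scope

/-- Besides surjectivity of the encoding it records that the free channels lie in `T`. This is what
later turns non-dependence on a name into freshness of the channel. -/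
theorem exists_encProc (N : ℕ) : ∀ {n : ℕ} {Γ : List Ty} {ρ : Fin n → ℕ} {T : Fin n → Prop}
    (M : Tm), sizeOf M < N → Scope Γ ρ T → Chk Γ M .proc → ∃ P : SProc n, M = encProc ρ P ∧ P.In T := by
  induction N with
  | zero => intro n Γ ρ T M h; exact absurd h (Nat.not_lt_zero _)
  | succ N ih =>
    intro n Γ ρ T M hs hΓ h
    obtain ⟨c, S, rfl, ht, hS⟩ := h.con_inv hΓ.hyps (by decide) (by decide)
    have abs {p : Tm} (hs : sizeOf p < N) (h : Chk Γ p .proc1) :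
        ∃ P : SProc (n + 1), p = .lam (encProc (liftE ρ) P) ∧ P.In (liftS T) := by
      obtain ⟨p, rfl, h'⟩ := h.pi_inv
      simp only [Tm.lam.sizeOf_spec] at hs
      obtain ⟨P, rfl, hP⟩ := ih p (by omega) hΓ.lift h'
      exact ⟨P, rfl, hP⟩
    cases c with
    | fwd =>
      obtain ⟨x, S, rfl, hx, hS⟩ := ChkSp.pi_inv hS
      obtain ⟨y, S, rfl, hy, hS⟩ := ChkSp.pi_inv hS
      obtain rfl := ChkSp.atom_inv hS
      obtain ⟨x, hx', rfl⟩ := hΓ.name_inv hx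
      obtain ⟨y, hy', rfl⟩ := hΓ.name_inv hy
      exact ⟨.fwd x y, rfl, SProc.in_fwd.2 ⟨hx', hy'⟩⟩
    | close =>
      obtain ⟨x, S, rfl, hx, hS⟩ := ChkSp.pi_inv hS
      obtain rfl := ChkSp.atom_inv hS
      obtain ⟨x, hx', rfl⟩ := hΓ.name_inv hx
      exact ⟨.close x, rfl, SProc.in_close.2 hx'⟩
    | wait =>
      obtain ⟨x, S, rfl, hx, hS⟩ := ChkSp.pi_inv hS
      obtain ⟨p, S, rfl, hp, hS⟩ := ChkSp.pi_inv hS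
      obtain rfl := ChkSp.atom_inv hS
      simp only [Tm.con.sizeOf_spec, List.cons.sizeOf_spec, List.nil.sizeOf_spec] at hs
      obtain ⟨x, hx', rfl⟩ := hΓ.name_inv hx
      obtain ⟨P, rfl, hP⟩ := ih p (by omega) hΓ hp
      exact ⟨.wait x P, rfl, SProc.in_wait.2 ⟨hx', hP⟩⟩
    | inl =>
      obtain ⟨x, S, rfl, hx, hS⟩ := ChkSp.pi_inv hS
      obtain ⟨p, S, rfl, hp, hS⟩ := ChkSp.pi_inv hS
      obtain rfl := ChkSp.atom_inv hS
      simp only [Tm.con.sizeOf_spec, List.cons.sizeOf_spec, List.nil.sizeOf_spec] at hs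
      obtain ⟨x, hx', rfl⟩ := hΓ.name_inv hx
      obtain ⟨P, rfl, hP⟩ := abs (by omega) hp
      exact ⟨.inl x P, rfl, SProc.in_inl.2 ⟨hx', hP⟩⟩
    | inr =>
      obtain ⟨x, S, rfl, hx, hS⟩ := ChkSp.pi_inv hS
      obtain ⟨p, S, rfl, hp, hS⟩ := ChkSp.pi_inv hS
      obtain rfl := ChkSp.atom_inv hS
      simp only [Tm.con.sizeOf_spec, List.cons.sizeOf_spec, List.nil.sizeOf_spec] at hs
      obtain ⟨x, hx', rfl⟩ := hΓ.name_inv hx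
      obtain ⟨P, rfl, hP⟩ := abs (by omega) hp
      exact ⟨.inr x P, rfl, SProc.in_inr.2 ⟨hx', hP⟩⟩
    | choice =>
      obtain ⟨x, S, rfl, hx, hS⟩ := ChkSp.pi_inv hS
      obtain ⟨p, S, rfl, hp, hS⟩ := ChkSp.pi_inv hS
      obtain ⟨q, S, rfl, hq, hS⟩ := ChkSp.pi_inv hS
      obtain rfl := ChkSp.atom_inv hS
      simp only [Tm.con.sizeOf_spec, List.cons.sizeOf_spec, List.nil.sizeOf_spec] at hs
      obtain ⟨x, hx', rfl⟩ := hΓ.name_inv hx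
      obtain ⟨P, rfl, hP⟩ := abs (by omega) hp
      obtain ⟨Q, rfl, hQ⟩ := abs (by omega) hq
      exact ⟨.choice x P Q, rfl, SProc.in_choice.2 ⟨hx', hP, hQ⟩⟩
    | out =>
      obtain ⟨x, S, rfl, hx, hS⟩ := ChkSp.pi_inv hS
      obtain ⟨p, S, rfl, hp, hS⟩ := ChkSp.pi_inv hS
      obtain ⟨q, S, rfl, hq, hS⟩ := ChkSp.pi_inv hS
      obtain rfl := ChkSp.atom_inv hS
      simp only [Tm.con.sizeOf_spec, List.cons.sizeOf_spec, List.nil.sizeOf_spec] at hs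
      obtain ⟨x, hx', rfl⟩ := hΓ.name_inv hx
      obtain ⟨P, rfl, hP⟩ := abs (by omega) hp
      obtain ⟨Q, rfl, hQ⟩ := abs (by omega) hq
      exact ⟨.out x P Q, rfl, SProc.in_out.2 ⟨hx', hP, hQ⟩⟩
    | inp =>
      obtain ⟨x, S, rfl, hx, hS⟩ := ChkSp.pi_inv hS
      obtain ⟨p, S, rfl, hp, hS⟩ := ChkSp.pi_inv hS
      obtain rfl := ChkSp.atom_inv hS
      obtain ⟨p, rfl, hp₁⟩ := Chk.pi_inv hp
      obtain ⟨p, rfl, hp₂⟩ := Chk.pi_inv hp₁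
      simp only [Tm.con.sizeOf_spec, Tm.lam.sizeOf_spec, List.cons.sizeOf_spec,
        List.nil.sizeOf_spec] at hs
      obtain ⟨x, hx', rfl⟩ := hΓ.name_inv hx
      obtain ⟨P, rfl, hP⟩ := ih p (by omega) hΓ.lift.lift hp₂
      exact ⟨.inp x P, rfl, SProc.in_inp.2 ⟨hx', hP⟩⟩
    | pcomp =>
      obtain ⟨a, S, rfl, ha, hS⟩ := ChkSp.pi_inv hS
      obtain ⟨p, S, rfl, hp, hS⟩ := ChkSp.pi_inv hS
      obtain ⟨q, S, rfl, hq, hS⟩ := ChkSp.pi_inv hS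
      obtain rfl := ChkSp.atom_inv hS
      simp only [Tm.con.sizeOf_spec, List.cons.sizeOf_spec, List.nil.sizeOf_spec] at hs
      obtain ⟨A, rfl⟩ := Chk.tp_inv hΓ.hyps ha
      obtain ⟨P, rfl, hP⟩ := abs (by omega) hp
      obtain ⟨Q, rfl, hQ⟩ := abs (by omega) hq
      exact ⟨.cut A P Q, rfl, SProc.in_cut.2 ⟨hP, hQ⟩⟩
    | _ => exact nomatch ht

namespace Scope
variable {n : ℕ} {Γ : List Ty} {ρ : Fin n → ℕ} {T : Fin n → Prop}

theorem proc_inv (h : Scope Γ ρ T) {M : Tm} (hM : Chk Γ M .proc) :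
    ∃ P : SProc n, M = encProc ρ P ∧ P.In T :=
  exists_encProc _ M (Nat.lt_succ_self _) h hM

theorem proc1_inv (h : Scope Γ ρ T) {M : Tm} (hM : Chk Γ M .proc1) :
    ∃ P : SProc (n + 1), M = .lam (encProc (liftE ρ) P) ∧ P.In (liftS T) := by
  obtain ⟨M, rfl, hM'⟩ := hM.pi_inv
  obtain ⟨P, rfl, hP⟩ := h.lift.proc_inv hM'
  exact ⟨P, rfl, hP⟩

theorem proc2_inv (h : Scope Γ ρ T) {M : Tm} (hM : Chk Γ M .proc2) :
    ∃ P : SProc (n + 2), M = .lam (.lam (encProc (liftE (liftE ρ)) P)) ∧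
      P.In (liftS (liftS T)) := by
  obtain ⟨M, rfl, hM'⟩ := hM.pi_inv
  obtain ⟨P, rfl, hP⟩ := h.lift.proc1_inv hM'
  exact ⟨P, rfl, hP⟩

end Scope

/-! ### Linearity derivations -/

/-- The channel `x` has no variable in `Γ`; it occurs only under the abstraction in the type. The
head constant determines the rule, the conclusion of the rule determines `P` by injectivity, and
process arguments not depending on `x` give the freshness conditions. -/
theorem exists_encLin (N : ℕ) : ∀ {n : ℕ} {Γ : List Ty} {ρ : Fin n → ℕ} {T : Fin n → Prop}
    {x : Fin n} {P : SProc n} (L : Tm), sizeOf L < N → Scope Γ ρ T → ¬ T x → P.In (orS x T) →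
    Chk Γ L (.linear (.lam (encProc (bindE ρ x) P))) → ∃ l : Lin x P, L = encLin ρ l := by
  induction N with
  | zero => intro n Γ ρ T x P L h; exact absurd h (Nat.not_lt_zero _)
  | succ N ih =>
    intro n Γ ρ T x P L hs hΓ hx hP h
    obtain ⟨c, S, rfl, ht, hS⟩ := h.con_inv hΓ.hyps (by decide) (by decide)
    -- Identifies the given process with the one read off from the arguments of the constant.
    have key {P' : SProc n} (hP' : P'.In (orS x T))
        (e : Tm.lam (encProc (bindE ρ x) P') = .lam (encProc (bindE ρ x) P)) : P = P' :=
      ((hΓ.bind hx).encProc_inj hP' hP (Tm.lam.inj e)).symm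
    have ne {i} (hi : T i) : i ≠ x := fun e => hx (e ▸ hi)
    -- A metavariable that does not depend on `x` was decoded in the scope without `x`.
    have fresh {P : SProc (n + 1)} (h : P.In (liftS T)) : x.succ ∉ P.fn := h.not_mem hx
    -- In a principal rule the tested channel changes from `x` to the continuation, which has no
    -- variable in the same context.
    have principal {P : SProc (n + 1)} {l : Tm} (hs : sizeOf l < N) (hP : P.In (liftS T))
        (h : Chk Γ l (.linear (.lam (encProc (bindE (skipE ρ) 0) P)))) :
        ∃ L : Lin 0 P, l = encLin (skipE ρ) L :=
      ih l hs hΓ.skip id (SProc.liftS_eq ▸ hP) h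
    -- In a congruence rule the tested channel stays `x`, and the channel bound by the prefix
    -- becomes a Π-quantified name.
    have congruence {P : SProc (n + 1)} {l : Tm} (hs : sizeOf l < N) (hP : P.In (liftS (orS x T)))
        (h : Chk Γ l (.pi .name (.linear (.lam (encProc (bindE (liftE ρ) x.succ) P))))) :
        ∃ L : Lin x.succ P, l = .lam (encLin (liftE ρ) L) := by
      obtain ⟨l, rfl, h'⟩ := h.pi_inv
      simp only [Tm.lam.sizeOf_spec] at hs
      obtain ⟨L, rfl⟩ := ih l (by omega) hΓ.lift (x := x.succ) hx (SProc.liftS_orS ▸ hP) h'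
      exact ⟨L, rfl⟩
    cases c with
    | lFwd1 =>
      obtain ⟨y, S, rfl, hy, hS⟩ := ChkSp.pi_inv hS
      obtain rfl := ChkSp.atom_inv hS
      obtain ⟨y, hy', rfl⟩ := hΓ.name_inv hy
      obtain ⟨-, e⟩ := chk_lFwd1.1 h
      have e' : Tm.lam (encProc (bindE ρ x) (.fwd x y)) =
          .lam (encProc (bindE ρ x) P) := by
        simp only [encProc]
        rw [bindE_self, bindE_ne ρ (ne hy')]
        exact e
      obtain rfl := key (SProc.in_fwd.2 ⟨.inl rfl, .inr hy'⟩) e'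
      exact ⟨.fwd₁ (ne hy').symm, rfl⟩
    | lFwd2 =>
      obtain ⟨y, S, rfl, hy, hS⟩ := ChkSp.pi_inv hS
      obtain rfl := ChkSp.atom_inv hS
      obtain ⟨y, hy', rfl⟩ := hΓ.name_inv hy
      obtain ⟨-, e⟩ := chk_lFwd2.1 h
      have e' : Tm.lam (encProc (bindE ρ x) (.fwd y x)) =
          .lam (encProc (bindE ρ x) P) := by
        simp only [encProc]
        rw [bindE_self, bindE_ne ρ (ne hy')]
        exact e
      obtain rfl := key (SProc.in_fwd.2 ⟨.inr hy', .inl rfl⟩) e'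
      exact ⟨.fwd₂ (ne hy'), rfl⟩
    | lClose =>
      obtain rfl := ChkSp.atom_inv hS
      have e := chk_lClose.1 h
      have e' : Tm.lam (encProc (bindE ρ x) (.close x)) =
          .lam (encProc (bindE ρ x) P) := by
        simp only [encProc]
        rw [bindE_self]
        exact e
      obtain rfl := key (SProc.in_close.2 (.inl rfl)) e'
      exact ⟨.close, rfl⟩
    | lWait =>
      obtain ⟨p, S, rfl, hp, hS⟩ := ChkSp.pi_inv hS
      obtain rfl := ChkSp.atom_inv hS
      obtain ⟨P₁, rfl, hP₁⟩ := hΓ.proc_inv hp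
      obtain ⟨-, e⟩ := chk_lWait.1 h
      have e' : Tm.lam (encProc (bindE ρ x) (.wait x P₁)) =
          .lam (encProc (bindE ρ x) P) := by
        simp only [encProc]
        rw [bindE_self, ← encProc_bindE (hP₁.not_mem hx)]
        exact e
      obtain rfl := key (SProc.in_wait.2 ⟨.inl rfl, hP₁.or x⟩) e'
      exact ⟨.wait (hP₁.not_mem hx), rfl⟩
    | lOut =>
      obtain ⟨p, S, rfl, hp, hS⟩ := ChkSp.pi_inv hS
      obtain ⟨q, S, rfl, hq, hS⟩ := ChkSp.pi_inv hS
      obtain ⟨l, S, rfl, hl, hS⟩ := ChkSp.pi_inv hS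
      obtain rfl := ChkSp.atom_inv hS
      simp only [Tm.con.sizeOf_spec, List.cons.sizeOf_spec, List.nil.sizeOf_spec] at hs
      obtain ⟨P₁, rfl, hP₁⟩ := hΓ.proc1_inv hp
      obtain ⟨Q₁, rfl, hQ₁⟩ := hΓ.proc1_inv hq
      obtain ⟨-, -, hl', e⟩ := chk_lOut.1 h
      have e' : Tm.lam (encProc (bindE ρ x) (.out x P₁ Q₁)) =
          .lam (encProc (bindE ρ x) P) := by
        simp only [encProc]
        rw [bindE_self, ← encProc_liftE_bindE (fresh hP₁), ← encProc_liftE_bindE (fresh hQ₁)]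
        exact e
      obtain rfl := key (SProc.in_out.2 ⟨.inl rfl, hP₁.lift_or x, hQ₁.lift_or x⟩) e'
      obtain ⟨L, rfl⟩ := principal (by omega) hQ₁ hl'
      exact ⟨.out L (fresh hP₁) (fresh hQ₁), rfl⟩
    | lInp =>
      obtain ⟨p, S, rfl, hp, hS⟩ := ChkSp.pi_inv hS
      obtain ⟨l, S, rfl, hl, hS⟩ := ChkSp.pi_inv hS
      obtain rfl := ChkSp.atom_inv hS
      obtain ⟨P₁, rfl, hP₁⟩ := hΓ.proc2_inv hp
      obtain ⟨-, hl', e⟩ := chk_lInp.1 h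
      have hP₂ : x.succ.succ ∉ P₁.fn := hP₁.not_mem hx
      have e' : Tm.lam (encProc (bindE ρ x) (.inp x P₁)) =
          .lam (encProc (bindE ρ x) P) := by
        simp only [encProc]
        rw [bindE_self, ← encProc_liftE_liftE_bindE hP₂]
        exact e
      obtain rfl := key (SProc.in_inp.2 ⟨.inl rfl, hP₁.lift_lift_or x⟩) e'
      obtain ⟨l, rfl, hl₂⟩ := hl'.pi_inv
      simp only [Tm.con.sizeOf_spec, Tm.lam.sizeOf_spec, List.cons.sizeOf_spec,
        List.nil.sizeOf_spec] at hs
      -- The continuation is skipped first and the received channel is declared afterwards, which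
      -- makes the tested channel the successor of `0`.
      obtain ⟨L, rfl⟩ := ih l (by omega) hΓ.skip.lift (x := Fin.succ 0) id
        (SProc.liftS_orS ▸ SProc.liftS_eq ▸ hP₁) hl₂
      exact ⟨.inp L hP₂, rfl⟩
    | lInl =>
      obtain ⟨p, S, rfl, hp, hS⟩ := ChkSp.pi_inv hS
      obtain ⟨l, S, rfl, hl, hS⟩ := ChkSp.pi_inv hS
      obtain rfl := ChkSp.atom_inv hS
      simp only [Tm.con.sizeOf_spec, List.cons.sizeOf_spec, List.nil.sizeOf_spec] at hs
      obtain ⟨P₁, rfl, hP₁⟩ := hΓ.proc1_inv hp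
      obtain ⟨-, hl', e⟩ := chk_lInl.1 h
      have e' : Tm.lam (encProc (bindE ρ x) (.inl x P₁)) =
          .lam (encProc (bindE ρ x) P) := by
        simp only [encProc]
        rw [bindE_self, ← encProc_liftE_bindE (fresh hP₁)]
        exact e
      obtain rfl := key (SProc.in_inl.2 ⟨.inl rfl, hP₁.lift_or x⟩) e'
      obtain ⟨L, rfl⟩ := principal (by omega) hP₁ hl'
      exact ⟨.inl L (fresh hP₁), rfl⟩
    | lInr =>
      obtain ⟨p, S, rfl, hp, hS⟩ := ChkSp.pi_inv hS
      obtain ⟨l, S, rfl, hl, hS⟩ := ChkSp.pi_inv hS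
      obtain rfl := ChkSp.atom_inv hS
      simp only [Tm.con.sizeOf_spec, List.cons.sizeOf_spec, List.nil.sizeOf_spec] at hs
      obtain ⟨P₁, rfl, hP₁⟩ := hΓ.proc1_inv hp
      obtain ⟨-, hl', e⟩ := chk_lInr.1 h
      have e' : Tm.lam (encProc (bindE ρ x) (.inr x P₁)) =
          .lam (encProc (bindE ρ x) P) := by
        simp only [encProc]
        rw [bindE_self, ← encProc_liftE_bindE (fresh hP₁)]
        exact e
      obtain rfl := key (SProc.in_inr.2 ⟨.inl rfl, hP₁.lift_or x⟩) e'
      obtain ⟨L, rfl⟩ := principal (by omega) hP₁ hl'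
      exact ⟨.inr L (fresh hP₁), rfl⟩
    | lChoice =>
      obtain ⟨p, S, rfl, hp, hS⟩ := ChkSp.pi_inv hS
      obtain ⟨q, S, rfl, hq, hS⟩ := ChkSp.pi_inv hS
      obtain ⟨l, S, rfl, hl, hS⟩ := ChkSp.pi_inv hS
      obtain ⟨m, S, rfl, hm, hS⟩ := ChkSp.pi_inv hS
      obtain rfl := ChkSp.atom_inv hS
      simp only [Tm.con.sizeOf_spec, List.cons.sizeOf_spec, List.nil.sizeOf_spec] at hs
      obtain ⟨P₁, rfl, hP₁⟩ := hΓ.proc1_inv hp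
      obtain ⟨Q₁, rfl, hQ₁⟩ := hΓ.proc1_inv hq
      obtain ⟨-, -, hl', hm', e⟩ := chk_lChoice.1 h
      have e' : Tm.lam (encProc (bindE ρ x) (.choice x P₁ Q₁)) =
          .lam (encProc (bindE ρ x) P) := by
        simp only [encProc]
        rw [bindE_self, ← encProc_liftE_bindE (fresh hP₁), ← encProc_liftE_bindE (fresh hQ₁)]
        exact e
      obtain rfl := key (SProc.in_choice.2 ⟨.inl rfl, hP₁.lift_or x, hQ₁.lift_or x⟩) e'
      obtain ⟨L₁, rfl⟩ := principal (by omega) hP₁ hl'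
      obtain ⟨L₂, rfl⟩ := principal (by omega) hQ₁ hm'
      exact ⟨.choice L₁ L₂ (fresh hP₁) (fresh hQ₁), rfl⟩
    | lWait2 =>
      obtain ⟨y, S, rfl, hy, hS⟩ := ChkSp.pi_inv hS
      obtain ⟨p, S, rfl, hp, hS⟩ := ChkSp.pi_inv hS
      obtain ⟨l, S, rfl, hl, hS⟩ := ChkSp.pi_inv hS
      obtain rfl := ChkSp.atom_inv hS
      simp only [Tm.con.sizeOf_spec, List.cons.sizeOf_spec, List.nil.sizeOf_spec] at hs
      obtain ⟨y, hy', rfl⟩ := hΓ.name_inv hy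
      obtain ⟨p, rfl, hp'⟩ := Chk.pi_inv hp
      obtain ⟨P₁, rfl, hP₁⟩ := (hΓ.bind hx).proc_inv hp'
      obtain ⟨-, -, hl', e⟩ := chk_lWait2.1 h
      have e' : Tm.lam (encProc (bindE ρ x) (.wait y P₁)) =
          .lam (encProc (bindE ρ x) P) := by
        simp only [encProc]
        rw [bindE_ne ρ (ne hy')]
        exact e
      obtain rfl := key (SProc.in_wait.2 ⟨.inr hy', hP₁⟩) e'
      obtain ⟨L, rfl⟩ := ih l (by omega) hΓ hx hP₁ hl'
      exact ⟨.wait₂ (ne hy').symm L, rfl⟩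
    | lOut2 =>
      obtain ⟨y, S, rfl, hy, hS⟩ := ChkSp.pi_inv hS
      obtain ⟨p, S, rfl, hp, hS⟩ := ChkSp.pi_inv hS
      obtain ⟨q, S, rfl, hq, hS⟩ := ChkSp.pi_inv hS
      obtain ⟨l, S, rfl, hl, hS⟩ := ChkSp.pi_inv hS
      obtain rfl := ChkSp.atom_inv hS
      simp only [Tm.con.sizeOf_spec, List.cons.sizeOf_spec, List.nil.sizeOf_spec] at hs
      obtain ⟨y, hy', rfl⟩ := hΓ.name_inv hy
      obtain ⟨p, rfl, hp'⟩ := Chk.pi_inv hp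
      obtain ⟨P₁, rfl, hP₁⟩ := (hΓ.bind hx).proc1_inv hp'
      obtain ⟨Q₁, rfl, hQ₁⟩ := hΓ.proc1_inv hq
      obtain ⟨-, -, -, hl', e⟩ := chk_lOut2.1 h
      have e' : Tm.lam (encProc (bindE ρ x) (.out y P₁ Q₁)) =
          .lam (encProc (bindE ρ x) P) := by
        simp only [encProc]
        rw [bindE_ne ρ (ne hy'), ← encProc_liftE_bindE (fresh hQ₁)]
        exact e
      obtain rfl := key (SProc.in_out.2 ⟨.inr hy', hP₁, hQ₁.lift_or x⟩) e'
      obtain ⟨L, rfl⟩ := congruence (by omega) hP₁ hl'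
      exact ⟨.out₂ (ne hy').symm L (fresh hQ₁), rfl⟩
    | lOut3 =>
      obtain ⟨y, S, rfl, hy, hS⟩ := ChkSp.pi_inv hS
      obtain ⟨p, S, rfl, hp, hS⟩ := ChkSp.pi_inv hS
      obtain ⟨q, S, rfl, hq, hS⟩ := ChkSp.pi_inv hS
      obtain ⟨l, S, rfl, hl, hS⟩ := ChkSp.pi_inv hS
      obtain rfl := ChkSp.atom_inv hS
      simp only [Tm.con.sizeOf_spec, List.cons.sizeOf_spec, List.nil.sizeOf_spec] at hs
      obtain ⟨y, hy', rfl⟩ := hΓ.name_inv hy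
      obtain ⟨P₁, rfl, hP₁⟩ := hΓ.proc1_inv hp
      obtain ⟨q, rfl, hq'⟩ := Chk.pi_inv hq
      obtain ⟨Q₁, rfl, hQ₁⟩ := (hΓ.bind hx).proc1_inv hq'
      obtain ⟨-, -, -, hl', e⟩ := chk_lOut3.1 h
      have e' : Tm.lam (encProc (bindE ρ x) (.out y P₁ Q₁)) =
          .lam (encProc (bindE ρ x) P) := by
        simp only [encProc]
        rw [bindE_ne ρ (ne hy'), ← encProc_liftE_bindE (fresh hP₁)]
        exact e
      obtain rfl := key (SProc.in_out.2 ⟨.inr hy', hP₁.lift_or x, hQ₁⟩) e'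
      obtain ⟨L, rfl⟩ := congruence (by omega) hQ₁ hl'
      exact ⟨.out₃ (ne hy').symm L (fresh hP₁), rfl⟩
    | lInp2 =>
      obtain ⟨y, S, rfl, hy, hS⟩ := ChkSp.pi_inv hS
      obtain ⟨p, S, rfl, hp, hS⟩ := ChkSp.pi_inv hS
      obtain ⟨l, S, rfl, hl, hS⟩ := ChkSp.pi_inv hS
      obtain rfl := ChkSp.atom_inv hS
      obtain ⟨y, hy', rfl⟩ := hΓ.name_inv hy
      obtain ⟨p, rfl, hp'⟩ := Chk.pi_inv hp
      obtain ⟨P₁, rfl, hP₁⟩ := (hΓ.bind hx).proc2_inv hp'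
      obtain ⟨-, -, hl', e⟩ := chk_lInp2.1 h
      have e' : Tm.lam (encProc (bindE ρ x) (.inp y P₁)) =
          .lam (encProc (bindE ρ x) P) := by
        simp only [encProc]
        rw [bindE_ne ρ (ne hy')]
        exact e
      obtain rfl := key (SProc.in_inp.2 ⟨.inr hy', hP₁⟩) e'
      obtain ⟨l, rfl, hl₂⟩ := hl'.pi_inv
      obtain ⟨l, rfl, hl₃⟩ := hl₂.pi_inv
      simp only [Tm.con.sizeOf_spec, Tm.lam.sizeOf_spec, List.cons.sizeOf_spec,
        List.nil.sizeOf_spec] at hs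
      rw [SProc.liftS_orS, SProc.liftS_orS] at hP₁
      obtain ⟨L, rfl⟩ := ih l (by omega) hΓ.lift.lift (x := x.succ.succ) hx hP₁ hl₃
      exact ⟨.inp₂ (ne hy').symm L, rfl⟩
    | lInl2 =>
      obtain ⟨y, S, rfl, hy, hS⟩ := ChkSp.pi_inv hS
      obtain ⟨p, S, rfl, hp, hS⟩ := ChkSp.pi_inv hS
      obtain ⟨l, S, rfl, hl, hS⟩ := ChkSp.pi_inv hS
      obtain rfl := ChkSp.atom_inv hS
      simp only [Tm.con.sizeOf_spec, List.cons.sizeOf_spec, List.nil.sizeOf_spec] at hs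
      obtain ⟨y, hy', rfl⟩ := hΓ.name_inv hy
      obtain ⟨p, rfl, hp'⟩ := Chk.pi_inv hp
      obtain ⟨P₁, rfl, hP₁⟩ := (hΓ.bind hx).proc1_inv hp'
      obtain ⟨-, -, hl', e⟩ := chk_lInl2.1 h
      have e' : Tm.lam (encProc (bindE ρ x) (.inl y P₁)) =
          .lam (encProc (bindE ρ x) P) := by
        simp only [encProc]
        rw [bindE_ne ρ (ne hy')]
        exact e
      obtain rfl := key (SProc.in_inl.2 ⟨.inr hy', hP₁⟩) e'
      obtain ⟨L, rfl⟩ := congruence (by omega) hP₁ hl'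
      exact ⟨.inl₂ (ne hy').symm L, rfl⟩
    | lInr2 =>
      obtain ⟨y, S, rfl, hy, hS⟩ := ChkSp.pi_inv hS
      obtain ⟨p, S, rfl, hp, hS⟩ := ChkSp.pi_inv hS
      obtain ⟨l, S, rfl, hl, hS⟩ := ChkSp.pi_inv hS
      obtain rfl := ChkSp.atom_inv hS
      simp only [Tm.con.sizeOf_spec, List.cons.sizeOf_spec, List.nil.sizeOf_spec] at hs
      obtain ⟨y, hy', rfl⟩ := hΓ.name_inv hy
      obtain ⟨p, rfl, hp'⟩ := Chk.pi_inv hp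
      obtain ⟨P₁, rfl, hP₁⟩ := (hΓ.bind hx).proc1_inv hp'
      obtain ⟨-, -, hl', e⟩ := chk_lInr2.1 h
      have e' : Tm.lam (encProc (bindE ρ x) (.inr y P₁)) =
          .lam (encProc (bindE ρ x) P) := by
        simp only [encProc]
        rw [bindE_ne ρ (ne hy')]
        exact e
      obtain rfl := key (SProc.in_inr.2 ⟨.inr hy', hP₁⟩) e'
      obtain ⟨L, rfl⟩ := congruence (by omega) hP₁ hl'
      exact ⟨.inr₂ (ne hy').symm L, rfl⟩
    | lChoice2 =>
      obtain ⟨y, S, rfl, hy, hS⟩ := ChkSp.pi_inv hS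
      obtain ⟨p, S, rfl, hp, hS⟩ := ChkSp.pi_inv hS
      obtain ⟨q, S, rfl, hq, hS⟩ := ChkSp.pi_inv hS
      obtain ⟨l, S, rfl, hl, hS⟩ := ChkSp.pi_inv hS
      obtain ⟨m, S, rfl, hm, hS⟩ := ChkSp.pi_inv hS
      obtain rfl := ChkSp.atom_inv hS
      simp only [Tm.con.sizeOf_spec, List.cons.sizeOf_spec, List.nil.sizeOf_spec] at hs
      obtain ⟨y, hy', rfl⟩ := hΓ.name_inv hy
      obtain ⟨p, rfl, hp'⟩ := Chk.pi_inv hp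
      obtain ⟨P₁, rfl, hP₁⟩ := (hΓ.bind hx).proc1_inv hp'
      obtain ⟨q, rfl, hq'⟩ := Chk.pi_inv hq
      obtain ⟨Q₁, rfl, hQ₁⟩ := (hΓ.bind hx).proc1_inv hq'
      obtain ⟨-, -, -, hl', hm', e⟩ := chk_lChoice2.1 h
      have e' : Tm.lam (encProc (bindE ρ x) (.choice y P₁ Q₁)) =
          .lam (encProc (bindE ρ x) P) := by
        simp only [encProc]
        rw [bindE_ne ρ (ne hy')]
        exact e
      obtain rfl := key (SProc.in_choice.2 ⟨.inr hy', hP₁, hQ₁⟩) e'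
      obtain ⟨L₁, rfl⟩ := congruence (by omega) hP₁ hl'
      obtain ⟨L₂, rfl⟩ := congruence (by omega) hQ₁ hm'
      exact ⟨.choice₂ (ne hy').symm L₁ L₂, rfl⟩
    | lPcomp1 =>
      obtain ⟨a, S, rfl, ha, hS⟩ := ChkSp.pi_inv hS
      obtain ⟨p, S, rfl, hp, hS⟩ := ChkSp.pi_inv hS
      obtain ⟨q, S, rfl, hq, hS⟩ := ChkSp.pi_inv hS
      obtain ⟨l, S, rfl, hl, hS⟩ := ChkSp.pi_inv hS
      obtain rfl := ChkSp.atom_inv hS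
      simp only [Tm.con.sizeOf_spec, List.cons.sizeOf_spec, List.nil.sizeOf_spec] at hs
      obtain ⟨A, rfl⟩ := Chk.tp_inv hΓ.hyps ha
      obtain ⟨p, rfl, hp'⟩ := Chk.pi_inv hp
      obtain ⟨p, rfl, hp₂⟩ := Chk.pi_inv hp'
      -- For cuts the metavariable abstracts the channel of the cut before the tested channel; hence
      -- the scope is lifted and then bound.
      obtain ⟨P₁, rfl, hP₁⟩ := (hΓ.lift.bind (x := x.succ) hx).proc_inv hp₂
      obtain ⟨Q₁, rfl, hQ₁⟩ := hΓ.proc1_inv hq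
      obtain ⟨-, -, hl', e⟩ := chk_lPcomp1.1 h
      have e' : Tm.lam (encProc (bindE ρ x) (.cut A P₁ Q₁)) =
          .lam (encProc (bindE ρ x) P) := by
        simp only [encProc]
        rw [← encProc_liftE_bindE (fresh hQ₁)]
        exact e
      rw [← SProc.liftS_orS] at hP₁
      obtain rfl := key (SProc.in_cut.2 ⟨hP₁, hQ₁.lift_or x⟩) e'
      obtain ⟨L, rfl⟩ := congruence (by omega) hP₁ hl'
      exact ⟨.cut₁ L (fresh hQ₁), rfl⟩
    | lPcomp2 =>
      obtain ⟨a, S, rfl, ha, hS⟩ := ChkSp.pi_inv hS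
      obtain ⟨p, S, rfl, hp, hS⟩ := ChkSp.pi_inv hS
      obtain ⟨q, S, rfl, hq, hS⟩ := ChkSp.pi_inv hS
      obtain ⟨l, S, rfl, hl, hS⟩ := ChkSp.pi_inv hS
      obtain rfl := ChkSp.atom_inv hS
      simp only [Tm.con.sizeOf_spec, List.cons.sizeOf_spec, List.nil.sizeOf_spec] at hs
      obtain ⟨A, rfl⟩ := Chk.tp_inv hΓ.hyps ha
      obtain ⟨P₁, rfl, hP₁⟩ := hΓ.proc1_inv hp
      obtain ⟨q, rfl, hq'⟩ := Chk.pi_inv hq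
      obtain ⟨q, rfl, hq₂⟩ := Chk.pi_inv hq'
      obtain ⟨Q₁, rfl, hQ₁⟩ := (hΓ.lift.bind (x := x.succ) hx).proc_inv hq₂
      obtain ⟨-, -, hl', e⟩ := chk_lPcomp2.1 h
      have e' : Tm.lam (encProc (bindE ρ x) (.cut A P₁ Q₁)) =
          .lam (encProc (bindE ρ x) P) := by
        simp only [encProc]
        rw [← encProc_liftE_bindE (fresh hP₁)]
        exact e
      rw [← SProc.liftS_orS] at hQ₁
      obtain rfl := key (SProc.in_cut.2 ⟨hP₁.lift_or x, hQ₁⟩) e'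
      obtain ⟨L, rfl⟩ := congruence (by omega) hQ₁ hl'
      exact ⟨.cut₂ L (fresh hP₁), rfl⟩
    | _ => exact nomatch ht

theorem Scope.lin_inv {n : ℕ} {Γ : List Ty} {ρ : Fin n → ℕ} {T : Fin n → Prop} {x : Fin n}
    {P : SProc n} {L : Tm} (h : Scope Γ ρ T) (hx : ¬ T x) (hP : P.In (orS x T))
    (hL : Chk Γ L (.linear (.lam (encProc (bindE ρ x) P)))) : ∃ l : Lin x P, L = encLin ρ l :=
  exists_encLin _ L (Nat.lt_succ_self _) h hx hP hL

/-! ### Typing derivations -/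

theorem liftS_true {n : ℕ} : liftS (fun _ : Fin n => True) = fun _ => True := by
  funext i
  induction i using Fin.cases <;> rfl

/-- `Γ` consists of the blocks `ρ i : name, η i : hyp (ρ i) A` for the assumptions `i : A` of `Δ`,
and `Δ` types all channels. -/
structure TypedScope {n : ℕ} (Γ : List Ty) (ρ η : Fin n → ℕ) (Δ : Ctx n) : Prop where
  scope : Scope Γ ρ fun _ => True
  blocks : Blocks Γ ρ η Δ
  enum : ∀ k y U, Γ[k]? = some (.hyp y U) → ∃ i A, η i = k ∧ Δ i = some A

namespace TypedScope
variable {n : ℕ} {Γ : List Ty} {ρ η : Fin n → ℕ} {Δ : Ctx n}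

theorem cons (h : TypedScope Γ ρ η Δ) (A : Tp) :
    TypedScope (.hyp (v 0) (encTp A) :: .name :: Γ) (blockE ρ) (hypE η) (Ctx.cons A Δ) where
  scope := liftS_true ▸ h.scope.block _ _
  blocks := h.blocks.cons A
  enum
    | 0, _, _, _ => ⟨0, A, rfl, rfl⟩
    | 1, _, _, hk => by simp at hk
    | k + 2, y, U, hk => by
      obtain ⟨i, A, rfl, hA⟩ := h.enum k y U hk
      exact ⟨i.succ, A, rfl, hA⟩

/-- A hypothesis is about the name of its own block, and names are pairwise different. The index of
the type therefore leaves only the hypothesis for channel `i`, and with it the type. -/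
theorem hyp_inv (h : TypedScope Γ ρ η Δ) {i : Fin n} {M T : Tm}
    (hM : Chk Γ M (.hyp (v (ρ i)) T)) : ∃ A, Δ i = some A ∧ M = v (η i) ∧ T = encTp A := by
  obtain ⟨k, y, U, rfl, hk, hy, rfl⟩ := Chk.hyp_inv h.scope.hyps hM
  obtain ⟨j, A, rfl, hA⟩ := h.enum k y U hk
  obtain ⟨-, h₂, h₃⟩ := h.blocks j A hA
  have e := Option.some.inj (hk.symm.trans h₂)
  simp only [Ty.hyp, Ty.atom.injEq, List.cons.injEq, and_true, true_and] at e
  obtain ⟨rfl, rfl⟩ := e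
  have hij : ρ j = ρ i := by
    rw [h₃]
    simpa [Nat.add_comm] using hy
  obtain rfl := h.scope.inj j i trivial trivial hij
  exact ⟨A, hA, rfl, Tm.ren_encTp _ _⟩

theorem hyp_inv_encTp (h : TypedScope Γ ρ η Δ) {i : Fin n} {M : Tm} {A : Tp}
    (hM : Chk Γ M (.hyp (v (ρ i)) (encTp A))) : Δ i = some A ∧ M = v (η i) := by
  obtain ⟨B, hB, hM, e⟩ := h.hyp_inv hM
  exact ⟨encTp_injective e ▸ hB, hM⟩

end TypedScope

/-- Here all channels are in scope, so no freshness is at stake: the process is identified by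
injectivity, the types by the hypotheses, and the linearity arguments by `Scope.lin_inv`. -/
theorem exists_encDer (N : ℕ) : ∀ {n : ℕ} {Γ : List Ty} {ρ η : Fin n → ℕ} {Δ : Ctx n} {P : SProc n}
    (W : Tm), sizeOf W < N → TypedScope Γ ρ η Δ → Chk Γ W (.wtp (encProc ρ P)) →
    ∃ D : SDer Δ P, W = encDer ρ η D := by
  induction N with
  | zero => intro n Γ ρ η Δ P W h; exact absurd h (Nat.not_lt_zero _)
  | succ N ih =>
    intro n Γ ρ η Δ P W hs hΓ h
    obtain ⟨c, S, rfl, ht, hS⟩ := h.con_inv hΓ.scope.hyps (by decide) (by decide)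
    have key {P' : SProc n} (e : encProc ρ P' = encProc ρ P) : P = P' :=
      (hΓ.scope.encProc_inj (fun _ _ => trivial) (fun _ _ => trivial) e).symm
    -- The newest channel is the tested one and has no variable; all the others are in scope.
    have lin {P : SProc (n + 1)} {l : Tm}
        (h : Chk Γ l (.linear (.lam (encProc (bindE (skipE ρ) 0) P)))) :
        ∃ L : Lin 0 P, l = encLin (skipE ρ) L := by
      refine hΓ.scope.skip.lin_inv id ?_ h
      rw [← SProc.liftS_eq, liftS_true]
      exact fun _ _ => trivial
    have der {A : Tp} {P : SProc (n + 1)} {d : Tm} (hs : sizeOf d < N)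
        (h : Chk Γ d (.pi .name (.pi (.hyp (v 0) (encTp A)) (.wtp (encProc (blockE ρ) P))))) :
        ∃ D : SDer (Ctx.cons A Δ) P, d = .lam (.lam (encDer (blockE ρ) (hypE η) D)) := by
      obtain ⟨d, rfl, h'⟩ := h.pi_inv
      obtain ⟨d, rfl, h''⟩ := h'.pi_inv
      simp only [Tm.lam.sizeOf_spec] at hs
      obtain ⟨D, rfl⟩ := ih d (by omega) (hΓ.cons A) h''
      exact ⟨D, rfl⟩
    cases c with
    | wtpFwd =>
      obtain ⟨a, S, rfl, ha, hS⟩ := ChkSp.pi_inv hS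
      obtain ⟨b, S, rfl, hb, hS⟩ := ChkSp.pi_inv hS
      obtain ⟨e, S, rfl, he, hS⟩ := ChkSp.pi_inv hS
      obtain ⟨x, S, rfl, hx, hS⟩ := ChkSp.pi_inv hS
      obtain ⟨k, S, rfl, hk, hS⟩ := ChkSp.pi_inv hS
      obtain ⟨y, S, rfl, hy, hS⟩ := ChkSp.pi_inv hS
      obtain ⟨m, S, rfl, hm, hS⟩ := ChkSp.pi_inv hS
      obtain rfl := ChkSp.atom_inv hS
      obtain ⟨A, rfl⟩ := Chk.tp_inv hΓ.scope.hyps ha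
      obtain ⟨B, rfl⟩ := Chk.tp_inv hΓ.scope.hyps hb
      obtain ⟨x, -, rfl⟩ := hΓ.scope.name_inv hx
      obtain ⟨y, -, rfl⟩ := hΓ.scope.name_inv hy
      obtain ⟨he', -, hk', -, hm', e⟩ := chk_wtpFwd.1 h
      -- The duality argument forces the second type to be the dual of the first and is itself
      -- determined by that type.
      obtain ⟨A', e₁, e₂, rfl⟩ := Chk.dual_inv hΓ.scope.hyps he'
      obtain rfl := encTp_injective e₁
      obtain rfl := encTp_injective e₂
      obtain ⟨hx', rfl⟩ := hΓ.hyp_inv_encTp hk'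
      obtain ⟨hy', rfl⟩ := hΓ.hyp_inv_encTp hm'
      obtain rfl := key (P' := .fwd x y) e
      exact ⟨.id A hx' hy', rfl⟩
    | wtpPcomp =>
      obtain ⟨a, S, rfl, ha, hS⟩ := ChkSp.pi_inv hS
      obtain ⟨b, S, rfl, hb, hS⟩ := ChkSp.pi_inv hS
      obtain ⟨p, S, rfl, hp, hS⟩ := ChkSp.pi_inv hS
      obtain ⟨q, S, rfl, hq, hS⟩ := ChkSp.pi_inv hS
      obtain ⟨e, S, rfl, he, hS⟩ := ChkSp.pi_inv hS
      obtain ⟨c, S, rfl, hc, hS⟩ := ChkSp.pi_inv hS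
      obtain ⟨d, S, rfl, hd, hS⟩ := ChkSp.pi_inv hS
      obtain ⟨l, S, rfl, hl, hS⟩ := ChkSp.pi_inv hS
      obtain ⟨m, S, rfl, hm, hS⟩ := ChkSp.pi_inv hS
      obtain rfl := ChkSp.atom_inv hS
      simp only [Tm.con.sizeOf_spec, List.cons.sizeOf_spec, List.nil.sizeOf_spec] at hs
      obtain ⟨A, rfl⟩ := Chk.tp_inv hΓ.scope.hyps ha
      obtain ⟨B, rfl⟩ := Chk.tp_inv hΓ.scope.hyps hb
      obtain ⟨P₁, rfl, -⟩ := hΓ.scope.proc1_inv hp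
      obtain ⟨Q₁, rfl, -⟩ := hΓ.scope.proc1_inv hq
      obtain ⟨-, -, he', hc', hd', hl', hm', e⟩ := chk_wtpPcomp.1 h
      obtain ⟨A', e₁, e₂, rfl⟩ := Chk.dual_inv hΓ.scope.hyps he'
      obtain rfl := encTp_injective e₁
      obtain rfl := encTp_injective e₂
      obtain rfl := key (P' := .cut A P₁ Q₁) e
      obtain ⟨D₁, rfl⟩ := der (by omega) hc'
      obtain ⟨D₂, rfl⟩ := der (by omega) hd'
      obtain ⟨L₁, rfl⟩ := lin hl'
      obtain ⟨L₂, rfl⟩ := lin hm'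
      exact ⟨.cut D₁ L₁ D₂ L₂, rfl⟩
    | wtpInl =>
      obtain ⟨a, S, rfl, ha, hS⟩ := ChkSp.pi_inv hS
      obtain ⟨b, S, rfl, hb, hS⟩ := ChkSp.pi_inv hS
      obtain ⟨p, S, rfl, hp, hS⟩ := ChkSp.pi_inv hS
      obtain ⟨x, S, rfl, hx, hS⟩ := ChkSp.pi_inv hS
      obtain ⟨k, S, rfl, hk, hS⟩ := ChkSp.pi_inv hS
      obtain ⟨d, S, rfl, hd, hS⟩ := ChkSp.pi_inv hS
      obtain rfl := ChkSp.atom_inv hS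
      simp only [Tm.con.sizeOf_spec, List.cons.sizeOf_spec, List.nil.sizeOf_spec] at hs
      obtain ⟨A, rfl⟩ := Chk.tp_inv hΓ.scope.hyps ha
      obtain ⟨B, rfl⟩ := Chk.tp_inv hΓ.scope.hyps hb
      obtain ⟨P₁, rfl, -⟩ := hΓ.scope.proc1_inv hp
      obtain ⟨x, -, rfl⟩ := hΓ.scope.name_inv hx
      obtain ⟨-, -, hk', hd', e⟩ := chk_wtpInl.1 h
      obtain ⟨hx', rfl⟩ := hΓ.hyp_inv_encTp (A := .plus A B) hk'
      obtain rfl := key (P' := .inl x P₁) e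
      obtain ⟨D, rfl⟩ := der (by omega) hd'
      exact ⟨.inl A B hx' D, rfl⟩
    | wtpInr =>
      obtain ⟨a, S, rfl, ha, hS⟩ := ChkSp.pi_inv hS
      obtain ⟨b, S, rfl, hb, hS⟩ := ChkSp.pi_inv hS
      obtain ⟨p, S, rfl, hp, hS⟩ := ChkSp.pi_inv hS
      obtain ⟨x, S, rfl, hx, hS⟩ := ChkSp.pi_inv hS
      obtain ⟨k, S, rfl, hk, hS⟩ := ChkSp.pi_inv hS
      obtain ⟨d, S, rfl, hd, hS⟩ := ChkSp.pi_inv hS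
      obtain rfl := ChkSp.atom_inv hS
      simp only [Tm.con.sizeOf_spec, List.cons.sizeOf_spec, List.nil.sizeOf_spec] at hs
      obtain ⟨A, rfl⟩ := Chk.tp_inv hΓ.scope.hyps ha
      obtain ⟨B, rfl⟩ := Chk.tp_inv hΓ.scope.hyps hb
      obtain ⟨P₁, rfl, -⟩ := hΓ.scope.proc1_inv hp
      obtain ⟨x, -, rfl⟩ := hΓ.scope.name_inv hx
      obtain ⟨-, -, hk', hd', e⟩ := chk_wtpInr.1 h
      obtain ⟨hx', rfl⟩ := hΓ.hyp_inv_encTp (A := .plus A B) hk'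
      obtain rfl := key (P' := .inr x P₁) e
      obtain ⟨D, rfl⟩ := der (by omega) hd'
      exact ⟨.inr A B hx' D, rfl⟩
    | wtpChoice =>
      obtain ⟨a, S, rfl, ha, hS⟩ := ChkSp.pi_inv hS
      obtain ⟨b, S, rfl, hb, hS⟩ := ChkSp.pi_inv hS
      obtain ⟨p, S, rfl, hp, hS⟩ := ChkSp.pi_inv hS
      obtain ⟨q, S, rfl, hq, hS⟩ := ChkSp.pi_inv hS
      obtain ⟨x, S, rfl, hx, hS⟩ := ChkSp.pi_inv hS
      obtain ⟨k, S, rfl, hk, hS⟩ := ChkSp.pi_inv hS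
      obtain ⟨c, S, rfl, hc, hS⟩ := ChkSp.pi_inv hS
      obtain ⟨d, S, rfl, hd, hS⟩ := ChkSp.pi_inv hS
      obtain rfl := ChkSp.atom_inv hS
      simp only [Tm.con.sizeOf_spec, List.cons.sizeOf_spec, List.nil.sizeOf_spec] at hs
      obtain ⟨A, rfl⟩ := Chk.tp_inv hΓ.scope.hyps ha
      obtain ⟨B, rfl⟩ := Chk.tp_inv hΓ.scope.hyps hb
      obtain ⟨P₁, rfl, -⟩ := hΓ.scope.proc1_inv hp
      obtain ⟨Q₁, rfl, -⟩ := hΓ.scope.proc1_inv hq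
      obtain ⟨x, -, rfl⟩ := hΓ.scope.name_inv hx
      obtain ⟨-, -, -, hk', hc', hd', e⟩ := chk_wtpChoice.1 h
      obtain ⟨hx', rfl⟩ := hΓ.hyp_inv_encTp (A := .wth A B) hk'
      obtain rfl := key (P' := .choice x P₁ Q₁) e
      obtain ⟨D₁, rfl⟩ := der (by omega) hc'
      obtain ⟨D₂, rfl⟩ := der (by omega) hd'
      exact ⟨.wth A B hx' D₁ D₂, rfl⟩
    | wtpOut =>
      obtain ⟨a, S, rfl, ha, hS⟩ := ChkSp.pi_inv hS
      obtain ⟨b, S, rfl, hb, hS⟩ := ChkSp.pi_inv hS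
      obtain ⟨p, S, rfl, hp, hS⟩ := ChkSp.pi_inv hS
      obtain ⟨q, S, rfl, hq, hS⟩ := ChkSp.pi_inv hS
      obtain ⟨x, S, rfl, hx, hS⟩ := ChkSp.pi_inv hS
      obtain ⟨k, S, rfl, hk, hS⟩ := ChkSp.pi_inv hS
      obtain ⟨c, S, rfl, hc, hS⟩ := ChkSp.pi_inv hS
      obtain ⟨l, S, rfl, hl, hS⟩ := ChkSp.pi_inv hS
      obtain ⟨d, S, rfl, hd, hS⟩ := ChkSp.pi_inv hS
      obtain rfl := ChkSp.atom_inv hS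
      simp only [Tm.con.sizeOf_spec, List.cons.sizeOf_spec, List.nil.sizeOf_spec] at hs
      obtain ⟨A, rfl⟩ := Chk.tp_inv hΓ.scope.hyps ha
      obtain ⟨B, rfl⟩ := Chk.tp_inv hΓ.scope.hyps hb
      obtain ⟨P₁, rfl, -⟩ := hΓ.scope.proc1_inv hp
      obtain ⟨Q₁, rfl, -⟩ := hΓ.scope.proc1_inv hq
      obtain ⟨x, -, rfl⟩ := hΓ.scope.name_inv hx
      obtain ⟨-, -, -, hk', hc', hl', hd', e⟩ := chk_wtpOut.1 h
      obtain ⟨hx', rfl⟩ := hΓ.hyp_inv_encTp (A := .tensor A B) hk'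
      obtain rfl := key (P' := .out x P₁ Q₁) e
      obtain ⟨D₁, rfl⟩ := der (by omega) hc'
      obtain ⟨D₂, rfl⟩ := der (by omega) hd'
      obtain ⟨L, rfl⟩ := lin hl'
      exact ⟨.tensor A B hx' D₁ L D₂, rfl⟩
    | wtpInp =>
      obtain ⟨a, S, rfl, ha, hS⟩ := ChkSp.pi_inv hS
      obtain ⟨b, S, rfl, hb, hS⟩ := ChkSp.pi_inv hS
      obtain ⟨p, S, rfl, hp, hS⟩ := ChkSp.pi_inv hS
      obtain ⟨x, S, rfl, hx, hS⟩ := ChkSp.pi_inv hS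
      obtain ⟨k, S, rfl, hk, hS⟩ := ChkSp.pi_inv hS
      obtain ⟨d, S, rfl, hd, hS⟩ := ChkSp.pi_inv hS
      obtain ⟨l, S, rfl, hl, hS⟩ := ChkSp.pi_inv hS
      obtain rfl := ChkSp.atom_inv hS
      obtain ⟨A, rfl⟩ := Chk.tp_inv hΓ.scope.hyps ha
      obtain ⟨B, rfl⟩ := Chk.tp_inv hΓ.scope.hyps hb
      obtain ⟨P₁, rfl, -⟩ := hΓ.scope.proc2_inv hp
      obtain ⟨x, -, rfl⟩ := hΓ.scope.name_inv hx
      obtain ⟨-, -, hk', hd', hl', e⟩ := chk_wtpInp.1 h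
      obtain ⟨hx', rfl⟩ := hΓ.hyp_inv_encTp (A := .par A B) hk'
      obtain rfl := key (P' := .inp x P₁) e
      obtain ⟨d, rfl, hd₁⟩ := hd'.pi_inv
      obtain ⟨d, rfl, hd₂⟩ := hd₁.pi_inv
      obtain ⟨d, rfl, hd₃⟩ := hd₂.pi_inv
      obtain ⟨d, rfl, hd₄⟩ := hd₃.pi_inv
      obtain ⟨l, rfl, hl₁⟩ := hl'.pi_inv
      simp only [Tm.con.sizeOf_spec, Tm.lam.sizeOf_spec, List.cons.sizeOf_spec,
        List.nil.sizeOf_spec] at hs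
      -- The block of the continuation is the outer one, so the received channel is number `0`.
      obtain ⟨D, rfl⟩ := ih d (by omega) ((hΓ.cons B).cons A) hd₄
      obtain ⟨L, rfl⟩ := hΓ.scope.lift.skip.lin_inv (x := 0) id
        (by rw [← SProc.liftS_eq, liftS_true, liftS_true]; exact fun _ _ => trivial) hl₁
      exact ⟨.par A B hx' D L, rfl⟩
    | wtpClose =>
      obtain ⟨x, S, rfl, hx, hS⟩ := ChkSp.pi_inv hS
      obtain ⟨k, S, rfl, hk, hS⟩ := ChkSp.pi_inv hS
      obtain rfl := ChkSp.atom_inv hS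
      obtain ⟨x, -, rfl⟩ := hΓ.scope.name_inv hx
      obtain ⟨-, hk', e⟩ := chk_wtpClose.1 h
      obtain ⟨hx', rfl⟩ := hΓ.hyp_inv_encTp (A := .one) hk'
      obtain rfl := key (P' := .close x) e
      exact ⟨.one hx', rfl⟩
    | wtpWait =>
      obtain ⟨p, S, rfl, hp, hS⟩ := ChkSp.pi_inv hS
      obtain ⟨x, S, rfl, hx, hS⟩ := ChkSp.pi_inv hS
      obtain ⟨k, S, rfl, hk, hS⟩ := ChkSp.pi_inv hS
      obtain ⟨d, S, rfl, hd, hS⟩ := ChkSp.pi_inv hS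
      obtain rfl := ChkSp.atom_inv hS
      simp only [Tm.con.sizeOf_spec, List.cons.sizeOf_spec, List.nil.sizeOf_spec] at hs
      obtain ⟨P₁, rfl, -⟩ := hΓ.scope.proc_inv hp
      obtain ⟨x, -, rfl⟩ := hΓ.scope.name_inv hx
      obtain ⟨-, -, hk', hd', e⟩ := chk_wtpWait.1 h
      obtain ⟨hx', rfl⟩ := hΓ.hyp_inv_encTp (A := .bot) hk'
      obtain rfl := key (P' := .wait x P₁) e
      obtain ⟨D, rfl⟩ := ih d (by omega) hΓ hd'
      exact ⟨.bot hx' D, rfl⟩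
    | _ => exact nomatch ht

theorem TypedScope.der_inv {n : ℕ} {Γ : List Ty} {ρ η : Fin n → ℕ} {Δ : Ctx n} {P : SProc n}
    {W : Tm} (h : TypedScope Γ ρ η Δ) (hW : Chk Γ W (.wtp (encProc ρ P))) :
    ∃ D : SDer Δ P, W = encDer ρ η D :=
  exists_encDer _ W (Nat.lt_succ_self _) h hW

/-! ### Contexts -/

theorem getElem?_blockCtx (Ts : List Tm) : ∀ k,
    (blockCtx Ts)[2 * k]? = Ts[k]?.map (.hyp (v 0)) ∧
    (blockCtx Ts)[2 * k + 1]? = Ts[k]?.map fun _ => .name := by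
  induction Ts with
  | nil => intro k; exact ⟨rfl, rfl⟩
  | cons T Ts ih =>
    intro k
    cases k with
    | zero => exact ⟨rfl, rfl⟩
    | succ k => exact ih k

theorem namesAndHyps_blockCtx (Ts : List Tm) : NamesAndHyps (blockCtx Ts) := by
  induction Ts with
  | nil => intro A hA; exact nomatch hA
  | cons T Ts ih => exact ih.name.hyp _ _

theorem getElem?_blockCtx_eq_name {Ts : List Tm} {k : ℕ} :
    (blockCtx Ts)[k]? = some .name ↔ ∃ j < Ts.length, k = 2 * j + 1 := by
  constructor
  · intro h
    obtain ⟨j, rfl | rfl⟩ := Nat.even_or_odd' k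
    · rw [(getElem?_blockCtx Ts j).1] at h
      cases e : Ts[j]? <;> rw [e] at h <;> exact nomatch h
    · refine ⟨j, ?_, rfl⟩
      rw [(getElem?_blockCtx Ts j).2] at h
      by_contra hj
      rw [List.getElem?_eq_none (by omega)] at h
      exact nomatch h
  · rintro ⟨j, hj, rfl⟩
    rw [(getElem?_blockCtx Ts j).2, List.getElem?_eq_getElem hj]
    rfl

/-- A declaration `hyp x T` is well formed only if `T` has type `tp`, and canonical forms of that
type are encodings. This is the source of the CP context in the second part of the claim. -/
theorem isCtx_blockCtx {Ts : List Tm} : IsCtx (blockCtx Ts) ↔ ∀ T ∈ Ts, ∃ A, T = encTp A := by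
  induction Ts with
  | nil => exact ⟨fun _ _ h => (nomatch h), fun _ => .nil⟩
  | cons T Ts ih =>
    rw [List.forall_mem_cons, ← ih]
    constructor
    · intro h
      cases h with
      | cons h hT =>
        cases h with
        | cons h _ =>
          cases hT with
          | atom hT =>
            cases hT with
            | cons _ hT =>
              cases hT with
              | cons hT _ => exact ⟨hT.tp_inv (namesAndHyps_blockCtx Ts).name, h⟩
    · rintro ⟨⟨A, rfl⟩, h⟩
      exact .cons (.cons h (.atom .nil)) (.atom (.cons (chk_name rfl) (.cons (chk_encTp _ A) .nil)))

theorem isCtx_nameCtx {n : ℕ} (S : Finset (Fin n)) : IsCtx (nameCtx S) := by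
  have (k : ℕ) : IsCtx (List.replicate k .name) := by
    induction k with
    | zero => exact .nil
    | succ k ih => exact .cons ih (.atom .nil)
  exact this _

theorem getElem?_nameCtx {n : ℕ} {S : Finset (Fin n)} {i : Fin n} (hi : i ∈ S) :
    (nameCtx S)[rankVar S i]? = some .name := by
  refine (List.getElem?_replicate_of_lt (Finset.card_lt_card ?_))
  -- A member of `S` is not below itself, so its rank is less than the cardinality.
  exact Finset.filter_ssubset.2 ⟨i, hi, lt_irrefl i⟩

theorem nameVar_injective {n : ℕ} : Function.Injective (nameVar : Fin n → ℕ) := fun i j h =>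
  Fin.ext (by simp only [nameVar] at h; omega)

theorem scope_blockCtx {n : ℕ} (T : Fin n → Tm) :
    Scope (n := n) (blockCtx (List.ofFn T)) nameVar fun _ => True where
  hyps := namesAndHyps_blockCtx _
  enum k hk := by
    obtain ⟨j, hj, rfl⟩ := getElem?_blockCtx_eq_name.1 hk
    exact ⟨⟨j, by simpa using hj⟩, trivial, rfl⟩
  inj _ _ _ _ h := nameVar_injective h

theorem getElem?_encCtx {n : ℕ} (A : Fin n → Tp) (i : Fin n) :
    (encCtx A)[hypVar i]? = some (.hyp (v 0) (encTp (A i))) := by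
  rw [encCtx, hypVar, (getElem?_blockCtx _ _).1]
  simp

theorem typedScope_encCtx {n : ℕ} (A : Fin n → Tp) :
    TypedScope (encCtx A) nameVar hypVar (Ctx.full A) where
  scope := scope_blockCtx _
  blocks i B hB := by
    cases hB
    exact ⟨getElem?_blockCtx_eq_name.2 ⟨i, by simp, rfl⟩, getElem?_encCtx A i, rfl⟩
  enum k y U hk := by
    -- Hypotheses stand at even positions and names at odd ones.
    obtain ⟨j, rfl | rfl⟩ := Nat.even_or_odd' k
    · have hj : j < n := by
        by_contra hj
        rw [encCtx, (getElem?_blockCtx _ j).1, List.getElem?_eq_none (by simpa using hj)] at hk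
        exact nomatch hk
      exact ⟨⟨j, hj⟩, _, rfl, rfl⟩
    · rw [encCtx, (getElem?_blockCtx _ j).2] at hk
      cases e : (List.ofFn fun i => encTp (A i))[j]? <;> rw [e] at hk <;> exact nomatch hk

/-- The variable for channel `j` in a context of blocks without the block of `i ≠ j`. -/
def eraseVar {n : ℕ} (i j : Fin n) : ℕ := if j < i then 2 * j + 1 else 2 * j - 1

/-- Without block `i` the later blocks move up by two variables, and `i` is the only channel left
without a variable. -/
theorem scope_eraseIdx {n : ℕ} (T : Fin n → Tm) (i : Fin n) :
    Scope (blockCtx ((List.ofFn T).eraseIdx i)) (eraseVar i) fun j => j ≠ i where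
  hyps := namesAndHyps_blockCtx _
  enum k hk := by
    obtain ⟨j, hj, rfl⟩ := getElem?_blockCtx_eq_name.1 hk
    rw [List.length_eraseIdx_of_lt (by simp), List.length_ofFn] at hj
    by_cases h : j < i
    · refine ⟨⟨j, by omega⟩, fun e => ?_, if_pos h⟩
      exact absurd h (by simp [← e])
    -- From position `i` on, block `j` of the shortened context belongs to channel `j + 1`.
    · refine ⟨⟨j + 1, by omega⟩, fun e => ?_, ?_⟩
      · exact h (by simp [← e])
      · exact if_neg fun h' => h (Nat.lt_of_succ_lt h')
  inj j k hj hk e := by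
    have hj' := Fin.val_ne_of_ne hj
    have hk' := Fin.val_ne_of_ne hk
    simp only [eraseVar, Fin.lt_def] at e
    refine Fin.ext ?_
    split_ifs at e <;> omega

/-- A process mentions only name variables, which are odd, so it does not matter where the
hypothesis of block `i` goes. On names the renaming of `lamBlock` is `bindE` over the shortened
context: a later name `2 * j + 1` goes to `(2 * j - 1) + 1`. -/
theorem lamBlock_encProc {n : ℕ} (i : Fin n) (P : SProc n) :
    lamBlock i (encProc nameVar P) = .lam (encProc (bindE (eraseVar i) i) P) := by
  rw [lamBlock, Tm.ren_encProc]
  congr 2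
  funext j
  have hj : nameVar j = 2 * j + 1 := rfl
  rw [Function.comp_apply]
  rcases lt_trichotomy j i with h | rfl | h
  · rw [bindE_ne _ h.ne, eraseVar, if_pos h, if_neg (by omega), if_pos (by omega), hj]
  · rw [bindE_self, if_pos hj]
  · rw [bindE_ne _ h.ne', eraseVar, if_neg h.not_gt, if_neg (by omega), if_neg (by omega)]
    omega

/-! ## Adequacy -/

/-- Derivations of processes that are equal but not definitionally so are compared without computing
any transport, by uniqueness. -/
theorem encDer_eq_of_eq {n : ℕ} {ρ η : Fin n → ℕ} {Γ : Ctx n} {P Q : SProc n} (h : P = Q)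
    (D : SDer Γ P) (E : SDer Γ Q) : encDer ρ η D = encDer ρ η E := by
  subst h
  rw [Subsingleton.elim D E]

theorem CPDer.sigma_eq {n : ℕ} {Θ : Ctx n} {P Q : CProc n} (h : P = Q)
    (D : CPDer Θ P) (E : CPDer Θ Q) : (⟨P, D⟩ : Σ P, CPDer Θ P) = ⟨Q, E⟩ := by
  subst h
  rw [Subsingleton.elim D E]

theorem decCP_encCP {n : ℕ} {ρ : Fin n → ℕ} (hρ : Function.Injective ρ) (P : CProc n) :
    decCP ρ (encCP ρ P) = some P := by
  rw [decCP, encCP, decProc_encProc _ hρ, Option.map_some, del_eps]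

/-- The LF stage always inverts, so only definedness of `δ` on the derivation is in question. -/
theorem decCPDer_eq {n : ℕ} {Δ : Ctx n} {P : SProc n} {D : SDer Δ P} {E : CPDer Δ (del P)}
    (h : delDer Δ D = some E) :
    decCPDer Δ (encProc nameVar P) (encDer nameVar hypVar D) = some ⟨del P, E⟩ := by
  simp only [decCPDer, decProc_encProc _ nameVar_injective, decDer_encDer, h, bind, pure,
    Option.bind]

theorem lf_encCPDer {n : ℕ} {A : Fin n → Tp} {P : CProc n} (D : CPDer (Ctx.full A) P) :
    LF (encCtx A) (encCPDer D) (.wtp (encCP nameVar P)) where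
  ctx := isCtx_blockCtx.2 fun T hT => by
    obtain ⟨i, rfl⟩ := (List.mem_ofFn' _ _).1 hT
    exact ⟨A i, rfl⟩
  type := .atom (.cons (chk_encProc _ fun i _ =>
    ((typedScope_encCtx A).blocks i (A i) rfl).1) .nil)
  term := chk_encDer _ (typedScope_encCtx A).blocks

theorem lf_encLin {n : ℕ} {P : CProc n} {i : Fin n} (L : Lin i (eps P)) :
    LF (nameCtx (P.fn \ {i})) (encLin (rankVar (P.fn \ {i})) L)
      (.linear (.lam (encCP (bindE (rankVar (P.fn \ {i})) i) P))) := by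
  have h : ∀ j ∈ (eps P).fn, j ≠ i →
      (nameCtx (P.fn \ {i}))[rankVar (P.fn \ {i}) j]? = some .name := fun j hj hji =>
    getElem?_nameCtx (by rw [fn_eps] at hj; simp [hj, hji])
  exact ⟨isCtx_nameCtx _, .atom (.cons (.lam (chk_encProc _ (names_bindE h))) .nil),
    chk_encLin L h⟩

theorem decCPDer_encCPDer {n : ℕ} {A : Fin n → Tp} {P : CProc n} (D : CPDer (Ctx.full A) P) :
    decCPDer (Ctx.full A) (encCP nameVar P) (encCPDer D) = some ⟨P, D⟩ := by
  -- The context types every channel, so every channel is free in `P`.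
  have hfn (i : Fin n) : i ∈ P.fn := (D.dom i).1 fun h => nomatch h
  obtain ⟨E, hE⟩ := Option.isSome_iff_exists.1 <|
    delDer_isSome (epsDer D) (Ctx.full A) (fun _ _ h => h)
      (fun z => ⟨fun _ => by rw [fn_eps]; exact hfn z, fun _ h => nomatch h⟩)
      fun z _ => ⟨D.lin z fun h => nomatch h⟩
  exact (decCPDer_eq hE).trans (congrArg some (CPDer.sigma_eq (del_eps P) E D))

end CPLF

theorem mainTheorem9 :
    -- decoding is left inverse to encoding, on all CP processes
    (∀ (n : ℕ) (ρ : Fin n → ℕ), Function.Injective ρ → ∀ P : CProc n,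
      decCP ρ (encCP ρ P) = some P) ∧
    -- from CP derivations to LF canonical forms
    (∀ (n : ℕ) (A : Fin n → Tp) (P : CProc n) (D : CPDer (Ctx.full A) P),
      ∃ (W : Tm) (L : Fin n → Tm),
        W = encCPDer D ∧
        LF (encCtx A) W (.wtp (encCP nameVar P)) ∧
        (∀ i, LF (nameCtx (P.fn \ {i})) (L i)
          (.linear (.lam (encCP (bindE (rankVar (P.fn \ {i})) i) P)))) ∧
        decCPDer (Ctx.full A) (encCP nameVar P) (encCPDer D) = some ⟨P, D⟩) ∧
    -- from LF canonical forms to CP derivations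
    (∀ (n : ℕ) (T : Fin n → Tm) (M W : Tm) (L : Fin n → Tm),
      LF (blockCtx (List.ofFn T)) W (.wtp M) →
      (∀ i : Fin n, LF (blockCtx ((List.ofFn T).eraseIdx i)) (L i) (.linear (lamBlock i M))) →
      ∃ (A : Fin n → Tp) (P : CProc n) (D : CPDer (Ctx.full A) P),
        blockCtx (List.ofFn T) = encCtx A ∧
        decCP nameVar M = some P ∧
        decCPDer (Ctx.full A) M W = some ⟨P, D⟩ ∧
        encCP nameVar P = M ∧
        encCPDer D = W) := by
  refine ⟨fun n ρ hρ P => decCP_encCP hρ P, fun n A P D =>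
    ⟨_, fun i => encLin (rankVar (P.fn \ {i})) (D.lin i fun h => nomatch h), rfl, lf_encCPDer D,
      fun i => lf_encLin _, decCPDer_encCPDer D⟩, ?_⟩
  intro n T M W L hW hL
  -- The types in the LF context are encodings because the context is well formed.
  choose A hA using fun i => isCtx_blockCtx.1 hW.ctx (T i) (List.mem_ofFn.2 ⟨i, rfl⟩)
  obtain rfl : T = fun i => encTp (A i) := funext hA
  -- That `M` is a process is part of the well-formedness of the type of `W`.
  have hM : Chk (encCtx A) M .proc := by
    cases hW.type with
    | atom h =>
      cases h with
      | cons h _ => exact h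
  have hS := typedScope_encCtx A
  obtain ⟨P, rfl, -⟩ := hS.scope.proc_inv hM
  obtain ⟨S, rfl⟩ := hS.der_inv hW.term
  -- The term `L i` lives in a context without block `i` and is inverted there; the existence of a
  -- linearity derivation is all that is used of it.
  have lin (i : Fin n) : Nonempty (Lin i P) := by
    have h := (hL i).term
    rw [lamBlock_encProc] at h
    obtain ⟨l, -⟩ := (scope_eraseIdx _ i).lin_inv (x := i) (fun h => h rfl)
      (fun j _ => em (j = i)) h
    exact ⟨l⟩
  have hP : P.Linear := fun z _ => lin z
  obtain ⟨E, hE⟩ := Option.isSome_iff_exists.1 <|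
    delDer_isSome S (Ctx.full A) (fun _ _ h => h)
      (fun z => ⟨fun _ => (lin z).elim Lin.mem_fn, fun _ h => nomatch h⟩) hP
  -- This equality settles both remaining equations: the one on processes directly, the one on
  -- derivations by uniqueness.
  have e : eps (del P) = P := eps_del S hP
  refine ⟨A, del P, E, rfl, ?_, decCPDer_eq hE, ?_, encDer_eq_of_eq e _ _⟩
  · rw [decCP, decProc_encProc _ nameVar_injective, Option.map_some]
  · rw [encCP, e]
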